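/- Let $M$ be a closed smooth manifold of dimension $n\ge 3$ with a smooth Riemannian metric $g$, let $2^*=\frac{2n}{n-2}$, and let $[g]=\{w^{4/(n-2)}g:\ w\in C^\infty(M),\ w>0\}$ be its conformal class. For $h\in[g]$ let $R_h$ be the scalar curvature and $dV_h$ the Riemannian measure of $h$, let $H^1(M,h)$ be the Sobolev space of $L^2$ functions with $L^2$ gradient, $H^1_+(M,h)=\{u\in H^1(M,h): u>0 \text{ a.e.}\}$, and $$\langle u,v\rangle_h=4\tfrac{n-1}{n-2}\int_M h(\nabla_h u,\nabla_h v)\,dV_h+\int_M R_h\,uv\,dV_h,\qquad \|u\|_h=\sqrt{\langle u,u\rangle_h}.$$ Assume that $$\mathcal Y(M,[g])=\inf_{u\in H^1_+(M,g)}\frac{\langle u,u\rangle_g}{\|u\|^2_{L^{2^*}(M,g)}}>0 .$$ Let $h\in[g]$, $1\le p\le 2^*-1$ and $u\in H^1_+(M,h)$. Then the problem of minimizing $\langle v,v\rangle_h$ over all $v\in H^1_+(M,h)$ with $v\ge u$ a.e. has a unique solution $T_h(u)$, and $0<\|T_h(u)\|_{L^{p+1}(M,h)}<\infty$. With $$I^h_p(u)=\frac{\langle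 u,u\rangle_h}{\|T_h(u)\|^2_{L^{p+1}(M,h)}}$$ one has $$I_p^h(u)-I_p^h(T_h(u))=\frac{1}{\|T_h(u)\|^2_{L^{p+1}(M,h)}}\left[\|u\|_h^2-\|T_h(u)\|_h^2\right]\ge 0 .$$ Moreover, if $I_p^h(u)=I_p^h(T_h(u))$, then $T_h(u)=u$. -/

import Mathlib

open MeasureTheory Filter
open scoped Manifold ContDiff Topology ENNReal Matrix

noncomputable section

namespace ConformalObstacle

/-- Smooth Riemannian metrics on the `n`-dimensional smooth manifold `M` (without boundary). -/
abbrev Metric (n : ℕ) (M : Type*) [TopologicalSpace M]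
    [ChartedSpace (EuclideanSpace ℝ (Fin n)) M] [IsManifold (𝓡 n) ∞ M] : Type _ :=
  Bundle.ContMDiffRiemannianMetric (𝓡 n) ∞ (EuclideanSpace ℝ (Fin n))
    (fun x : M => TangentSpace (𝓡 n) x)

/-- The exponent `2^* = 2n/(n-2)`. -/
def critExp (n : ℕ) : ℝ := 2 * n / (n - 2)

/-! ### Local coordinate formulas

`G` is the matrix `(g_ij)` of a metric in local coordinates, a function of `y ∈ ℝⁿ`. -/

section Coordinates

variable {n : ℕ}

/-- The partial derivative `∂_i f (y)`. -/
def pd (i : Fin n) (f : EuclideanSpace ℝ (Fin n) → ℝ) (y : EuclideanSpace ℝ (Fin n)) : ℝ :=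
  fderiv ℝ f y (EuclideanSpace.single i 1)

/-- The Christoffel symbols `Γ^k_ij = ½ g^{kl} (∂_i g_jl + ∂_j g_il - ∂_l g_ij)`. -/
def christoffel (G : EuclideanSpace ℝ (Fin n) → Matrix (Fin n) (Fin n) ℝ) (k i j : Fin n)
    (y : EuclideanSpace ℝ (Fin n)) : ℝ :=
  (1 / 2) * ∑ l, (G y)⁻¹ k l *
    (pd i (fun z => G z j l) y + pd j (fun z => G z i l) y - pd l (fun z => G z i j) y)

/-- The Ricci curvature
`R_jk = ∂_i Γ^i_jk - ∂_j Γ^i_ik + Γ^i_il Γ^l_jk - Γ^i_jl Γ^l_ik` (sum over `i`, `l`). -/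
def ricci (G : EuclideanSpace ℝ (Fin n) → Matrix (Fin n) (Fin n) ℝ) (j k : Fin n)
    (y : EuclideanSpace ℝ (Fin n)) : ℝ :=
  ∑ i, (pd i (christoffel G i j k) y - pd j (christoffel G i i k) y
    + ∑ l, (christoffel G i i l y * christoffel G l j k y
      - christoffel G i j l y * christoffel G l i k y))

/-- The scalar curvature `g^{jk} R_jk`. -/
def coordScalar (G : EuclideanSpace ℝ (Fin n) → Matrix (Fin n) (Fin n) ℝ)
    (y : EuclideanSpace ℝ (Fin n)) : ℝ :=
  ∑ j, ∑ k, (G y)⁻¹ j k * ricci G j k y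

end Coordinates

section Manifold

variable {n : ℕ} {M : Type*} [TopologicalSpace M] [ChartedSpace (EuclideanSpace ℝ (Fin n)) M]
  [IsManifold (𝓡 n) ∞ M]

/-- The matrix `g_ij(y) = g(∂_i, ∂_j)` of `g` in the chart around `x₀`, for `y` in the target of
the chart. -/
def coordMetric (g : Metric n M) (x₀ : M) (y : EuclideanSpace ℝ (Fin n)) :
    Matrix (Fin n) (Fin n) ℝ :=
  Matrix.of fun i j =>
    g.inner ((extChartAt (𝓡 n) x₀).symm y)
      (mfderiv 𝓘(ℝ, EuclideanSpace ℝ (Fin n)) (𝓡 n) (extChartAt (𝓡 n) x₀).symm y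
        (EuclideanSpace.single i 1 : EuclideanSpace ℝ (Fin n)))
      (mfderiv 𝓘(ℝ, EuclideanSpace ℝ (Fin n)) (𝓡 n) (extChartAt (𝓡 n) x₀).symm y
        (EuclideanSpace.single j 1 : EuclideanSpace ℝ (Fin n)))

/-- The scalar curvature `R_g` at `x` (computed in the chart around `x`; the value does not depend
on the chart). -/
def scalarCurvature (g : Metric n M) (x : M) : ℝ :=
  coordScalar (coordMetric g x) (extChartAt (𝓡 n) x x)

/-- The conformal class `[g] = {w^{4/(n-2)} g : w ∈ C^∞(M), w > 0}`. -/
def conformalClass (g : Metric n M) : Set (Metric n M) :=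
  {h | ∃ w : M → ℝ, ContMDiff (𝓡 n) 𝓘(ℝ, ℝ) ∞ w ∧ (∀ x, 0 < w x) ∧
    ∀ (x : M) (a b : TangentSpace (𝓡 n) x),
      h.inner x a b = w x ^ (4 / ((n : ℝ) - 2)) * g.inner x a b}

/-- `g` as a bilinear form on the tangent space at `x`. -/
def metricForm (g : Metric n M) (x : M) : LinearMap.BilinForm ℝ (TangentSpace (𝓡 n) x) :=
  LinearMap.mk₂ ℝ (fun a b => g.inner x a b) (by intros; simp) (by intros; simp)
    (by intros; simp) (by intros; simp)

theorem metricForm_nondegenerate (g : Metric n M) (x : M) : (metricForm g x).Nondegenerate := by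
  constructor
  · intro a ha
    by_contra h
    exact (g.pos x a h).ne' (ha a)
  · intro a ha
    by_contra h
    exact (g.pos x a h).ne' (ha a)

instance (x : M) : FiniteDimensional ℝ (TangentSpace (𝓡 n) x) :=
  inferInstanceAs (FiniteDimensional ℝ (EuclideanSpace ℝ (Fin n)))

/-- The gradient of a differentiable function: `g(∇f, a) = df(a)` for all tangent vectors `a`. -/
def gradient (g : Metric n M) (f : M → ℝ) (x : M) : TangentSpace (𝓡 n) x :=
  ((metricForm g x).toDual (metricForm_nondegenerate g x)).symm
    (mfderiv (𝓡 n) 𝓘(ℝ, ℝ) f x).toLinearMap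

theorem inner_gradient (g : Metric n M) (f : M → ℝ) (x : M) (a : TangentSpace (𝓡 n) x) :
    g.inner x (gradient g f x) a = mfderiv (𝓡 n) 𝓘(ℝ, ℝ) f x a :=
  LinearMap.BilinForm.apply_toDual_symm_apply (B := metricForm g x)
    (hB := metricForm_nondegenerate g x) (mfderiv (𝓡 n) 𝓘(ℝ, ℝ) f x).toLinearMap a

/-- The length `|a|_g` of a tangent vector. -/
def tangentNorm (g : Metric n M) (x : M) (a : TangentSpace (𝓡 n) x) : ℝ :=
  √(g.inner x a a)

variable [MeasurableSpace M]

/-- The measure `√(det g_ij) dy` of the chart around `x₀`, transported to `M`; it is carried by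
the domain of the chart. -/
def chartVolume (g : Metric n M) (x₀ : M) : Measure M :=
  (((volume : Measure (EuclideanSpace ℝ (Fin n))).restrict (extChartAt (𝓡 n) x₀).target).withDensity
    (fun y => ENNReal.ofReal √((coordMetric g x₀ y).det))).map (extChartAt (𝓡 n) x₀).symm

/-- The Riemannian measure `dV_g`: the smallest measure dominating `√(det g_ij) dy` in every
chart. As these local measures agree on overlaps, it coincides with each of them on the domain of
the corresponding chart. -/
def vol (g : Metric n M) : Measure M := ⨆ x₀ : M, chartVolume g x₀

/-- `X` is the (weak) gradient of `u ∈ L²(M, g)`: there are smooth functions `φ_k` with `φ_k → u`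
in `L²` and `∇φ_k → X` in `L²`. -/
def HasWeakGradient (g : Metric n M) (u : Lp ℝ 2 (vol g)) (X : Π x : M, TangentSpace (𝓡 n) x) :
    Prop :=
  ∃ φ : ℕ → M → ℝ, (∀ k, ContMDiff (𝓡 n) 𝓘(ℝ, ℝ) ∞ (φ k)) ∧
    Tendsto (fun k => eLpNorm (fun x => φ k x - u x) 2 (vol g)) atTop (𝓝 0) ∧
    (∀ k, MemLp (fun x => tangentNorm g x (gradient g (φ k) x - X x)) 2 (vol g)) ∧
    Tendsto (fun k => eLpNorm (fun x => tangentNorm g x (gradient g (φ k) x - X x)) 2 (vol g))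
      atTop (𝓝 0)

/-- The Sobolev space `H¹(M, g)`: the closure of `C^∞(M)` in the norm
`(‖u‖²_{L²} + ‖∇u‖²_{L²})^{1/2}`, as a set of elements of `L²(M, g)`. -/
def H1 (g : Metric n M) : Set (Lp ℝ 2 (vol g)) := {u | ∃ X, HasWeakGradient g u X}

/-- `H¹_+(M, g) = {u ∈ H¹(M, g) : u > 0}`. -/
def H1pos (g : Metric n M) : Set (Lp ℝ 2 (vol g)) := {u | u ∈ H1 g ∧ ∀ᵐ x ∂(vol g), 0 < u x}

open Classical in
/-- The weak gradient of `u ∈ H¹(M, g)`, unique up to equality almost everywhere. -/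
def weakGradient (g : Metric n M) (u : Lp ℝ 2 (vol g)) : Π x : M, TangentSpace (𝓡 n) x :=
  if hu : ∃ X, HasWeakGradient g u X then hu.choose else 0

/-- `⟨u, v⟩_g = 4 (n-1)/(n-2) ∫ g(∇u, ∇v) dV_g + ∫ R_g u v dV_g`. -/
def form (g : Metric n M) (u v : Lp ℝ 2 (vol g)) : ℝ :=
  4 * ((n : ℝ) - 1) / ((n : ℝ) - 2)
      * ∫ x, g.inner x (weakGradient g u x) (weakGradient g v x) ∂(vol g)
    + ∫ x, scalarCurvature g x * u x * v x ∂(vol g)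

/-- `‖u‖_g = √⟨u, u⟩_g`. -/
def formNorm (g : Metric n M) (u : Lp ℝ 2 (vol g)) : ℝ := √(form g u u)

/-- The norm of `L^q(M, g)`. -/
def normLp (g : Metric n M) (q : ℝ) (u : Lp ℝ 2 (vol g)) : ℝ :=
  lpNorm u (ENNReal.ofReal q) (vol g)

/-- The Yamabe functional `J^g(u) = ⟨u, u⟩_g / ‖u‖²_{L^{2^*}}`. -/
def yamabeFunctional (g : Metric n M) (u : Lp ℝ 2 (vol g)) : ℝ :=
  form g u u / normLp g (critExp n) u ^ 2

/-- The Yamabe invariant `𝒴(M, [g])`, the infimum of `J^g` over `H¹_+(M, g)`. -/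
def yamabeInvariant (g : Metric n M) : ℝ := ⨅ u : H1pos g, yamabeFunctional g u

/-- `v` solves the obstacle problem `min {⟨v, v⟩_h : v ∈ H¹_+(M, h), v ≥ u}`. -/
def IsObstacleSolution (h : Metric n M) (u v : Lp ℝ 2 (vol h)) : Prop :=
  (v ∈ H1pos h ∧ u ≤ v) ∧ ∀ z : Lp ℝ 2 (vol h), z ∈ H1pos h → u ≤ z → form h v v ≤ form h z z

/-- The state map `T_h`: a solution of the obstacle problem with obstacle `u`. -/
def obstacleMap (h : Metric n M) (u : Lp ℝ 2 (vol h)) : Lp ℝ 2 (vol h) :=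
  Classical.epsilon (IsObstacleSolution h u)

/-- The functional `I_p^h(u) = ⟨u, u⟩_h / ‖T_h(u)‖²_{L^{p+1}}`. -/
def controlFunctional (h : Metric n M) (p : ℝ) (u : Lp ℝ 2 (vol h)) : ℝ :=
  form h u u / normLp h (p + 1) (obstacleMap h u) ^ 2

end Manifold

end ConformalObstacle

end

open ConformalObstacle

/-!
Along a conformal change `h = w^{4/(n-2)} g` the energy satisfies `⟨φ, φ⟩_h = ⟨wφ, wφ⟩_g` on smooth
functions (by the transformation law of the scalar curvature, with Green's formula for the cross
terms), while `‖φ‖_{L^{2^*}(h)} = ‖wφ‖_{L^{2^*}(g)}`. Positivity of the Yamabe invariant is thus a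
Sobolev inequality `𝒴 ‖u‖²_{L^{2^*}(h)} ≤ ⟨u, u⟩_h` for every `h ∈ [g]`; it passes from positive to
arbitrary functions by replacing `φ` with `√(φ² + ε²)`, which does not increase the Dirichlet
integral. As `M` has finite volume, `⟨·, ·⟩_h` is coercive on `H¹(M, h)`, and the parallelogram law
gives existence and uniqueness of the minimizer over the closed convex set `{v ≥ u}`. Since `T_h(u)`
solves its own obstacle problem, `T_h ∘ T_h = T_h`, which is the monotonicity formula; equality
makes `u` itself a minimizer.
-/

noncomputable section

namespace ConformalObstacle

section LeviCivita

variable {E F V W : Type*} [NormedAddCommGroup E] [NormedSpace ℝ E]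
  [NormedAddCommGroup F] [NormedSpace ℝ F] [NormedAddCommGroup V] [NormedSpace ℝ V]
  [NormedAddCommGroup W] [NormedSpace ℝ W]

theorem fderiv_clm_apply_const₂ {T : F → E →L[ℝ] V →L[ℝ] W} {y : F}
    (hT : DifferentiableAt ℝ T y) (a : F) (b : E) (c : V) :
    fderiv ℝ (fun z => T z b c) y a = fderiv ℝ T y a b c := by
  have hT' := (hT.hasFDerivAt.clm_apply (hasFDerivAt_const b y)).clm_apply (hasFDerivAt_const c y)
  rw [hT'.fderiv]
  simp

/-- `Γ` is the Levi-Civita connection of the field `B` of bilinear forms at `y`, in the form of the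
Koszul formula; `Γ z a b` is the Christoffel symbol `Γ^k_ij a^i b^j`. -/
def IsLeviCivita (B : E → E →L[ℝ] E →L[ℝ] ℝ) (Γ : E → E →L[ℝ] E →L[ℝ] E) (y : E) : Prop :=
  ∀ a b c, 2 * B y (Γ y a b) c = fderiv ℝ B y a b c + fderiv ℝ B y b a c - fderiv ℝ B y c a b

/-- The curvature tensor `R(a, b)c` of the connection `Γ`. -/
def curvature (Γ : E → E →L[ℝ] E →L[ℝ] E) (y a b c : E) : E :=
  fderiv ℝ Γ y a b c - fderiv ℝ Γ y b a c + Γ y a (Γ y b c) - Γ y b (Γ y a c)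

/-- The endomorphism `a ↦ R(a, b)c`, whose trace is the Ricci curvature. -/
def curvatureEnd (Γ : E → E →L[ℝ] E →L[ℝ] E) (y b c : E) : E →ₗ[ℝ] E where
  toFun a := curvature Γ y a b c
  map_add' a a' := by simp only [curvature, map_add, FunLike.coe_add, Pi.add_apply]; abel
  map_smul' t a := by simp [curvature, smul_sub, smul_add]

/-- The Ricci curvature of the connection `Γ`. -/
def ricciForm (Γ : E → E →L[ℝ] E →L[ℝ] E) (y : E) : LinearMap.BilinForm ℝ E :=
  LinearMap.mk₂ ℝ (fun b c => LinearMap.trace ℝ E (curvatureEnd Γ y b c))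
    (fun b b' c => by
      rw [← map_add]; congr 1; ext a
      simp only [curvatureEnd, curvature, LinearMap.coe_mk, AddHom.coe_mk, LinearMap.add_apply,
        map_add, add_apply]
      abel)
    (fun t b c => by
      rw [← map_smul]; congr 1; ext a
      simp only [curvatureEnd, curvature, LinearMap.coe_mk, AddHom.coe_mk, LinearMap.smul_apply,
        map_smul, smul_apply]
      module)
    (fun b c c' => by
      rw [← map_add]; congr 1; ext a
      simp only [curvatureEnd, curvature, LinearMap.coe_mk, AddHom.coe_mk, LinearMap.add_apply,
        map_add]
      abel)
    (fun t b c => by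
      rw [← map_smul]; congr 1; ext a
      simp only [curvatureEnd, curvature, LinearMap.coe_mk, AddHom.coe_mk, LinearMap.smul_apply,
        map_smul]
      module)

theorem ricciForm_apply (Γ : E → E →L[ℝ] E →L[ℝ] E) (y b c : E) :
    ricciForm Γ y b c = LinearMap.trace ℝ E (curvatureEnd Γ y b c) := rfl

section Pullback

variable {B B' : E → E →L[ℝ] E →L[ℝ] ℝ} {Γ Γ' : E → E →L[ℝ] E →L[ℝ] E} {ψ : E → E} {y : E}

theorem fderiv_pullback_form (hψ : ContDiffAt ℝ 2 ψ y) (hB : DifferentiableAt ℝ B (ψ y))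
    (hB' : DifferentiableAt ℝ B' y)
    (h : ∀ᶠ z in 𝓝 y, ∀ b c, B' z b c = B (ψ z) (fderiv ℝ ψ z b) (fderiv ℝ ψ z c)) (a b c : E) :
    fderiv ℝ B' y a b c = fderiv ℝ B (ψ y) (fderiv ℝ ψ y a) (fderiv ℝ ψ y b) (fderiv ℝ ψ y c)
      + B (ψ y) (fderiv ℝ (fderiv ℝ ψ) y a b) (fderiv ℝ ψ y c)
      + B (ψ y) (fderiv ℝ ψ y b) (fderiv ℝ (fderiv ℝ ψ) y a c) := by
  have hψ₁ : HasFDerivAt ψ (fderiv ℝ ψ y) y := (hψ.differentiableAt (by norm_num)).hasFDerivAt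
  have hψ₂ : HasFDerivAt (fderiv ℝ ψ) (fderiv ℝ (fderiv ℝ ψ) y) y :=
    ((hψ.fderiv_right (m := 1) (by norm_num)).differentiableAt (by norm_num)).hasFDerivAt
  have hBψ : HasFDerivAt (fun z => B (ψ z)) ((fderiv ℝ B (ψ y)).comp (fderiv ℝ ψ y)) y :=
    hB.hasFDerivAt.comp (G := E →L[ℝ] E →L[ℝ] ℝ) y hψ₁
  have hpull := (hBψ.clm_apply (hψ₂.clm_apply (hasFDerivAt_const b y))).clm_apply
    (hψ₂.clm_apply (hasFDerivAt_const c y))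
  rw [← fderiv_clm_apply_const₂ hB', (show (fun z => B' z b c) =ᶠ[𝓝 y] _ from
    h.mono fun z hz => hz b c).fderiv_eq, hpull.fderiv]
  simp only [ContinuousLinearMap.comp_zero, zero_add, ContinuousLinearMap.flip_add, add_apply,
    ContinuousLinearMap.comp_apply, ContinuousLinearMap.flip_apply]
  ring

/-- The inhomogeneous transformation law of Christoffel symbols. -/
theorem IsLeviCivita.pullback
    (hψ : ContDiffAt ℝ 2 ψ y) (hB : DifferentiableAt ℝ B (ψ y)) (hB' : DifferentiableAt ℝ B' y)
    (h : ∀ᶠ z in 𝓝 y, ∀ b c, B' z b c = B (ψ z) (fderiv ℝ ψ z b) (fderiv ℝ ψ z c))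
    (hΓ : IsLeviCivita B Γ (ψ y)) (hΓ' : IsLeviCivita B' Γ' y)
    (hsymm : ∀ a b, B (ψ y) a b = B (ψ y) b a)
    (hnondeg : ∀ v, (∀ w, B (ψ y) v w = 0) → v = 0)
    (hsurj : Function.Surjective (fderiv ℝ ψ y)) (a b : E) :
    fderiv ℝ ψ y (Γ' y a b) = Γ (ψ y) (fderiv ℝ ψ y a) (fderiv ℝ ψ y b)
      + fderiv ℝ (fderiv ℝ ψ) y a b := by
  have hψ₂ : ∀ a b, fderiv ℝ (fderiv ℝ ψ) y a b = fderiv ℝ (fderiv ℝ ψ) y b a :=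
    (hψ.isSymmSndFDerivAt (by simp)).eq
  rw [← sub_eq_zero]
  refine hnondeg _ fun w => ?_
  obtain ⟨c, rfl⟩ := hsurj w
  have koszul' := hΓ' a b c
  simp only [fderiv_pullback_form hψ hB hB' h, h.self_of_nhds] at koszul'
  have koszul := hΓ (fderiv ℝ ψ y a) (fderiv ℝ ψ y b) (fderiv ℝ ψ y c)
  rw [hψ₂ b a, hψ₂ c a, hψ₂ c b,
    hsymm (fderiv ℝ ψ y b) (fderiv ℝ (fderiv ℝ ψ) y a c)] at koszul'
  simp only [map_sub, map_add, FunLike.coe_sub, FunLike.coe_add, Pi.add_apply, Pi.sub_apply]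
  linarith

theorem fderiv_pullback_connection (hψ : ContDiffAt ℝ 3 ψ y)
    (hΓ : DifferentiableAt ℝ Γ (ψ y)) (hΓ' : DifferentiableAt ℝ Γ' y)
    (h : ∀ᶠ z in 𝓝 y, ∀ a b, fderiv ℝ ψ z (Γ' z a b) =
      Γ (ψ z) (fderiv ℝ ψ z a) (fderiv ℝ ψ z b) + fderiv ℝ (fderiv ℝ ψ) z a b) (d a b : E) :
    fderiv ℝ (fderiv ℝ ψ) y d (Γ' y a b) + fderiv ℝ ψ y (fderiv ℝ Γ' y d a b) =
      fderiv ℝ Γ (ψ y) (fderiv ℝ ψ y d) (fderiv ℝ ψ y a) (fderiv ℝ ψ y b)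
      + Γ (ψ y) (fderiv ℝ (fderiv ℝ ψ) y d a) (fderiv ℝ ψ y b)
      + Γ (ψ y) (fderiv ℝ ψ y a) (fderiv ℝ (fderiv ℝ ψ) y d b)
      + fderiv ℝ (fderiv ℝ (fderiv ℝ ψ)) y d a b := by
  have hψ' : ContDiffAt ℝ 2 (fderiv ℝ ψ) y := hψ.fderiv_right (by norm_num)
  have hψ₁ : HasFDerivAt ψ (fderiv ℝ ψ y) y := (hψ.differentiableAt (by norm_num)).hasFDerivAt
  have hψ₂ : HasFDerivAt (fderiv ℝ ψ) (fderiv ℝ (fderiv ℝ ψ) y) y :=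
    (hψ'.differentiableAt (by norm_num)).hasFDerivAt
  have hψ₃ : HasFDerivAt (fderiv ℝ (fderiv ℝ ψ)) (fderiv ℝ (fderiv ℝ (fderiv ℝ ψ)) y) y :=
    ((hψ'.fderiv_right (m := 1) (by norm_num)).differentiableAt (by norm_num)).hasFDerivAt
  have hleft := hψ₂.clm_apply ((hΓ'.hasFDerivAt.clm_apply (hasFDerivAt_const a y)).clm_apply
    (hasFDerivAt_const b y))
  have hright := (((hΓ.hasFDerivAt.comp y hψ₁).clm_apply
    (hψ₂.clm_apply (hasFDerivAt_const a y))).clm_apply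
    (hψ₂.clm_apply (hasFDerivAt_const b y))).add
    ((hψ₃.clm_apply (hasFDerivAt_const a y)).clm_apply (hasFDerivAt_const b y))
  have heq := DFunLike.congr_fun ((hleft.congr_of_eventuallyEq
    (h.mono fun z hz => (hz a b).symm)).unique hright) d
  simp only [ContinuousLinearMap.comp_zero, zero_add, add_apply, ContinuousLinearMap.comp_apply,
    ContinuousLinearMap.flip_apply, Function.comp_apply, ContinuousLinearMap.flip_add] at heq
  rw [add_comm, heq]
  abel

theorem curvature_pullback (hψ : ContDiffAt ℝ 3 ψ y)
    (hΓ : DifferentiableAt ℝ Γ (ψ y)) (hΓ' : DifferentiableAt ℝ Γ' y)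
    (h : ∀ᶠ z in 𝓝 y, ∀ a b, fderiv ℝ ψ z (Γ' z a b) =
      Γ (ψ z) (fderiv ℝ ψ z a) (fderiv ℝ ψ z b) + fderiv ℝ (fderiv ℝ ψ) z a b) (a b c : E) :
    fderiv ℝ ψ y (curvature Γ' y a b c) =
      curvature Γ (ψ y) (fderiv ℝ ψ y a) (fderiv ℝ ψ y b) (fderiv ℝ ψ y c) := by
  have hψ₂ : fderiv ℝ (fderiv ℝ ψ) y a b = fderiv ℝ (fderiv ℝ ψ) y b a :=
    ((hψ.of_le (by norm_num)).isSymmSndFDerivAt (n := 2) (by simp)).eq a b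
  have hψ₃ : fderiv ℝ (fderiv ℝ (fderiv ℝ ψ)) y a b = fderiv ℝ (fderiv ℝ (fderiv ℝ ψ)) y b a :=
    ((hψ.fderiv_right (m := 2) (by norm_num)).isSymmSndFDerivAt (by simp)).eq a b
  have hab := fderiv_pullback_connection hψ hΓ hΓ' h a b c
  have hba := fderiv_pullback_connection hψ hΓ hΓ' h b a c
  rw [hψ₃, hψ₂] at hab
  simp only [curvature, map_add, map_sub, h.self_of_nhds]
  linear_combination (norm := module) hab - hba

theorem ricciForm_pullback (hψ : ContDiffAt ℝ 3 ψ y)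
    (hΓ : DifferentiableAt ℝ Γ (ψ y)) (hΓ' : DifferentiableAt ℝ Γ' y)
    (h : ∀ᶠ z in 𝓝 y, ∀ a b, fderiv ℝ ψ z (Γ' z a b) =
      Γ (ψ z) (fderiv ℝ ψ z a) (fderiv ℝ ψ z b) + fderiv ℝ (fderiv ℝ ψ) z a b)
    (hbij : Function.Bijective (fderiv ℝ ψ y)) (b c : E) :
    ricciForm Γ' y b c = ricciForm Γ (ψ y) (fderiv ℝ ψ y b) (fderiv ℝ ψ y c) := by
  let e : E ≃ₗ[ℝ] E := LinearEquiv.ofBijective (fderiv ℝ ψ y).toLinearMap hbij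
  rw [ricciForm_apply, ricciForm_apply, ← LinearMap.trace_conj' (curvatureEnd Γ' y b c) e]
  congr 1
  ext a
  obtain ⟨a, rfl⟩ := e.surjective a
  rw [LinearEquiv.conj_apply_apply, e.symm_apply_apply]
  exact curvature_pullback hψ hΓ hΓ' h a b c

end Pullback

variable {B B' : E → E →L[ℝ] E →L[ℝ] ℝ} {Γ Γ' : E → E →L[ℝ] E →L[ℝ] E} {y : E}

theorem fderiv_apply_comm_of_symm (hB : DifferentiableAt ℝ B y)
    (hsymm : ∀ᶠ z in 𝓝 y, ∀ a b, B z a b = B z b a) (a b c : E) :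
    fderiv ℝ B y a b c = fderiv ℝ B y a c b := by
  rw [← fderiv_clm_apply_const₂ hB, ← fderiv_clm_apply_const₂ hB, Filter.EventuallyEq.fderiv_eq]
  exact hsymm.mono fun z hz => hz b c

namespace IsLeviCivita

theorem unique (hΓ : IsLeviCivita B Γ y) (hΓ' : IsLeviCivita B Γ' y)
    (hnondeg : ∀ v, (∀ w, B y v w = 0) → v = 0) : Γ y = Γ' y := by
  ext1 a
  ext1 b
  rw [← sub_eq_zero]
  refine hnondeg _ fun c => ?_
  simp only [map_sub, FunLike.coe_sub, Pi.sub_apply]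
  linarith [hΓ a b c, hΓ' a b c]

theorem torsionFree (hΓ : IsLeviCivita B Γ y) (hB : DifferentiableAt ℝ B y)
    (hsymm : ∀ᶠ z in 𝓝 y, ∀ a b, B z a b = B z b a)
    (hnondeg : ∀ v, (∀ w, B y v w = 0) → v = 0) (a b : E) : Γ y a b = Γ y b a := by
  rw [← sub_eq_zero]
  refine hnondeg _ fun c => ?_
  simp only [map_sub, FunLike.coe_sub, Pi.sub_apply]
  linarith [hΓ a b c, hΓ b a c, fderiv_apply_comm_of_symm hB hsymm c a b]

theorem metricCompatible (hΓ : IsLeviCivita B Γ y) (hB : DifferentiableAt ℝ B y)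
    (hsymm : ∀ᶠ z in 𝓝 y, ∀ a b, B z a b = B z b a) (a b c : E) :
    fderiv ℝ B y a b c = B y (Γ y a b) c + B y b (Γ y a c) := by
  rw [hsymm.self_of_nhds b]
  linarith [hΓ a b c, hΓ a c b, fderiv_apply_comm_of_symm hB hsymm a b c]

end IsLeviCivita

/-- The covariant derivative of the vector field `N` as an endomorphism. -/
def covDeriv (Γ : E → E →L[ℝ] E →L[ℝ] E) (N : E → E) (y : E) : E →L[ℝ] E :=
  fderiv ℝ N y + (Γ y).flip (N y)

/-- The covariant Hessian of `f`. -/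
def covHessian (Γ : E → E →L[ℝ] E →L[ℝ] E) (f : E → ℝ) (y : E) (a b : E) : ℝ :=
  fderiv ℝ (fderiv ℝ f) y a b - fderiv ℝ f y (Γ y a b)

theorem covHessian_pullback {f : E → ℝ} {ψ : E → E} (hψ : ContDiffAt ℝ 2 ψ y)
    (hf : ContDiffAt ℝ 2 f (ψ y))
    (h : ∀ a b, fderiv ℝ ψ y (Γ' y a b) =
      Γ (ψ y) (fderiv ℝ ψ y a) (fderiv ℝ ψ y b) + fderiv ℝ (fderiv ℝ ψ) y a b) (a b : E) :
    covHessian Γ' (f ∘ ψ) y a b = covHessian Γ f (ψ y) (fderiv ℝ ψ y a) (fderiv ℝ ψ y b) := by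
  have hψ₁ : DifferentiableAt ℝ ψ y := hψ.differentiableAt (by norm_num)
  have hψ₂ : HasFDerivAt (fderiv ℝ ψ) (fderiv ℝ (fderiv ℝ ψ) y) y :=
    ((hψ.fderiv_right (m := 1) (by norm_num)).differentiableAt (by norm_num)).hasFDerivAt
  have hf₂ : HasFDerivAt (fderiv ℝ f) (fderiv ℝ (fderiv ℝ f) (ψ y)) (ψ y) :=
    ((hf.fderiv_right (m := 1) (by norm_num)).differentiableAt (by norm_num)).hasFDerivAt
  have hchain : fderiv ℝ (f ∘ ψ) =ᶠ[𝓝 y] fun z => (fderiv ℝ f (ψ z)).comp (fderiv ℝ ψ z) := by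
    filter_upwards [hψ.eventually (by simp), hψ.continuousAt.eventually (hf.eventually (by simp))]
      with z hψz hfz
    exact fderiv_comp z (hfz.differentiableAt (by norm_num)) (hψz.differentiableAt (by norm_num))
  have hsecond : HasFDerivAt (fun z => (fderiv ℝ f (ψ z)).comp (fderiv ℝ ψ z)) _ y :=
    (hf₂.comp y hψ₁.hasFDerivAt).clm_comp hψ₂
  rw [covHessian, covHessian, hchain.fderiv_eq, hchain.self_of_nhds, hsecond.fderiv]
  simp only [add_apply, ContinuousLinearMap.comp_apply, ContinuousLinearMap.compL_apply,
    ContinuousLinearMap.flip_apply, Function.comp_apply, h, map_add]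
  ring

theorem IsLeviCivita.inner_covDeriv_gradient {f : E → ℝ} {N : E → E} (hΓ : IsLeviCivita B Γ y)
    (hB : DifferentiableAt ℝ B y) (hsymm : ∀ᶠ z in 𝓝 y, ∀ a b, B z a b = B z b a)
    (hf : ContDiffAt ℝ 2 f y) (hN : DifferentiableAt ℝ N y)
    (hfN : ∀ᶠ z in 𝓝 y, ∀ a, B z (N z) a = fderiv ℝ f z a) (a c : E) :
    B y (covDeriv Γ N y a) c = covHessian Γ f y a c := by
  have hf₂ : HasFDerivAt (fderiv ℝ f) (fderiv ℝ (fderiv ℝ f) y) y :=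
    ((hf.fderiv_right (m := 1) (by norm_num)).differentiableAt (by norm_num)).hasFDerivAt
  have hleft := (hB.hasFDerivAt.clm_apply hN.hasFDerivAt).clm_apply (hasFDerivAt_const c y)
  have hright := hf₂.clm_apply (hasFDerivAt_const c y)
  have heq := DFunLike.congr_fun
    ((hright.congr_of_eventuallyEq (hfN.mono fun z hz => hz c)).unique hleft) a
  simp only [ContinuousLinearMap.comp_zero, zero_add, ContinuousLinearMap.flip_apply,
    ContinuousLinearMap.flip_add, add_apply, ContinuousLinearMap.comp_apply] at heq
  rw [covHessian, heq, hΓ.metricCompatible hB hsymm, ← hfN.self_of_nhds]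
  simp only [covDeriv, add_apply, ContinuousLinearMap.flip_apply, map_add]
  ring

/-- The difference of the Levi-Civita connections of `e^{2f} B` and `B`, where `df = l` and the
gradient of `f` is `N`. -/
def conformalShift (β : E →L[ℝ] E →L[ℝ] ℝ) (l : E →L[ℝ] ℝ) (N : E) : E →L[ℝ] E →L[ℝ] E :=
  l.smulRight (ContinuousLinearMap.id ℝ E) + (l.smulRight (ContinuousLinearMap.id ℝ E)).flip
    - ((ContinuousLinearMap.smulRightL ℝ E E).flip N).comp β

@[simp] theorem conformalShift_apply (β : E →L[ℝ] E →L[ℝ] ℝ) (l : E →L[ℝ] ℝ) (N a b : E) :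
    conformalShift β l N a b = l a • b + l b • a - β a b • N := by
  simp [conformalShift]

theorem fderiv_exp_smul_form {f : E → ℝ} (hB : DifferentiableAt ℝ B y)
    (hf : DifferentiableAt ℝ f y) (hB' : DifferentiableAt ℝ B' y)
    (h : ∀ᶠ z in 𝓝 y, B' z = Real.exp (2 * f z) • B z) (a b c : E) :
    fderiv ℝ B' y a b c =
      Real.exp (2 * f y) * (2 * fderiv ℝ f y a * B y b c + fderiv ℝ B y a b c) := by
  have hBbc := (hB.hasFDerivAt.clm_apply (hasFDerivAt_const b y)).clm_apply (hasFDerivAt_const c y)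
  have hprod : HasFDerivAt (fun z => B' z b c) _ y :=
    (((hf.hasFDerivAt.const_mul 2).exp).mul hBbc).congr_of_eventuallyEq
      (h.mono fun z hz => by simp [hz])
  rw [← fderiv_clm_apply_const₂ hB', hprod.fderiv]
  simp only [ContinuousLinearMap.comp_zero, zero_add, add_apply, smul_apply,
    ContinuousLinearMap.flip_apply, smul_eq_mul]
  ring

theorem IsLeviCivita.conformal {f : E → ℝ} {N : E} (hΓ : IsLeviCivita B Γ y)
    (hB : DifferentiableAt ℝ B y) (hf : DifferentiableAt ℝ f y)
    (hN : ∀ a, B y N a = fderiv ℝ f y a)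
    (hB' : DifferentiableAt ℝ B' y) (h : ∀ᶠ z in 𝓝 y, B' z = Real.exp (2 * f z) • B z)
    (hΓ' : Γ' y = Γ y + conformalShift (B y) (fderiv ℝ f y) N) : IsLeviCivita B' Γ' y := by
  intro a b c
  simp only [fderiv_exp_smul_form hB hf hB' h, hΓ', h.self_of_nhds, FunLike.coe_add, Pi.add_apply,
    FunLike.coe_smul, Pi.smul_apply, conformalShift_apply, map_add, map_sub, map_smul,
    FunLike.coe_sub, Pi.sub_apply, smul_eq_mul, hN]
  linear_combination Real.exp (2 * f y) * hΓ a b c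

theorem fderiv_conformal_connection {f : E → ℝ} {N : E → E} (hB : DifferentiableAt ℝ B y)
    (hΓ : DifferentiableAt ℝ Γ y) (hΓ' : DifferentiableAt ℝ Γ' y)
    (hf : ContDiffAt ℝ 2 f y) (hN : DifferentiableAt ℝ N y)
    (h : ∀ᶠ z in 𝓝 y, Γ' z = Γ z + conformalShift (B z) (fderiv ℝ f z) (N z)) (a b c : E) :
    fderiv ℝ Γ' y a b c = fderiv ℝ Γ y a b c
      + (fderiv ℝ (fderiv ℝ f) y a b • c + fderiv ℝ (fderiv ℝ f) y a c • b
        - (fderiv ℝ B y a b c) • N y - B y b c • fderiv ℝ N y a) := by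
  have hf₂ : HasFDerivAt (fderiv ℝ f) (fderiv ℝ (fderiv ℝ f) y) y :=
    ((hf.fderiv_right (m := 1) (by norm_num)).differentiableAt (by norm_num)).hasFDerivAt
  have hdf (b : E) : HasFDerivAt (fun z => fderiv ℝ f z b) _ y :=
    hf₂.clm_apply (hasFDerivAt_const b y)
  have hBbc := (hB.hasFDerivAt.clm_apply (hasFDerivAt_const b y)).clm_apply (hasFDerivAt_const c y)
  have hΓbc := (hΓ.hasFDerivAt.clm_apply (hasFDerivAt_const b y)).clm_apply (hasFDerivAt_const c y)
  have hsum := hΓbc.add ((((hdf b).smul (hasFDerivAt_const c y)).add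
    ((hdf c).smul (hasFDerivAt_const b y))).sub (hBbc.smul hN.hasFDerivAt))
  have hΓ'bc : HasFDerivAt (fun z => Γ' z b c) _ y :=
    hsum.congr_of_eventuallyEq (h.mono fun z hz => by simp [hz])
  rw [← fderiv_clm_apply_const₂ hΓ', hΓ'bc.fderiv]
  simp only [ContinuousLinearMap.comp_zero, zero_add, smul_zero, add_apply,
    ContinuousLinearMap.flip_apply, sub_apply, ContinuousLinearMap.smulRight_apply, smul_apply,
    add_right_inj]
  module

section Ricci

variable {f : E → ℝ} {N : E → E}

theorem curvature_conformal (hLC : IsLeviCivita B Γ y) (hB : DifferentiableAt ℝ B y)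
    (hΓ : DifferentiableAt ℝ Γ y) (hΓ' : DifferentiableAt ℝ Γ' y)
    (hsymm : ∀ᶠ z in 𝓝 y, ∀ a b, B z a b = B z b a)
    (hnondeg : ∀ v, (∀ w, B y v w = 0) → v = 0)
    (hf : ContDiffAt ℝ 2 f y) (hN : DifferentiableAt ℝ N y)
    (hfN : ∀ a, B y (N y) a = fderiv ℝ f y a)
    (h : ∀ᶠ z in 𝓝 y, Γ' z = Γ z + conformalShift (B z) (fderiv ℝ f z) (N z)) (a b c : E) :
    curvature Γ' y a b c = curvature Γ y a b c + covHessian Γ f y a c • b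
      + B y a c • (covDeriv Γ N y b + fderiv ℝ f y (N y) • b - fderiv ℝ f y b • N y)
      + fderiv ℝ f y a • (B y b c • N y - fderiv ℝ f y c • b)
      + (fderiv ℝ f y b * fderiv ℝ f y c - fderiv ℝ f y (N y) * B y b c
          - covHessian Γ f y b c) • a
      - B y b c • covDeriv Γ N y a := by
  have hsymm₀ := hsymm.self_of_nhds
  have hf₂ : fderiv ℝ (fderiv ℝ f) y b a = fderiv ℝ (fderiv ℝ f) y a b :=
    (hf.isSymmSndFDerivAt (by simp)).eq b a
  simp only [curvature, fderiv_conformal_connection hB hΓ hΓ' hf hN h,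
    hLC.metricCompatible hB hsymm, h.self_of_nhds, add_apply, conformalShift_apply, map_add,
    map_sub, map_smul, smul_add, covHessian, covDeriv, ContinuousLinearMap.flip_apply]
  rw [hLC.torsionFree hB hsymm hnondeg b a, hf₂, hsymm₀ a (Γ y b c), hsymm₀ b (Γ y a c),
    hsymm₀ a b, hsymm₀ a (N y), hsymm₀ b (N y)]
  simp only [hfN]
  module

theorem ricciForm_conformal [FiniteDimensional ℝ E] (hLC : IsLeviCivita B Γ y)
    (hB : DifferentiableAt ℝ B y)
    (hΓ : DifferentiableAt ℝ Γ y) (hΓ' : DifferentiableAt ℝ Γ' y)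
    (hsymm : ∀ᶠ z in 𝓝 y, ∀ a b, B z a b = B z b a)
    (hnondeg : ∀ v, (∀ w, B y v w = 0) → v = 0)
    (hf : ContDiffAt ℝ 2 f y) (hN : DifferentiableAt ℝ N y)
    (hfN : ∀ᶠ z in 𝓝 y, ∀ a, B z (N z) a = fderiv ℝ f z a)
    (h : ∀ᶠ z in 𝓝 y, Γ' z = Γ z + conformalShift (B z) (fderiv ℝ f z) (N z)) (b c : E) :
    ricciForm Γ' y b c = ricciForm Γ y b c + (2 - Module.finrank ℝ E) * covHessian Γ f y b c
      - LinearMap.trace ℝ E (covDeriv Γ N y) * B y b c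
      + (Module.finrank ℝ E - 2) * (fderiv ℝ f y b * fderiv ℝ f y c
        - fderiv ℝ f y (N y) * B y b c) := by
  have hN₀ := hfN.self_of_nhds
  have hdecomp : curvatureEnd Γ' y b c = curvatureEnd Γ y b c
      + ((fderiv ℝ (fderiv ℝ f) y).flip c - (fderiv ℝ f y).comp ((Γ y).flip c)
          : E →L[ℝ] ℝ).toLinearMap.smulRight b
      + ((B y).flip c).toLinearMap.smulRight (covDeriv Γ N y b + fderiv ℝ f y (N y) • b
          - fderiv ℝ f y b • N y)
      + (fderiv ℝ f y).toLinearMap.smulRight (B y b c • N y - fderiv ℝ f y c • b)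
      + (fderiv ℝ f y b * fderiv ℝ f y c - fderiv ℝ f y (N y) * B y b c
          - covHessian Γ f y b c) • LinearMap.id
      - B y b c • (covDeriv Γ N y).toLinearMap :=
    LinearMap.ext fun a =>
      curvature_conformal hLC hB hΓ hΓ' hsymm hnondeg hf hN hN₀ h a b c
  have hHess := hLC.inner_covDeriv_gradient hB hsymm hf hN hfN b c
  rw [ricciForm_apply, hdecomp]
  simp only [map_add, map_sub, LinearMap.trace_smulRight, map_smul, LinearMap.trace_id]
  simp only [ContinuousLinearMap.toLinearMap_sub, ContinuousLinearMap.toLinearMap_comp,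
    LinearMap.sub_apply, ContinuousLinearMap.coe_coe, ContinuousLinearMap.flip_apply,
    LinearMap.coe_comp, Function.comp_apply, hHess, smul_eq_mul, hN₀]
  simp only [covHessian, ricciForm_apply]
  ring

end Ricci

end LeviCivita

section MatrixCalculus

variable {ι X : Type*} [Fintype ι] [DecidableEq ι] [NormedAddCommGroup X] [NormedSpace ℝ X]
  {A : X → Matrix ι ι ℝ} {s : Set X} {m : WithTop ℕ∞} {y : X}

theorem contDiffOn_det (h : ∀ i j, ContDiffOn ℝ m (fun z => A z i j) s) :
    ContDiffOn ℝ m (fun z => (A z).det) s := by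
  simp only [Matrix.det_apply]
  exact ContDiffOn.sum fun σ _ => (contDiffOn_prod fun i _ => h _ _).const_smul _

theorem contDiffOn_matrix_inv (h : ∀ i j, ContDiffOn ℝ m (fun z => A z i j) s)
    (hdet : ∀ z ∈ s, (A z).det ≠ 0) (i j : ι) : ContDiffOn ℝ m (fun z => (A z)⁻¹ i j) s := by
  simp only [Matrix.inv_def, Matrix.smul_apply, Ring.inverse_eq_inv', smul_eq_mul,
    Matrix.adjugate_apply]
  refine ((contDiffOn_det h).inv hdet).mul (contDiffOn_det fun k l => ?_)
  by_cases hk : k = j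
  · subst hk
    simpa using contDiffOn_const
  · simpa [Matrix.updateRow_ne hk] using h k l

theorem det_updateCol_eq_sum_adjugate (A : Matrix ι ι ℝ) (i : ι) (v : ι → ℝ) :
    (A.updateCol i v).det = ∑ j, A.adjugate i j * v j := by
  rw [← Matrix.cramer_apply, Matrix.cramer_eq_adjugate_mulVec]
  rfl

theorem fderiv_det (h : ∀ i j, DifferentiableAt ℝ (fun z => A z i j) y) (v : X) :
    fderiv ℝ (fun z => (A z).det) y v =
      ∑ i, ∑ j, (A y).adjugate i j * fderiv ℝ (fun z => A z j i) y v := by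
  have hdet : HasFDerivAt (fun z => (A z).det) (∑ σ : Equiv.Perm ι, (Equiv.Perm.sign σ) •
      ∑ i, (∏ j ∈ Finset.univ.erase i, A y (σ j) j) • fderiv ℝ (fun z => A z (σ i) i) y) y := by
    simp only [Matrix.det_apply]
    exact HasFDerivAt.fun_sum fun σ _ =>
      (HasFDerivAt.finsetProd fun i _ => (h (σ i) i).hasFDerivAt).const_smul _
  rw [hdet.fderiv]
  simp only [← det_updateCol_eq_sum_adjugate, Matrix.det_apply]
  rw [Finset.sum_comm]
  simp only [FunLike.coe_sum, Finset.sum_apply, FunLike.coe_smul, Pi.smul_apply, Finset.smul_sum]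
  refine Finset.sum_congr rfl fun σ _ => Finset.sum_congr rfl fun i _ => ?_
  congr 1
  rw [← Finset.mul_prod_erase Finset.univ _ (Finset.mem_univ i), Matrix.updateCol_self, mul_comm,
    smul_eq_mul]
  congr 1
  exact Finset.prod_congr rfl fun j hj => by rw [Matrix.updateCol_ne (Finset.ne_of_mem_erase hj)]

end MatrixCalculus

section CoordinateMetric

variable {n : ℕ}

local notation "𝔼" => EuclideanSpace ℝ (Fin n)
local notation "𝐞[" i "]" => EuclideanSpace.single i (1 : ℝ)

theorem sum_smul_single (a : 𝔼) : ∑ i, a i • 𝐞[i] = a := by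
  ext j
  simp [Finset.sum_apply, Pi.single_apply]

theorem euclidean_induction {P : 𝔼 → Prop} (zero : P 0) (single : ∀ i, P 𝐞[i])
    (add : ∀ a b, P a → P b → P (a + b)) (smul : ∀ (t : ℝ) a, P a → P (t • a)) (a : 𝔼) : P a := by
  rw [← sum_smul_single a]
  exact Finset.sum_induction _ P add zero fun i _ => smul _ _ (single i)

theorem trace_eq_sum (T : 𝔼 →ₗ[ℝ] 𝔼) : LinearMap.trace ℝ 𝔼 T = ∑ i, T 𝐞[i] i := by
  rw [LinearMap.trace_eq_sum_inner T (EuclideanSpace.basisFun (Fin n) ℝ)]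
  simp [EuclideanSpace.inner_single_left]

/-- The bilinear form with matrix `A`. -/
def bilin (A : Matrix (Fin n) (Fin n) ℝ) : 𝔼 →L[ℝ] 𝔼 →L[ℝ] ℝ :=
  ∑ i, ∑ j, A i j • (EuclideanSpace.proj i : 𝔼 →L[ℝ] ℝ).smulRight
    (EuclideanSpace.proj j : 𝔼 →L[ℝ] ℝ)

theorem bilin_apply (A : Matrix (Fin n) (Fin n) ℝ) (a b : 𝔼) :
    bilin A a b = a.ofLp ⬝ᵥ A *ᵥ b.ofLp := by
  simp [bilin, dotProduct, Matrix.mulVec, Finset.mul_sum, mul_left_comm]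

@[simp] theorem bilin_single (A : Matrix (Fin n) (Fin n) ℝ) (i j : Fin n) :
    bilin A 𝐞[i] 𝐞[j] = A i j := by
  simp [bilin_apply]

theorem bilin_comm {A : Matrix (Fin n) (Fin n) ℝ} (h : A.IsSymm) (a b : 𝔼) :
    bilin A a b = bilin A b a := by
  rw [bilin_apply, bilin_apply, dotProduct_comm, ← Matrix.vecMul_transpose, h.eq,
    ← Matrix.dotProduct_mulVec]

theorem bilin_smul (t : ℝ) (A : Matrix (Fin n) (Fin n) ℝ) : bilin (t • A) = t • bilin A := by
  ext a b
  simp [bilin_apply, Matrix.smul_mulVec]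

/-- The vector with components `A^{ij} v_j`: the covector `v` with its index raised by `A`. -/
def raise (A : Matrix (Fin n) (Fin n) ℝ) (v : Fin n → ℝ) : 𝔼 :=
  WithLp.toLp 2 (A⁻¹ *ᵥ v)

theorem bilin_raise_single {A : Matrix (Fin n) (Fin n) ℝ} (hA : A.IsSymm) (hdet : A.det ≠ 0)
    (v : Fin n → ℝ) (j : Fin n) : bilin A (raise A v) 𝐞[j] = v j := by
  rw [bilin_comm hA, bilin_apply, raise, Matrix.mulVec_mulVec,
    Matrix.mul_nonsing_inv A hdet.isUnit]
  simp

theorem raise_bilin_single {A : Matrix (Fin n) (Fin n) ℝ} (hA : A.IsSymm) (hdet : A.det ≠ 0)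
    (a : 𝔼) : raise A (fun j => bilin A a 𝐞[j]) = a := by
  have hrow : (fun j => bilin A a 𝐞[j]) = A *ᵥ a.ofLp :=
    funext fun j => by simp [bilin_comm hA a, bilin_apply]
  rw [hrow, raise, Matrix.mulVec_mulVec, Matrix.nonsing_inv_mul A hdet.isUnit, Matrix.one_mulVec]

/-- The trace of the bilinear form `R` with respect to the metric with matrix `A`. -/
def metricTrace (A : Matrix (Fin n) (Fin n) ℝ) (R : 𝔼 → 𝔼 → ℝ) : ℝ :=
  ∑ j, ∑ k, A⁻¹ j k * R 𝐞[j] 𝐞[k]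

theorem metricTrace_eq_trace {A : Matrix (Fin n) (Fin n) ℝ} (hA : A.IsSymm) (hdet : A.det ≠ 0)
    {R : 𝔼 → 𝔼 → ℝ} {T : 𝔼 →ₗ[ℝ] 𝔼} (hT : ∀ a b, bilin A (T a) b = R a b) :
    metricTrace A R = LinearMap.trace ℝ 𝔼 T := by
  rw [trace_eq_sum]
  refine Finset.sum_congr rfl fun j _ => ?_
  rw [← raise_bilin_single hA hdet (T 𝐞[j])]
  simp only [hT]
  rfl

theorem exists_endomorphism_of_bilinForm {A : Matrix (Fin n) (Fin n) ℝ} (hA : A.IsSymm)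
    (hdet : A.det ≠ 0) (R : LinearMap.BilinForm ℝ 𝔼) :
    ∃ T : 𝔼 →ₗ[ℝ] 𝔼, ∀ a b, bilin A (T a) b = R a b := by
  refine ⟨(WithLp.linearEquiv 2 ℝ (Fin n → ℝ)).symm.toLinearMap ∘ₗ A⁻¹.mulVecLin ∘ₗ
    LinearMap.pi fun k => R.flip 𝐞[k], fun a b => ?_⟩
  induction b using euclidean_induction with
  | zero => simp only [map_zero]
  | single j => exact bilin_raise_single hA hdet (fun k => R a 𝐞[k]) j
  | add b b' hb hb' => rw [map_add, map_add, hb, hb']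
  | smul t b hb => rw [map_smul, map_smul, hb]

theorem IsLeviCivita.of_single {B : 𝔼 → 𝔼 →L[ℝ] 𝔼 →L[ℝ] ℝ} {Γ : 𝔼 → 𝔼 →L[ℝ] 𝔼 →L[ℝ] 𝔼}
    {y : 𝔼} (h : ∀ i j k, 2 * B y (Γ y 𝐞[i] 𝐞[j]) 𝐞[k] = fderiv ℝ B y 𝐞[i] 𝐞[j] 𝐞[k]
      + fderiv ℝ B y 𝐞[j] 𝐞[i] 𝐞[k] - fderiv ℝ B y 𝐞[k] 𝐞[i] 𝐞[j]) :
    IsLeviCivita B Γ y := by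
  intro a b c
  induction c using euclidean_induction with
  | zero => simp
  | add c c' hc hc' => simp only [map_add, add_apply]; linear_combination hc + hc'
  | smul t c hc => simp only [map_smul, smul_apply, smul_eq_mul]; linear_combination t * hc
  | single k =>
    induction b using euclidean_induction with
    | zero => simp
    | add b b' hb hb' => simp only [map_add, add_apply]; linear_combination hb + hb'
    | smul t b hb => simp only [map_smul, smul_apply, smul_eq_mul]; linear_combination t * hb
    | single j =>
      induction a using euclidean_induction with
      | zero => simp
      | add a a' ha ha' => simp only [map_add, add_apply]; linear_combination ha + ha'
      | smul t a ha => simp only [map_smul, smul_apply, smul_eq_mul]; linear_combination t * ha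
      | single i => exact h i j k

/-- `G` is the matrix of a smooth Riemannian metric on the open set `U`. -/
structure IsSmoothMetric (G : 𝔼 → Matrix (Fin n) (Fin n) ℝ) (U : Set 𝔼) : Prop where
  isOpen : IsOpen U
  contDiffOn : ∀ i j, ContDiffOn ℝ ∞ (fun z => G z i j) U
  symm : ∀ z ∈ U, (G z).IsSymm
  pos : ∀ z ∈ U, ∀ a, a ≠ 0 → 0 < bilin (G z) a a

/-- The Levi-Civita connection of `G`, with components the Christoffel symbols. -/
def conn (G : 𝔼 → Matrix (Fin n) (Fin n) ℝ) (y : 𝔼) : 𝔼 →L[ℝ] 𝔼 →L[ℝ] 𝔼 :=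
  ∑ k, ∑ i, ∑ j, christoffel G k i j y • (EuclideanSpace.proj i : 𝔼 →L[ℝ] ℝ).smulRight
    ((EuclideanSpace.proj j : 𝔼 →L[ℝ] ℝ).smulRight 𝐞[k])

theorem conn_single (G : 𝔼 → Matrix (Fin n) (Fin n) ℝ) (y : 𝔼) (i j k : Fin n) :
    conn G y 𝐞[i] 𝐞[j] k = christoffel G k i j y := by
  simp [conn, Finset.sum_apply, Pi.single_apply]

theorem contDiffOn_pd {f : 𝔼 → ℝ} {U : Set 𝔼} (hU : IsOpen U) (hf : ContDiffOn ℝ ∞ f U)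
    (i : Fin n) : ContDiffOn ℝ ∞ (pd i f) U :=
  (hf.fderiv_of_isOpen hU (by simp)).clm_apply contDiffOn_const

/-- The gradient of `f` in coordinates. -/
def coordGrad (G : 𝔼 → Matrix (Fin n) (Fin n) ℝ) (f : 𝔼 → ℝ) (y : 𝔼) : 𝔼 :=
  raise (G y) fun j => pd j f y

/-- The Laplacian of `f` in coordinates. -/
def coordLap (G : 𝔼 → Matrix (Fin n) (Fin n) ℝ) (f : 𝔼 → ℝ) (y : 𝔼) : ℝ :=
  LinearMap.trace ℝ 𝔼 (covDeriv (conn G) (coordGrad G f) y)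

namespace IsSmoothMetric

variable {G : EuclideanSpace ℝ (Fin n) → Matrix (Fin n) (Fin n) ℝ}
  {U : Set (EuclideanSpace ℝ (Fin n))} {f : EuclideanSpace ℝ (Fin n) → ℝ}
  {y : EuclideanSpace ℝ (Fin n)}

theorem det_pos (hG : IsSmoothMetric G U) (hy : y ∈ U) : 0 < (G y).det := by
  refine Matrix.PosDef.det_pos (Matrix.PosDef.of_dotProduct_mulVec_pos ?_ fun {x} hx => ?_)
  · rw [Matrix.IsHermitian, Matrix.conjTranspose_eq_transpose_of_trivial]
    exact hG.symm y hy
  · simpa [bilin_apply] using hG.pos y hy (WithLp.toLp 2 x) (by simpa using hx)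

theorem nondegenerate (hG : IsSmoothMetric G U) (hy : y ∈ U) (v : 𝔼)
    (h : ∀ w, bilin (G y) v w = 0) : v = 0 := by
  by_contra hv
  exact (hG.pos y hy v hv).ne' (h v)

theorem eventually_symm (hG : IsSmoothMetric G U) (hy : y ∈ U) :
    ∀ᶠ z in 𝓝 y, ∀ a b, bilin (G z) a b = bilin (G z) b a :=
  (hG.isOpen.eventually_mem hy).mono fun z hz => bilin_comm (hG.symm z hz)

theorem contDiffOn_inv (hG : IsSmoothMetric G U) (i j : Fin n) :
    ContDiffOn ℝ ∞ (fun z => (G z)⁻¹ i j) U :=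
  contDiffOn_matrix_inv hG.contDiffOn (fun _ hz => (hG.det_pos hz).ne') i j

theorem contDiffOn_christoffel (hG : IsSmoothMetric G U) (k i j : Fin n) :
    ContDiffOn ℝ ∞ (christoffel G k i j) U :=
  contDiffOn_const.mul (ContDiffOn.sum fun l _ => (hG.contDiffOn_inv k l).mul
    (((contDiffOn_pd hG.isOpen (hG.contDiffOn j l) i).add
      (contDiffOn_pd hG.isOpen (hG.contDiffOn i l) j)).sub
      (contDiffOn_pd hG.isOpen (hG.contDiffOn i j) l)))

theorem contDiffOn_bilin (hG : IsSmoothMetric G U) : ContDiffOn ℝ ∞ (fun z => bilin (G z)) U :=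
  ContDiffOn.sum fun i _ => ContDiffOn.sum fun j _ =>
    (ContinuousLinearMap.toSpanSingleton ℝ _).contDiff.comp_contDiffOn (hG.contDiffOn i j)

theorem contDiffOn_conn (hG : IsSmoothMetric G U) : ContDiffOn ℝ ∞ (conn G) U :=
  ContDiffOn.sum fun k _ => ContDiffOn.sum fun i _ => ContDiffOn.sum fun j _ =>
    (ContinuousLinearMap.toSpanSingleton ℝ _).contDiff.comp_contDiffOn
      (hG.contDiffOn_christoffel k i j)

theorem contDiffOn_coordGrad (hG : IsSmoothMetric G U) (hf : ContDiffOn ℝ ∞ f U) :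
    ContDiffOn ℝ ∞ (coordGrad G f) U :=
  contDiffOn_euclidean.2 fun i => ContDiffOn.sum (s := Finset.univ) fun j _ =>
    (hG.contDiffOn_inv i j).mul (contDiffOn_pd hG.isOpen hf j)

theorem differentiableAt_of_contDiffOn {V : Type*} [NormedAddCommGroup V] [NormedSpace ℝ V]
    {F : 𝔼 → V} (hG : IsSmoothMetric G U) (hF : ContDiffOn ℝ ∞ F U) (hy : y ∈ U) :
    DifferentiableAt ℝ F y :=
  (hF.contDiffAt (hG.isOpen.mem_nhds hy)).differentiableAt (by simp)

theorem differentiableAt_bilin (hG : IsSmoothMetric G U) (hy : y ∈ U) :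
    DifferentiableAt ℝ (fun z => bilin (G z)) y :=
  hG.differentiableAt_of_contDiffOn hG.contDiffOn_bilin hy

theorem differentiableAt_conn (hG : IsSmoothMetric G U) (hy : y ∈ U) :
    DifferentiableAt ℝ (conn G) y :=
  hG.differentiableAt_of_contDiffOn hG.contDiffOn_conn hy

theorem differentiableAt_coordGrad (hG : IsSmoothMetric G U) (hf : ContDiffOn ℝ ∞ f U)
    (hy : y ∈ U) : DifferentiableAt ℝ (coordGrad G f) y :=
  hG.differentiableAt_of_contDiffOn (hG.contDiffOn_coordGrad hf) hy

theorem bilin_coordGrad (hG : IsSmoothMetric G U) (hy : y ∈ U) (f : 𝔼 → ℝ) (a : 𝔼) :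
    bilin (G y) (coordGrad G f y) a = fderiv ℝ f y a := by
  induction a using euclidean_induction with
  | zero => simp only [map_zero]
  | single j => exact bilin_raise_single (hG.symm y hy) (hG.det_pos hy).ne' _ j
  | add a b ha hb => rw [map_add, map_add, ha, hb]
  | smul t a ha => rw [map_smul, map_smul, ha]

theorem isLeviCivita_conn (hG : IsSmoothMetric G U) (hy : y ∈ U) :
    IsLeviCivita (fun z => bilin (G z)) (conn G) y := by
  refine IsLeviCivita.of_single fun i j k => ?_
  have hconn : conn G y 𝐞[i] 𝐞[j] = (1 / 2 : ℝ) • raise (G y) fun l =>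
      pd i (fun z => G z j l) y + pd j (fun z => G z i l) y - pd l (fun z => G z i j) y := by
    ext k
    rw [conn_single]
    rfl
  simp only [hconn, map_smul, smul_apply, smul_eq_mul,
    bilin_raise_single (hG.symm y hy) (hG.det_pos hy).ne',
    ← fderiv_clm_apply_const₂ (hG.differentiableAt_bilin hy), bilin_single, pd]
  ring

end IsSmoothMetric

end CoordinateMetric

section ScalarCurvature

variable {n : ℕ}

local notation "𝔼" => EuclideanSpace ℝ (Fin n)
local notation "𝐞[" i "]" => EuclideanSpace.single i (1 : ℝ)

theorem conn_single_apply (G : 𝔼 → Matrix (Fin n) (Fin n) ℝ) (y v : 𝔼) (i k : Fin n) :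
    conn G y 𝐞[i] v k = ∑ j, christoffel G k i j y * v j := by
  conv_lhs => rw [← sum_smul_single v]
  simp [conn_single, mul_comm]

theorem metricTrace_smul {A : Matrix (Fin n) (Fin n) ℝ} {t : ℝ} (ht : t ≠ 0) (hdet : A.det ≠ 0)
    (R : 𝔼 → 𝔼 → ℝ) : metricTrace (t • A) R = t⁻¹ * metricTrace A R := by
  have hinv : (t • A)⁻¹ = t⁻¹ • A⁻¹ := Matrix.inv_smul' A (Units.mk0 t ht) hdet.isUnit
  simp only [metricTrace, hinv, Matrix.smul_apply, smul_eq_mul, Finset.mul_sum, mul_assoc]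

theorem metricTrace_bilin {A : Matrix (Fin n) (Fin n) ℝ} (hA : A.IsSymm) (hdet : A.det ≠ 0) :
    metricTrace A (fun a b => bilin A a b) = n := by
  rw [metricTrace_eq_trace hA hdet (R := fun a b => bilin A a b) (T := LinearMap.id)
    fun a b => rfl, LinearMap.trace_id, finrank_euclideanSpace_fin]

theorem metricTrace_pullback {A A' : Matrix (Fin n) (Fin n) ℝ} (hA : A.IsSymm) (hdet : A.det ≠ 0)
    (hA' : A'.IsSymm) (hdet' : A'.det ≠ 0) (e : 𝔼 ≃ₗ[ℝ] 𝔼)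
    (h : ∀ a b, bilin A' a b = bilin A (e a) (e b)) {R : 𝔼 → 𝔼 → ℝ} {T : 𝔼 →ₗ[ℝ] 𝔼}
    (hT : ∀ a b, bilin A (T a) b = R a b) :
    metricTrace A' (fun a b => R (e a) (e b)) = metricTrace A R := by
  rw [metricTrace_eq_trace hA hdet hT, ← LinearMap.trace_conj' T e.symm]
  refine metricTrace_eq_trace hA' hdet' fun a b => ?_
  rw [h, LinearEquiv.conj_apply_apply, e.apply_symm_apply, hT, LinearEquiv.symm_symm]

namespace IsSmoothMetric

variable {G G' : EuclideanSpace ℝ (Fin n) → Matrix (Fin n) (Fin n) ℝ}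
  {U U' : Set (EuclideanSpace ℝ (Fin n))} {f : EuclideanSpace ℝ (Fin n) → ℝ}
  {y : EuclideanSpace ℝ (Fin n)}

theorem fderiv_conn_single (hG : IsSmoothMetric G U) (hy : y ∈ U) (i j k l : Fin n) :
    fderiv ℝ (conn G) y 𝐞[i] 𝐞[j] 𝐞[k] l = pd i (christoffel G l j k) y := by
  have hconn := ((hG.differentiableAt_conn hy).clm_apply
    (differentiableAt_const 𝐞[j])).clm_apply (differentiableAt_const 𝐞[k])
  have hcomp : christoffel G l j k =
      (EuclideanSpace.proj l : 𝔼 →L[ℝ] ℝ) ∘ fun z => conn G z 𝐞[j] 𝐞[k] :=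
    funext fun z => (conn_single G z j k l).symm
  rw [pd, hcomp, ((EuclideanSpace.proj l : 𝔼 →L[ℝ] ℝ).hasFDerivAt.comp y hconn.hasFDerivAt).fderiv,
    ContinuousLinearMap.comp_apply, fderiv_clm_apply_const₂ (hG.differentiableAt_conn hy)]
  rfl

theorem ricci_eq (hG : IsSmoothMetric G U) (hy : y ∈ U) (j k : Fin n) :
    ricci G j k y = ricciForm (conn G) y 𝐞[j] 𝐞[k] := by
  rw [ricciForm_apply, trace_eq_sum, ricci]
  refine Finset.sum_congr rfl fun i _ => ?_
  simp only [curvatureEnd, curvature, LinearMap.coe_mk, AddHom.coe_mk, PiLp.add_apply,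
    PiLp.sub_apply, hG.fderiv_conn_single hy, conn_single_apply _ _ (conn G y _ _), conn_single,
    Finset.sum_sub_distrib, add_sub_assoc]

theorem coordScalar_eq (hG : IsSmoothMetric G U) (hy : y ∈ U) :
    coordScalar G y = metricTrace (G y) (fun a b => ricciForm (conn G) y a b) := by
  simp only [coordScalar, metricTrace, hG.ricci_eq hy]

theorem bilin_covDeriv_coordGrad (hG : IsSmoothMetric G U) (hf : ContDiffOn ℝ ∞ f U) (hy : y ∈ U)
    (a b : 𝔼) :
    bilin (G y) (covDeriv (conn G) (coordGrad G f) y a) b = covHessian (conn G) f y a b :=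
  (hG.isLeviCivita_conn hy).inner_covDeriv_gradient (hG.differentiableAt_bilin hy)
    (hG.eventually_symm hy) (contDiffAt_infty.1 (hf.contDiffAt (hG.isOpen.mem_nhds hy)) 2)
    (hG.differentiableAt_coordGrad hf hy)
    ((hG.isOpen.eventually_mem hy).mono fun _ hz => hG.bilin_coordGrad hz f) a b

theorem metricTrace_covHessian (hG : IsSmoothMetric G U) (hf : ContDiffOn ℝ ∞ f U) (hy : y ∈ U) :
    metricTrace (G y) (covHessian (conn G) f y) = coordLap G f y :=
  metricTrace_eq_trace (hG.symm y hy) (hG.det_pos hy).ne' (hG.bilin_covDeriv_coordGrad hf hy)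

section Pullback

variable {ψ : EuclideanSpace ℝ (Fin n) → EuclideanSpace ℝ (Fin n)}

theorem bijective_fderiv_of_pullback (hG' : IsSmoothMetric G' U') (hy : y ∈ U')
    (h : ∀ a b, bilin (G' y) a b = bilin (G (ψ y)) (fderiv ℝ ψ y a) (fderiv ℝ ψ y b)) :
    Function.Bijective (fderiv ℝ ψ y) := by
  have hinj : Function.Injective (fderiv ℝ ψ y).toLinearMap := by
    rw [← LinearMap.ker_eq_bot, LinearMap.ker_eq_bot']
    intro a ha
    replace ha : fderiv ℝ ψ y a = 0 := ha
    exact hG'.nondegenerate hy a fun b => by rw [h, ha, map_zero, zero_apply]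
  exact ⟨hinj, LinearMap.surjective_of_injective hinj⟩

theorem conn_pullback (hG : IsSmoothMetric G U) (hG' : IsSmoothMetric G' U')
    (hψ : ContDiffOn ℝ ∞ ψ U') (hU : Set.MapsTo ψ U' U)
    (h : ∀ z ∈ U', ∀ a b, bilin (G' z) a b = bilin (G (ψ z)) (fderiv ℝ ψ z a) (fderiv ℝ ψ z b))
    (hy : y ∈ U') (a b : 𝔼) : fderiv ℝ ψ y (conn G' y a b) =
      conn G (ψ y) (fderiv ℝ ψ y a) (fderiv ℝ ψ y b) + fderiv ℝ (fderiv ℝ ψ) y a b :=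
  IsLeviCivita.pullback (contDiffAt_infty.1 (hψ.contDiffAt (hG'.isOpen.mem_nhds hy)) 2)
    (hG.differentiableAt_bilin (hU hy)) (hG'.differentiableAt_bilin hy)
    ((hG'.isOpen.eventually_mem hy).mono h) (hG.isLeviCivita_conn (hU hy))
    (hG'.isLeviCivita_conn hy) (bilin_comm (hG.symm _ (hU hy))) (hG.nondegenerate (hU hy))
    (hG'.bijective_fderiv_of_pullback hy (h y hy)).2 a b

theorem coordScalar_pullback (hG : IsSmoothMetric G U) (hG' : IsSmoothMetric G' U')
    (hψ : ContDiffOn ℝ ∞ ψ U') (hU : Set.MapsTo ψ U' U)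
    (h : ∀ z ∈ U', ∀ a b, bilin (G' z) a b = bilin (G (ψ z)) (fderiv ℝ ψ z a) (fderiv ℝ ψ z b))
    (hy : y ∈ U') : coordScalar G' y = coordScalar G (ψ y) := by
  have hbij := hG'.bijective_fderiv_of_pullback hy (h y hy)
  have hric := ricciForm_pullback
    (contDiffAt_infty.1 (hψ.contDiffAt (hG'.isOpen.mem_nhds hy)) 3)
    (hG.differentiableAt_conn (hU hy)) (hG'.differentiableAt_conn hy)
    ((hG'.isOpen.eventually_mem hy).mono fun z hz => hG.conn_pullback hG' hψ hU h hz) hbij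
  obtain ⟨T, hT⟩ := exists_endomorphism_of_bilinForm (hG.symm _ (hU hy)) (hG.det_pos (hU hy)).ne'
    (ricciForm (conn G) (ψ y))
  rw [hG.coordScalar_eq (hU hy), hG'.coordScalar_eq hy]
  simp only [hric]
  exact metricTrace_pullback (R := fun b c => ricciForm (conn G) (ψ y) b c)
    (hG.symm _ (hU hy)) (hG.det_pos (hU hy)).ne' (hG'.symm _ hy) (hG'.det_pos hy).ne'
    (LinearEquiv.ofBijective (fderiv ℝ ψ y).toLinearMap hbij) (h y hy) hT

theorem coordLap_pullback (hG : IsSmoothMetric G U) (hG' : IsSmoothMetric G' U')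
    (hψ : ContDiffOn ℝ ∞ ψ U') (hU : Set.MapsTo ψ U' U)
    (h : ∀ z ∈ U', ∀ a b, bilin (G' z) a b = bilin (G (ψ z)) (fderiv ℝ ψ z a) (fderiv ℝ ψ z b))
    (hf : ContDiffOn ℝ ∞ f U) (hy : y ∈ U') :
    coordLap G' (f ∘ ψ) y = coordLap G f (ψ y) := by
  have hbij := hG'.bijective_fderiv_of_pullback hy (h y hy)
  have hhess := covHessian_pullback
    (contDiffAt_infty.1 (hψ.contDiffAt (hG'.isOpen.mem_nhds hy)) 2)
    (contDiffAt_infty.1 (hf.contDiffAt (hG.isOpen.mem_nhds (hU hy))) 2)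
    (hG.conn_pullback hG' hψ hU h hy)
  rw [← hG.metricTrace_covHessian hf (hU hy), ← hG'.metricTrace_covHessian (hf.comp hψ hU) hy,
    funext₂ hhess]
  exact metricTrace_pullback (hG.symm _ (hU hy)) (hG.det_pos (hU hy)).ne' (hG'.symm _ hy)
    (hG'.det_pos hy).ne' (LinearEquiv.ofBijective (fderiv ℝ ψ y).toLinearMap hbij) (h y hy)
    (hG.bilin_covDeriv_coordGrad hf (hU hy))

end Pullback

theorem metricTrace_fderiv_mul_fderiv (hG : IsSmoothMetric G U) (hy : y ∈ U) (f : 𝔼 → ℝ) :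
    metricTrace (G y) (fun a b => fderiv ℝ f y a * fderiv ℝ f y b)
      = fderiv ℝ f y (coordGrad G f y) := by
  rw [metricTrace_eq_trace (hG.symm y hy) (hG.det_pos hy).ne'
    (T := (fderiv ℝ f y).toLinearMap.smulRight (coordGrad G f y)) fun a b => by
      simp [hG.bilin_coordGrad hy f]]
  simp

section Conformal

theorem conformal (hG : IsSmoothMetric G U) (hf : ContDiffOn ℝ ∞ f U)
    (hG' : ∀ z ∈ U, G' z = Real.exp (2 * f z) • G z) : IsSmoothMetric G' U where
  isOpen := hG.isOpen
  contDiffOn i j := ((contDiffOn_const.mul hf).exp.mul (hG.contDiffOn i j)).congr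
    fun z hz => by rw [hG' z hz, Matrix.smul_apply, smul_eq_mul]
  symm z hz := by rw [hG' z hz]; exact (hG.symm z hz).smul _
  pos z hz a ha := by
    rw [hG' z hz, bilin_smul]
    exact mul_pos (Real.exp_pos _) (hG.pos z hz a ha)

theorem conn_conformal (hG : IsSmoothMetric G U) (hf : ContDiffOn ℝ ∞ f U)
    (hG' : ∀ z ∈ U, G' z = Real.exp (2 * f z) • G z) (hy : y ∈ U) :
    conn G' y = conn G y + conformalShift (bilin (G y)) (fderiv ℝ f y) (coordGrad G f y) := by
  have hm := hG.conformal hf hG'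
  have hLC := (hG.isLeviCivita_conn hy).conformal
    (Γ' := fun z => conn G z + conformalShift (bilin (G z)) (fderiv ℝ f z) (coordGrad G f z))
    (hG.differentiableAt_bilin hy) (hG.differentiableAt_of_contDiffOn hf hy)
    (hG.bilin_coordGrad hy f) (hm.differentiableAt_bilin hy)
    ((hG.isOpen.eventually_mem hy).mono fun z hz => by rw [hG' z hz, bilin_smul]) rfl
  exact (hm.isLeviCivita_conn hy).unique hLC (hm.nondegenerate hy)

theorem coordScalar_conformal (hG : IsSmoothMetric G U) (hf : ContDiffOn ℝ ∞ f U)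
    (hG' : ∀ z ∈ U, G' z = Real.exp (2 * f z) • G z) (hy : y ∈ U) :
    coordScalar G' y = Real.exp (-(2 * f y)) * (coordScalar G y
      - 2 * ((n : ℝ) - 1) * coordLap G f y
      - ((n : ℝ) - 1) * ((n : ℝ) - 2) * fderiv ℝ f y (coordGrad G f y)) := by
  have hm := hG.conformal hf hG'
  have hric (b c : 𝔼) : ricciForm (conn G') y b c = ricciForm (conn G) y b c
      + (2 - n) * covHessian (conn G) f y b c - coordLap G f y * bilin (G y) b c
      + (n - 2) * (fderiv ℝ f y b * fderiv ℝ f y c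
        - fderiv ℝ f y (coordGrad G f y) * bilin (G y) b c) := by
    rw [ricciForm_conformal (hG.isLeviCivita_conn hy) (hG.differentiableAt_bilin hy)
      (hG.differentiableAt_conn hy) (hm.differentiableAt_conn hy) (hG.eventually_symm hy)
      (hG.nondegenerate hy) (contDiffAt_infty.1 (hf.contDiffAt (hG.isOpen.mem_nhds hy)) 2)
      (hG.differentiableAt_coordGrad hf hy)
      ((hG.isOpen.eventually_mem hy).mono fun _ hz => hG.bilin_coordGrad hz f)
      ((hG.isOpen.eventually_mem hy).mono fun _ hz => hG.conn_conformal hf hG' hz) b c,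
      finrank_euclideanSpace_fin]
    rfl
  have htrace : metricTrace (G y) (fun a b => ricciForm (conn G') y a b) =
      metricTrace (G y) (fun a b => ricciForm (conn G) y a b)
        + (2 - n) * metricTrace (G y) (covHessian (conn G) f y)
        - coordLap G f y * metricTrace (G y) (fun a b => bilin (G y) a b)
        + (n - 2) * (metricTrace (G y) (fun a b => fderiv ℝ f y a * fderiv ℝ f y b)
          - fderiv ℝ f y (coordGrad G f y) * metricTrace (G y) (fun a b => bilin (G y) a b)) := by
    simp only [metricTrace, hric, Finset.mul_sum, ← Finset.sum_add_distrib,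
      ← Finset.sum_sub_distrib]
    refine Finset.sum_congr rfl fun i _ => Finset.sum_congr rfl fun j _ => ?_
    ring
  rw [hm.coordScalar_eq hy, hG.coordScalar_eq hy, hG' y hy,
    metricTrace_smul (Real.exp_ne_zero _) (hG.det_pos hy).ne', htrace,
    hG.metricTrace_covHessian hf hy, metricTrace_bilin (hG.symm y hy) (hG.det_pos hy).ne',
    hG.metricTrace_fderiv_mul_fderiv hy, Real.exp_neg]
  ring

end Conformal

section Divergence

theorem pd_symm (hG : IsSmoothMetric G U) (hy : y ∈ U) (i k l : Fin n) :
    pd i (fun z => G z k l) y = pd i (fun z => G z l k) y := by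
  rw [pd, pd, Filter.EventuallyEq.fderiv_eq]
  exact (hG.isOpen.eventually_mem hy).mono fun z hz => (hG.symm z hz).apply l k

theorem sum_christoffel (hG : IsSmoothMetric G U) (hy : y ∈ U) (i : Fin n) :
    ∑ k, christoffel G k k i y =
      (1 / 2) * ∑ k, ∑ l, (G y)⁻¹ k l * pd i (fun z => G z l k) y := by
  have hcancel : ∑ k, ∑ l, (G y)⁻¹ k l * pd l (fun z => G z k i) y
      = ∑ k, ∑ l, (G y)⁻¹ k l * pd k (fun z => G z i l) y := by
    rw [Finset.sum_comm]
    refine Finset.sum_congr rfl fun k _ => Finset.sum_congr rfl fun l _ => ?_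
    rw [(hG.symm y hy).inv.apply k l, hG.pd_symm hy]
  simp only [christoffel, ← Finset.mul_sum, mul_sub, mul_add, Finset.sum_add_distrib,
    Finset.sum_sub_distrib, hcancel, hG.pd_symm hy i]
  ring

theorem pd_sqrt_det (hG : IsSmoothMetric G U) (hy : y ∈ U) (i : Fin n) :
    pd i (fun z => √((G z).det)) y = √((G y).det) * ∑ k, christoffel G k k i y := by
  have hdet := hG.det_pos hy
  have hpd : fderiv ℝ (fun z => (G z).det) y 𝐞[i]
      = (G y).det * ∑ k, ∑ l, (G y)⁻¹ k l * pd i (fun z => G z l k) y := by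
    rw [fderiv_det fun k l => hG.differentiableAt_of_contDiffOn (hG.contDiffOn k l) hy]
    simp only [Finset.mul_sum]
    refine Finset.sum_congr rfl fun k _ => Finset.sum_congr rfl fun l _ => ?_
    rw [Matrix.inv_def, Matrix.smul_apply, Ring.inverse_eq_inv', smul_eq_mul, ← mul_assoc,
      mul_inv_cancel_left₀ hdet.ne', pd]
  rw [pd, fderiv_sqrt (hG.differentiableAt_of_contDiffOn (contDiffOn_det hG.contDiffOn) hy)
    hdet.ne', smul_apply, hpd, hG.sum_christoffel hy, smul_eq_mul]
  have hsqrt : √((G y).det) ≠ 0 := (Real.sqrt_pos.2 hdet).ne'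
  field_simp
  rw [Real.sq_sqrt hdet.le]

theorem coordLap_eq_sum (G : 𝔼 → Matrix (Fin n) (Fin n) ℝ) (f : 𝔼 → ℝ) (y : 𝔼) :
    coordLap G f y = ∑ i, (fderiv ℝ (coordGrad G f) y 𝐞[i] i
      + (∑ k, christoffel G k k i y) * coordGrad G f y i) := by
  have hconn : ∑ i, conn G y 𝐞[i] (coordGrad G f y) i
      = ∑ i, (∑ k, christoffel G k k i y) * coordGrad G f y i := by
    simp only [conn_single_apply, Finset.sum_mul]
    exact Finset.sum_comm
  rw [Finset.sum_add_distrib, ← hconn, ← Finset.sum_add_distrib, coordLap, trace_eq_sum]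
  rfl

theorem sqrt_det_mul_coordLap (hG : IsSmoothMetric G U) (hf : ContDiffOn ℝ ∞ f U) (hy : y ∈ U) :
    ∑ i, pd i (fun z => √((G z).det) * coordGrad G f z i) y = √((G y).det) * coordLap G f y := by
  have hgrad (i : Fin n) : HasFDerivAt (fun z => coordGrad G f z i)
      ((EuclideanSpace.proj i : 𝔼 →L[ℝ] ℝ).comp (fderiv ℝ (coordGrad G f) y)) y :=
    (EuclideanSpace.proj i : 𝔼 →L[ℝ] ℝ).hasFDerivAt.comp y
      (hG.differentiableAt_coordGrad hf hy).hasFDerivAt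
  have hsqrt : DifferentiableAt ℝ (fun z => √((G z).det)) y :=
    (hG.differentiableAt_of_contDiffOn (contDiffOn_det hG.contDiffOn) hy).sqrt
      (hG.det_pos hy).ne'
  rw [coordLap_eq_sum, Finset.mul_sum]
  refine Finset.sum_congr rfl fun i _ => ?_
  rw [pd, fderiv_fun_mul hsqrt (hgrad i).differentiableAt, (hgrad i).fderiv, add_apply, smul_apply,
    smul_apply, show fderiv ℝ (fun z => √((G z).det)) y 𝐞[i] = _ from hG.pd_sqrt_det hy i]
  simp only [ContinuousLinearMap.comp_apply, PiLp.proj_apply, smul_eq_mul]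
  ring

end Divergence

end IsSmoothMetric

end ScalarCurvature
section CoordinateSmoothness

variable {n : ℕ}

namespace IsSmoothMetric

variable {G : EuclideanSpace ℝ (Fin n) → Matrix (Fin n) (Fin n) ℝ}
  {U V : Set (EuclideanSpace ℝ (Fin n))} {f : EuclideanSpace ℝ (Fin n) → ℝ}

theorem mono (hG : IsSmoothMetric G U) (hV : IsOpen V) (h : V ⊆ U) : IsSmoothMetric G V where
  isOpen := hV
  contDiffOn i j := (hG.contDiffOn i j).mono h
  symm z hz := hG.symm z (h hz)
  pos z hz := hG.pos z (h hz)

theorem contDiffOn_coordScalar (hG : IsSmoothMetric G U) : ContDiffOn ℝ ∞ (coordScalar G) U := by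
  have hΓ := hG.contDiffOn_christoffel
  refine ContDiffOn.sum fun j _ => ContDiffOn.sum fun k _ => (hG.contDiffOn_inv j k).mul ?_
  refine ContDiffOn.sum fun i _ => ((contDiffOn_pd hG.isOpen (hΓ i j k) i).sub
    (contDiffOn_pd hG.isOpen (hΓ i i k) j)).add (ContDiffOn.sum fun l _ => ?_)
  exact ((hΓ i i l).mul (hΓ l j k)).sub ((hΓ i j l).mul (hΓ l i k))

theorem sqrt_det_pos (hG : IsSmoothMetric G U) {y : EuclideanSpace ℝ (Fin n)} (hy : y ∈ U) :
    0 < √((G y).det) :=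
  Real.sqrt_pos.2 (hG.det_pos hy)

theorem contDiffOn_sqrt_det (hG : IsSmoothMetric G U) :
    ContDiffOn ℝ ∞ (fun z => √((G z).det)) U :=
  (contDiffOn_det hG.contDiffOn).sqrt fun _ hz => (hG.det_pos hz).ne'

theorem contDiffOn_coordLap (hG : IsSmoothMetric G U) (hf : ContDiffOn ℝ ∞ f U) :
    ContDiffOn ℝ ∞ (coordLap G f) U := by
  have hdivergence : ContDiffOn ℝ ∞ (fun y => (√((G y).det))⁻¹ *
      ∑ i, pd i (fun z => √((G z).det) * coordGrad G f z i) y) U :=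
    (hG.contDiffOn_sqrt_det.inv fun z hz => (hG.sqrt_det_pos hz).ne').mul <|
      ContDiffOn.sum fun i _ => contDiffOn_pd hG.isOpen (hG.contDiffOn_sqrt_det.mul
        (contDiffOn_euclidean.1 (hG.contDiffOn_coordGrad hf) i)) i
  refine hdivergence.congr fun y hy => ?_
  rw [hG.sqrt_det_mul_coordLap hf hy, inv_mul_cancel_left₀ (hG.sqrt_det_pos hy).ne']

end IsSmoothMetric

end CoordinateSmoothness

section Charts

variable {n : ℕ} {M : Type*} [TopologicalSpace M] [ChartedSpace (EuclideanSpace ℝ (Fin n)) M]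

local notation "𝔼" => EuclideanSpace ℝ (Fin n)
local notation "𝐞[" i "]" => EuclideanSpace.single i (1 : ℝ)

/-- The differential of the chart around `x₀`. -/
def dchart (x₀ x : M) : TangentSpace (𝓡 n) x →L[ℝ] EuclideanSpace ℝ (Fin n) :=
  mfderiv (𝓡 n) 𝓘(ℝ, EuclideanSpace ℝ (Fin n)) (extChartAt (𝓡 n) x₀) x

/-- The differential of the inverse of the chart around `x₀`: it maps the standard basis to the
coordinate frame. -/
def frame (x₀ : M) (y : EuclideanSpace ℝ (Fin n)) :
    EuclideanSpace ℝ (Fin n) →L[ℝ] TangentSpace (𝓡 n) ((extChartAt (𝓡 n) x₀).symm y) :=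
  mfderiv 𝓘(ℝ, EuclideanSpace ℝ (Fin n)) (𝓡 n) (extChartAt (𝓡 n) x₀).symm y

/-- The coordinate change from the chart around `x₀` to the chart around `x₁`. -/
def coordChange (x₀ x₁ : M) (y : EuclideanSpace ℝ (Fin n)) : EuclideanSpace ℝ (Fin n) :=
  extChartAt (𝓡 n) x₁ ((extChartAt (𝓡 n) x₀).symm y)

/-- The domain of the coordinate change from the chart around `x₀` to the chart around `x₁`. -/
def coordOverlap (x₀ x₁ : M) : Set (EuclideanSpace ℝ (Fin n)) :=
  (extChartAt (𝓡 n) x₀).target ∩ (extChartAt (𝓡 n) x₀).symm ⁻¹' (extChartAt (𝓡 n) x₁).source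

/-- The coordinate expression of the function `f` in the chart around `x₀`. -/
def coordExpr (n : ℕ) {M : Type*} [TopologicalSpace M] [ChartedSpace (EuclideanSpace ℝ (Fin n)) M]
    (x₀ : M) (f : M → ℝ) (y : EuclideanSpace ℝ (Fin n)) : ℝ :=
  f ((extChartAt (𝓡 n) x₀).symm y)

theorem exists_mem_target_eq_symm {x₀ x : M} (hx : x ∈ (extChartAt (𝓡 n) x₀).source) :
    ∃ y ∈ (extChartAt (𝓡 n) x₀).target, (extChartAt (𝓡 n) x₀).symm y = x :=
  ⟨_, (extChartAt (𝓡 n) x₀).map_source hx, (extChartAt (𝓡 n) x₀).left_inv hx⟩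

theorem isOpen_coordOverlap (x₀ x₁ : M) : IsOpen (coordOverlap (n := n) x₀ x₁) :=
  (continuousOn_extChartAt_symm x₀).isOpen_inter_preimage (isOpen_extChartAt_target x₀)
    (isOpen_extChartAt_source x₁)

theorem continuous_of_coord {f : M → ℝ} (F : M → 𝔼 → ℝ)
    (hF : ∀ x₀, ContinuousOn (F x₀) (extChartAt (𝓡 n) x₀).target)
    (h : ∀ x₀, ∀ x ∈ (extChartAt (𝓡 n) x₀).source, f x = F x₀ (extChartAt (𝓡 n) x₀ x)) :
    Continuous f := by
  refine continuous_iff_continuousAt.2 fun x₀ => ?_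
  have hsource := extChartAt_source_mem_nhds (I := 𝓡 n) x₀
  have hcont : ContinuousOn (fun x => F x₀ (extChartAt (𝓡 n) x₀ x)) (extChartAt (𝓡 n) x₀).source :=
    (hF x₀).comp (continuousOn_extChartAt x₀) (extChartAt (𝓡 n) x₀).mapsTo
  exact (hcont.continuousAt hsource).congr
    (Filter.eventually_of_mem hsource fun x hx => (h x₀ x hx).symm)

theorem mdifferentiableAt_of_contMDiff {f : M → ℝ} (hf : ContMDiff (𝓡 n) 𝓘(ℝ, ℝ) ∞ f) (x : M) :
    MDifferentiableAt (𝓡 n) 𝓘(ℝ, ℝ) f x :=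
  hf.mdifferentiable (by simp) x

variable [IsManifold (𝓡 n) ∞ M]

section ChartDerivative

variable (x₀ : M) {x : M} {y : EuclideanSpace ℝ (Fin n)}

theorem mdifferentiableAt_chart_symm (hy : y ∈ (extChartAt (𝓡 n) x₀).target) :
    MDifferentiableAt 𝓘(ℝ, 𝔼) (𝓡 n) (extChartAt (𝓡 n) x₀).symm y := by
  have hwithin := mdifferentiableWithinAt_extChartAt_symm hy
  rwa [ModelWithCorners.range_eq_univ, mdifferentiableWithinAt_univ] at hwithin

theorem mdifferentiableAt_chart (hx : x ∈ (extChartAt (𝓡 n) x₀).source) :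
    MDifferentiableAt (𝓡 n) 𝓘(ℝ, 𝔼) (extChartAt (𝓡 n) x₀) x :=
  mdifferentiableAt_extChartAt (by rwa [extChartAt_source] at hx)

theorem dchart_frame (hy : y ∈ (extChartAt (𝓡 n) x₀).target) (a : 𝔼) :
    dchart x₀ ((extChartAt (𝓡 n) x₀).symm y) (frame x₀ y a) = a := by
  have hcomp := mfderiv_extChartAt_comp_mfderivWithin_extChartAt_symm hy
  rw [ModelWithCorners.range_eq_univ, mfderivWithin_univ] at hcomp
  exact congrArg (fun L => L a) hcomp

theorem frame_dchart (hy : y ∈ (extChartAt (𝓡 n) x₀).target)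
    (a : TangentSpace (𝓡 n) ((extChartAt (𝓡 n) x₀).symm y)) :
    frame x₀ y (dchart x₀ ((extChartAt (𝓡 n) x₀).symm y) a) = a := by
  have hcomp := mfderivWithin_extChartAt_symm_comp_mfderiv_extChartAt hy
  rw [ModelWithCorners.range_eq_univ, mfderivWithin_univ] at hcomp
  exact congrArg (fun L => L a) hcomp

theorem dchart_surjective (hx : x ∈ (extChartAt (𝓡 n) x₀).source) :
    Function.Surjective (dchart (n := n) x₀ x) := by
  obtain ⟨y, hy, rfl⟩ := exists_mem_target_eq_symm hx
  exact fun a => ⟨_, dchart_frame x₀ hy a⟩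

theorem contMDiffOn_frame (a : 𝔼) :
    ContMDiffOn 𝓘(ℝ, 𝔼) (𝓡 n).tangent ∞
      (fun y => Bundle.TotalSpace.mk' 𝔼 ((extChartAt (𝓡 n) x₀).symm y) (frame x₀ y a)
        : 𝔼 → TangentBundle (𝓡 n) M) (extChartAt (𝓡 n) x₀).target := by
  have hopen : IsOpen (extChartAt (𝓡 n) x₀).target := isOpen_extChartAt_target x₀
  have htangentMap := (contMDiffOn_extChartAt_symm (I := 𝓡 n) (n := ∞)
    x₀).contMDiffOn_tangentMapWithin (m := ∞) (by simp) hopen.uniqueMDiffOn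
  have hconst : ContMDiffOn 𝓘(ℝ, 𝔼) 𝓘(ℝ, 𝔼).tangent ∞
      (fun y => (⟨y, a⟩ : TangentBundle 𝓘(ℝ, 𝔼) 𝔼)) (extChartAt (𝓡 n) x₀).target :=
    contMDiffOn_vectorSpace_iff_contDiffOn.2 contDiffOn_const
  refine (htangentMap.comp hconst fun y hy => hy).congr fun y hy => ?_
  simp only [Function.comp_def, tangentMapWithin, frame]
  rw [mfderivWithin_of_isOpen hopen hy]
  rfl

end ChartDerivative

section CoordinateMetric

variable (g : Metric n M) (x₀ x₁ : M) {x : M} {y : EuclideanSpace ℝ (Fin n)}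

theorem bilin_coordMetric (y a b : 𝔼) :
    bilin (coordMetric g x₀ y) a b =
      g.inner ((extChartAt (𝓡 n) x₀).symm y) (frame x₀ y a) (frame x₀ y b) := by
  induction a using euclidean_induction with
  | zero => simp only [map_zero, zero_apply]
  | add a a' ha ha' => simp only [map_add, add_apply, ha, ha']
  | smul t a ha => simp only [map_smul, smul_apply, ha]
  | single i =>
    induction b using euclidean_induction with
    | zero => simp only [map_zero]
    | add b b' hb hb' => simp only [map_add, hb, hb']
    | smul t b hb => simp only [map_smul, hb]
    | single j => exact bilin_single _ i j

theorem inner_eq_bilin (hx : x ∈ (extChartAt (𝓡 n) x₀).source) (a b : TangentSpace (𝓡 n) x) :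
    g.inner x a b = bilin (coordMetric g x₀ (extChartAt (𝓡 n) x₀ x)) (dchart x₀ x a)
      (dchart x₀ x b) := by
  obtain ⟨y, hy, rfl⟩ := exists_mem_target_eq_symm hx
  rw [(extChartAt (𝓡 n) x₀).right_inv hy, bilin_coordMetric, frame_dchart x₀ hy,
    frame_dchart x₀ hy]

theorem contDiffOn_coordMetric (i j : Fin n) :
    ContDiffOn ℝ ∞ (fun y => coordMetric g x₀ y i j) (extChartAt (𝓡 n) x₀).target := by
  have hmetric := g.contMDiff.comp_contMDiffOn (contMDiffOn_extChartAt_symm (I := 𝓡 n) (n := ∞) x₀)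
  have hbundle := ContMDiffOn.clm_bundle_apply₂ (F₁ := 𝔼) (F₂ := 𝔼) (F₃ := ℝ)
    (E₁ := fun x : M => TangentSpace (𝓡 n) x) (E₂ := fun x : M => TangentSpace (𝓡 n) x)
    (E₃ := fun _ : M => ℝ) (b := (extChartAt (𝓡 n) x₀).symm)
    (ψ := fun y => g.inner ((extChartAt (𝓡 n) x₀).symm y))
    hmetric (contMDiffOn_frame x₀ 𝐞[i]) (contMDiffOn_frame x₀ 𝐞[j])
  exact fun y hy =>
    ((Bundle.contMDiffWithinAt_totalSpace ..).1 (hbundle y hy)).2.contDiffWithinAt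

theorem isSmoothMetric_coordMetric :
    IsSmoothMetric (coordMetric g x₀) (extChartAt (𝓡 n) x₀).target where
  isOpen := isOpen_extChartAt_target x₀
  contDiffOn := contDiffOn_coordMetric g x₀
  symm y _ := Matrix.IsSymm.ext fun i j => g.symm _ _ _
  pos y hy a ha := by
    rw [bilin_coordMetric]
    refine g.pos _ _ fun h => ha ?_
    rw [← dchart_frame x₀ hy a, h, map_zero]

theorem contDiffOn_coordChange :
    ContDiffOn ℝ ∞ (coordChange x₀ x₁) (coordOverlap (n := n) x₀ x₁) :=
  contMDiffOn_iff_contDiffOn.1 <|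
    (contMDiffOn_extChartAt (I := 𝓡 n) (n := ∞) (x := x₁)).comp
      ((contMDiffOn_extChartAt_symm (I := 𝓡 n) (n := ∞) x₀).mono Set.inter_subset_left)
      fun y hy => by simpa using hy.2

theorem fderiv_coordChange (hy : y ∈ coordOverlap x₀ x₁) (a : 𝔼) :
    fderiv ℝ (coordChange x₀ x₁) y a = dchart x₁ ((extChartAt (𝓡 n) x₀).symm y) (frame x₀ y a) := by
  rw [← mfderiv_eq_fderiv]
  exact congrArg (fun L => L a)
    (mfderiv_comp y (mdifferentiableAt_chart x₁ hy.2) (mdifferentiableAt_chart_symm x₀ hy.1))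

theorem bilin_coordChange (hy : y ∈ coordOverlap x₀ x₁) (a b : 𝔼) :
    bilin (coordMetric g x₀ y) a b = bilin (coordMetric g x₁ (coordChange x₀ x₁ y))
      (fderiv ℝ (coordChange x₀ x₁) y a) (fderiv ℝ (coordChange x₀ x₁) y b) := by
  rw [bilin_coordMetric, fderiv_coordChange x₀ x₁ hy, fderiv_coordChange x₀ x₁ hy,
    inner_eq_bilin g x₁ hy.2]
  rfl

theorem scalarCurvature_eq_coord (hx : x ∈ (extChartAt (𝓡 n) x₀).source) :
    scalarCurvature g x = coordScalar (coordMetric g x₀) (extChartAt (𝓡 n) x₀ x) := by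
  have hG' := (isSmoothMetric_coordMetric g x).mono (isOpen_coordOverlap x x₀)
    Set.inter_subset_left
  rw [scalarCurvature, (isSmoothMetric_coordMetric g x₀).coordScalar_pullback hG'
    (contDiffOn_coordChange x x₀) (fun y hy => (extChartAt (𝓡 n) x₀).map_source hy.2)
    (fun z hz => bilin_coordChange g x x₀ hz) (y := extChartAt (𝓡 n) x x)
    ⟨mem_extChartAt_target x, by simpa using hx⟩, coordChange, extChartAt_to_inv]

theorem continuous_scalarCurvature : Continuous (scalarCurvature g) :=
  continuous_of_coord (fun x₀ => coordScalar (coordMetric g x₀))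
    (fun x₀ => (isSmoothMetric_coordMetric g x₀).contDiffOn_coordScalar.continuousOn)
    fun x₀ _ hx => scalarCurvature_eq_coord g x₀ hx

end CoordinateMetric

section Gradient

variable (g : Metric n M) {f f₁ f₂ : M → ℝ} (x₀ : M) {x : M} {y : EuclideanSpace ℝ (Fin n)}

theorem contDiffOn_coordExpr (hf : ContMDiff (𝓡 n) 𝓘(ℝ, ℝ) ∞ f) :
    ContDiffOn ℝ ∞ (coordExpr n x₀ f) (extChartAt (𝓡 n) x₀).target :=
  contMDiffOn_iff_contDiffOn.1 (hf.comp_contMDiffOn (contMDiffOn_extChartAt_symm x₀))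

theorem fderiv_coordExpr (hy : y ∈ (extChartAt (𝓡 n) x₀).target)
    (hf : MDifferentiableAt (𝓡 n) 𝓘(ℝ, ℝ) f ((extChartAt (𝓡 n) x₀).symm y)) (b : 𝔼) :
    fderiv ℝ (coordExpr n x₀ f) y b =
      mfderiv (𝓡 n) 𝓘(ℝ, ℝ) f ((extChartAt (𝓡 n) x₀).symm y) (frame x₀ y b) := by
  rw [← mfderiv_eq_fderiv]
  exact congrArg (fun L => L b) (mfderiv_comp y hf (mdifferentiableAt_chart_symm x₀ hy))

theorem mfderiv_eq_coord (hx : x ∈ (extChartAt (𝓡 n) x₀).source)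
    (hf : MDifferentiableAt (𝓡 n) 𝓘(ℝ, ℝ) f x) (a : TangentSpace (𝓡 n) x) :
    mfderiv (𝓡 n) 𝓘(ℝ, ℝ) f x a =
      fderiv ℝ (coordExpr n x₀ f) (extChartAt (𝓡 n) x₀ x) (dchart x₀ x a) := by
  obtain ⟨y, hy, rfl⟩ := exists_mem_target_eq_symm hx
  rw [(extChartAt (𝓡 n) x₀).right_inv hy, fderiv_coordExpr x₀ hy hf, frame_dchart x₀ hy]

theorem dchart_gradient (hx : x ∈ (extChartAt (𝓡 n) x₀).source)
    (hf : MDifferentiableAt (𝓡 n) 𝓘(ℝ, ℝ) f x) :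
    dchart x₀ x (gradient g f x) =
      coordGrad (coordMetric g x₀) (coordExpr n x₀ f) (extChartAt (𝓡 n) x₀ x) := by
  have hG := isSmoothMetric_coordMetric g x₀
  have hy := (extChartAt (𝓡 n) x₀).map_source hx
  rw [← sub_eq_zero]
  refine hG.nondegenerate hy _ fun b => ?_
  obtain ⟨a, rfl⟩ := dchart_surjective x₀ hx b
  rw [map_sub, sub_apply, sub_eq_zero, hG.bilin_coordGrad hy, ← inner_eq_bilin g x₀ hx,
    inner_gradient, mfderiv_eq_coord x₀ hx hf]

/-- The pairing `g(∇f₁, ∇f₂)`. -/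
def gradInner (g : Metric n M) (f₁ f₂ : M → ℝ) (x : M) : ℝ :=
  g.inner x (gradient g f₁ x) (gradient g f₂ x)

theorem gradInner_eq_coord (hx : x ∈ (extChartAt (𝓡 n) x₀).source)
    (hf₁ : MDifferentiableAt (𝓡 n) 𝓘(ℝ, ℝ) f₁ x) (hf₂ : MDifferentiableAt (𝓡 n) 𝓘(ℝ, ℝ) f₂ x) :
    gradInner g f₁ f₂ x = fderiv ℝ (coordExpr n x₀ f₁) (extChartAt (𝓡 n) x₀ x)
      (coordGrad (coordMetric g x₀) (coordExpr n x₀ f₂) (extChartAt (𝓡 n) x₀ x)) := by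
  rw [gradInner, inner_gradient, mfderiv_eq_coord x₀ hx hf₁, dchart_gradient g x₀ hx hf₂]

theorem continuous_gradInner (hf₁ : ContMDiff (𝓡 n) 𝓘(ℝ, ℝ) ∞ f₁)
    (hf₂ : ContMDiff (𝓡 n) 𝓘(ℝ, ℝ) ∞ f₂) : Continuous (gradInner g f₁ f₂) := by
  refine continuous_of_coord (fun x₀ y => fderiv ℝ (coordExpr n x₀ f₁) y
    (coordGrad (coordMetric g x₀) (coordExpr n x₀ f₂) y)) (fun x₀ => ?_)
    fun x₀ x hx => gradInner_eq_coord g x₀ hx (mdifferentiableAt_of_contMDiff hf₁ x)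
      (mdifferentiableAt_of_contMDiff hf₂ x)
  have hG := isSmoothMetric_coordMetric g x₀
  exact (((contDiffOn_coordExpr x₀ hf₁).fderiv_of_isOpen (m := ∞) hG.isOpen (by simp)).clm_apply
    (hG.contDiffOn_coordGrad (contDiffOn_coordExpr x₀ hf₂))).continuousOn

/-- The Laplacian `Δ_g f = div ∇f` (computed in the chart around `x`). -/
def laplacian (g : Metric n M) (f : M → ℝ) (x : M) : ℝ :=
  coordLap (coordMetric g x) (coordExpr n x f) (extChartAt (𝓡 n) x x)

theorem laplacian_eq_coord (hf : ContMDiff (𝓡 n) 𝓘(ℝ, ℝ) ∞ f)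
    (hx : x ∈ (extChartAt (𝓡 n) x₀).source) :
    laplacian g f x =
      coordLap (coordMetric g x₀) (coordExpr n x₀ f) (extChartAt (𝓡 n) x₀ x) := by
  have hopen := isOpen_coordOverlap (n := n) x x₀
  have hG := isSmoothMetric_coordMetric g x₀
  have hG' := (isSmoothMetric_coordMetric g x).mono hopen Set.inter_subset_left
  have hmaps : Set.MapsTo (coordChange (n := n) x x₀) (coordOverlap x x₀)
    (extChartAt (𝓡 n) x₀).target := fun y hy => (extChartAt (𝓡 n) x₀).map_source hy.2
  have hmem : extChartAt (𝓡 n) x x ∈ coordOverlap (n := n) x x₀ :=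
    ⟨mem_extChartAt_target x, by simpa using hx⟩
  have hexpr : coordExpr n x f =ᶠ[𝓝 (extChartAt (𝓡 n) x x)] coordExpr n x₀ f ∘ coordChange x x₀ :=
    (hopen.eventually_mem hmem).mono fun y hy =>
      (congrArg f ((extChartAt (𝓡 n) x₀).left_inv hy.2)).symm
  have hpullback := hG.coordLap_pullback hG' (contDiffOn_coordChange x x₀) hmaps
    (fun z hz => bilin_coordChange g x x₀ hz) (contDiffOn_coordExpr x₀ hf) hmem
  rw [coordChange, extChartAt_to_inv, ← hG'.metricTrace_covHessian
    ((contDiffOn_coordExpr x₀ hf).comp (contDiffOn_coordChange x x₀) hmaps) hmem] at hpullback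
  rw [← hpullback, laplacian, ← (isSmoothMetric_coordMetric g x).metricTrace_covHessian
    (contDiffOn_coordExpr x hf) (mem_extChartAt_target x)]
  congr 1
  funext a b
  rw [covHessian, covHessian, hexpr.fderiv.fderiv_eq, hexpr.fderiv_eq]

theorem continuous_laplacian (hf : ContMDiff (𝓡 n) 𝓘(ℝ, ℝ) ∞ f) : Continuous (laplacian g f) :=
  continuous_of_coord (fun x₀ => coordLap (coordMetric g x₀) (coordExpr n x₀ f))
    (fun x₀ => ((isSmoothMetric_coordMetric g x₀).contDiffOn_coordLap
      (contDiffOn_coordExpr x₀ hf)).continuousOn)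
    fun x₀ _ hx => laplacian_eq_coord g x₀ hf hx

end Gradient

/-- The metric `h` is the conformal change `e^{2f} g` of `g`. -/
def IsConformalChange (f : M → ℝ) (g h : Metric n M) : Prop :=
  ∀ (x : M) (a b : TangentSpace (𝓡 n) x), h.inner x a b = Real.exp (2 * f x) * g.inner x a b

namespace IsConformalChange

variable {f : M → ℝ} {g h : Metric n M}

theorem coordMetric_eq (hh : IsConformalChange f g h) (x₀ : M) (y : EuclideanSpace ℝ (Fin n)) :
    coordMetric h x₀ y = Real.exp (2 * coordExpr n x₀ f y) • coordMetric g x₀ y :=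
  Matrix.ext fun _ _ => hh _ _ _

theorem sqrt_det_coordMetric (hh : IsConformalChange f g h) (x₀ : M) (y : 𝔼) :
    √((coordMetric h x₀ y).det) =
      √((coordMetric g x₀ y).det) * Real.exp (n * coordExpr n x₀ f y) := by
  have hexp : Real.exp (2 * coordExpr n x₀ f y) ^ n = Real.exp (n * coordExpr n x₀ f y) ^ 2 := by
    rw [← Real.exp_nat_mul, ← Real.exp_nat_mul]
    push_cast
    ring_nf
  rw [hh.coordMetric_eq, Matrix.det_smul, Fintype.card_fin, hexp, Real.sqrt_mul (sq_nonneg _),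
    Real.sqrt_sq (Real.exp_pos _).le, mul_comm]

theorem gradient_eq (hh : IsConformalChange f g h) (φ : M → ℝ) (x : M) :
    gradient h φ x = Real.exp (-(2 * f x)) • gradient g φ x := by
  have hcancel (t : ℝ) : Real.exp (-(2 * f x)) * (Real.exp (2 * f x) * t) = t := by
    rw [Real.exp_neg, inv_mul_cancel_left₀ (Real.exp_ne_zero _)]
  rw [← sub_eq_zero]
  refine (metricForm_nondegenerate h x).1 _ fun a => ?_
  change h.inner x _ a = 0
  rw [map_sub, sub_apply, inner_gradient, map_smul, smul_apply, hh, inner_gradient, smul_eq_mul]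
  exact sub_eq_zero.2 (hcancel _).symm

theorem gradInner_eq (hh : IsConformalChange f g h) (φ ψ : M → ℝ) (x : M) :
    gradInner h φ ψ x = Real.exp (-(2 * f x)) * gradInner g φ ψ x := by
  rw [gradInner, inner_gradient, gradInner, ← inner_gradient g, hh.gradient_eq, map_smul,
    smul_eq_mul]

theorem scalarCurvature_eq (hh : IsConformalChange f g h) (hf : ContMDiff (𝓡 n) 𝓘(ℝ, ℝ) ∞ f)
    (x : M) : scalarCurvature h x = Real.exp (-(2 * f x)) * (scalarCurvature g x
      - 2 * ((n : ℝ) - 1) * laplacian g f x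
      - ((n : ℝ) - 1) * ((n : ℝ) - 2) * gradInner g f f x) := by
  have hx := mem_extChartAt_source (I := 𝓡 n) x
  have hf' := mdifferentiableAt_of_contMDiff hf x
  rw [scalarCurvature, scalarCurvature, gradInner_eq_coord g x hx hf' hf', laplacian,
    (isSmoothMetric_coordMetric g x).coordScalar_conformal (contDiffOn_coordExpr x hf)
      (fun z _ => hh.coordMetric_eq x z) (mem_extChartAt_target x)]
  simp only [coordExpr, extChartAt_to_inv]

end IsConformalChange

end Charts
section Volume

variable {n : ℕ}

local notation "𝔼" => EuclideanSpace ℝ (Fin n)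
local notation "𝐞[" i "]" => EuclideanSpace.single i (1 : ℝ)

theorem det_eq_of_pullback {A A' : Matrix (Fin n) (Fin n) ℝ} {L : 𝔼 →L[ℝ] 𝔼}
    (h : ∀ a b, bilin A' a b = bilin A (L a) (L b)) : A'.det = L.det ^ 2 * A.det := by
  let b := (EuclideanSpace.basisFun (Fin n) ℝ).toBasis
  let J := LinearMap.toMatrix b b L.toLinearMap
  have hJ (i : Fin n) : Jᵀ i = (L 𝐞[i]).ofLp := by
    ext k
    simp [J, b, LinearMap.toMatrix_apply]
  have hA' : A' = Jᵀ * A * J := by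
    ext i j
    rw [← bilin_single A', h, bilin_apply, Matrix.mul_mul_apply, hJ, hJ]
  have hdet : J.det = L.det := LinearMap.det_toMatrix b L.toLinearMap
  rw [hA', Matrix.det_mul, Matrix.det_mul, Matrix.det_transpose, hdet]
  ring

variable {M : Type*} [TopologicalSpace M] [ChartedSpace (EuclideanSpace ℝ (Fin n)) M]

theorem injOn_coordChange (x₀ x₁ : M) :
    Set.InjOn (coordChange (n := n) x₀ x₁) (coordOverlap x₀ x₁) := fun _ hy _ hz h =>
  (extChartAt (𝓡 n) x₀).symm.injOn hy.1 hz.1 ((extChartAt (𝓡 n) x₁).injOn hy.2 hz.2 h)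

theorem image_coordChange (x₀ x₁ : M) (A : Set M) :
    coordChange (n := n) x₀ x₁ '' ((extChartAt (𝓡 n) x₀).target ∩
        (extChartAt (𝓡 n) x₀).symm ⁻¹' (A ∩ (extChartAt (𝓡 n) x₁).source)) =
      (extChartAt (𝓡 n) x₁).target ∩
        (extChartAt (𝓡 n) x₁).symm ⁻¹' (A ∩ (extChartAt (𝓡 n) x₀).source) := by
  ext z
  constructor
  · rintro ⟨y, ⟨hy, hyA, hy₁⟩, rfl⟩
    refine ⟨(extChartAt (𝓡 n) x₁).map_source hy₁, ?_⟩
    rw [Set.mem_preimage, coordChange, (extChartAt (𝓡 n) x₁).left_inv hy₁]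
    exact ⟨hyA, (extChartAt (𝓡 n) x₀).map_target hy⟩
  · rintro ⟨hz, hzA, hz₀⟩
    refine ⟨extChartAt (𝓡 n) x₀ ((extChartAt (𝓡 n) x₁).symm z),
      ⟨(extChartAt (𝓡 n) x₀).map_source hz₀, ?_⟩, ?_⟩
    · rw [Set.mem_preimage, (extChartAt (𝓡 n) x₀).left_inv hz₀]
      exact ⟨hzA, (extChartAt (𝓡 n) x₁).map_target hz⟩
    · rw [coordChange, (extChartAt (𝓡 n) x₀).left_inv hz₀, (extChartAt (𝓡 n) x₁).right_inv hz]

section ChartMeasurability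

variable [MeasurableSpace M] [BorelSpace M]

theorem aemeasurable_chart_symm (x₀ : M) :
    AEMeasurable (extChartAt (𝓡 n) x₀).symm
      ((volume : Measure 𝔼).restrict (extChartAt (𝓡 n) x₀).target) :=
  (continuousOn_extChartAt_symm x₀).aemeasurable (isOpen_extChartAt_target x₀).measurableSet

theorem measurableSet_target_inter_preimage (x₀ : M) {A : Set M} (hA : MeasurableSet A) :
    MeasurableSet ((extChartAt (𝓡 n) x₀).target ∩ (extChartAt (𝓡 n) x₀).symm ⁻¹' A) := by
  have hsymm := (continuousOn_iff_continuous_domRestrict.1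
    (continuousOn_extChartAt_symm (I := 𝓡 n) x₀)).measurable hA
  rw [← Subtype.image_preimage_coe]
  exact (MeasurableEmbedding.subtype_coe
    (isOpen_extChartAt_target (I := 𝓡 n) x₀).measurableSet).measurableSet_image.2 hsymm

end ChartMeasurability

variable [IsManifold (𝓡 n) ∞ M]

theorem aemeasurable_density (g : Metric n M) (x₀ : M) :
    AEMeasurable (fun y => ENNReal.ofReal √((coordMetric g x₀ y).det))
      ((volume : Measure 𝔼).restrict (extChartAt (𝓡 n) x₀).target) :=
  ((isSmoothMetric_coordMetric g x₀).contDiffOn_sqrt_det.continuousOn.aemeasurable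
    (isOpen_extChartAt_target x₀).measurableSet).ennreal_ofReal

variable [MeasurableSpace M]

theorem chartVolume_le_vol (g : Metric n M) (x₀ : M) : chartVolume g x₀ ≤ vol g :=
  le_iSup (chartVolume g) x₀

variable [BorelSpace M]

theorem lintegral_chartVolume (g : Metric n M) (x₀ : M) {F : M → ℝ≥0∞} (hF : Measurable F) :
    ∫⁻ x, F x ∂chartVolume g x₀ = ∫⁻ y in (extChartAt (𝓡 n) x₀).target,
      ENNReal.ofReal √((coordMetric g x₀ y).det) * F ((extChartAt (𝓡 n) x₀).symm y) := by
  have hsymm := aemeasurable_chart_symm (n := n) x₀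
  rw [chartVolume, lintegral_map' hF.aemeasurable
    (hsymm.mono_ac (withDensity_absolutelyContinuous _ _))]
  exact lintegral_withDensity_eq_lintegral_mul₀ (aemeasurable_density g x₀)
    (hF.comp_aemeasurable hsymm)

theorem chartVolume_apply (g : Metric n M) (x₀ : M) {A : Set M} (hA : MeasurableSet A) :
    chartVolume g x₀ A = ∫⁻ y in (extChartAt (𝓡 n) x₀).target ∩ (extChartAt (𝓡 n) x₀).symm ⁻¹' A,
      ENNReal.ofReal √((coordMetric g x₀ y).det) := by
  rw [chartVolume, Measure.map_apply_of_aemeasurable ((aemeasurable_chart_symm x₀).mono_ac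
    (withDensity_absolutelyContinuous _ _)) hA, withDensity_apply',
    Measure.restrict_restrict' (isOpen_extChartAt_target x₀).measurableSet, Set.inter_comm]

theorem chartVolume_inter_source (g : Metric n M) (x₀ x₁ : M) {A : Set M} (hA : MeasurableSet A) :
    chartVolume g x₁ (A ∩ (extChartAt (𝓡 n) x₀).source) =
      chartVolume g x₀ (A ∩ (extChartAt (𝓡 n) x₁).source) := by
  have hA₀ := hA.inter (isOpen_extChartAt_source (I := 𝓡 n) x₀).measurableSet
  have hA₁ := hA.inter (isOpen_extChartAt_source (I := 𝓡 n) x₁).measurableSet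
  rw [chartVolume_apply g x₁ hA₀, chartVolume_apply g x₀ hA₁, ← image_coordChange]
  set s : Set 𝔼 := (extChartAt (𝓡 n) x₀).target ∩
    (extChartAt (𝓡 n) x₀).symm ⁻¹' (A ∩ (extChartAt (𝓡 n) x₁).source)
  have hs : MeasurableSet s := measurableSet_target_inter_preimage x₀ hA₁
  have hsub : s ⊆ coordOverlap x₀ x₁ := fun y hy => ⟨hy.1, hy.2.2⟩
  have hderiv (y : 𝔼) (hy : y ∈ s) :
      HasFDerivWithinAt (coordChange x₀ x₁) (fderiv ℝ (coordChange x₀ x₁) y) s y :=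
    (((contDiffOn_coordChange x₀ x₁).contDiffAt
      ((isOpen_coordOverlap x₀ x₁).mem_nhds (hsub hy))).differentiableAt
      (by simp)).hasFDerivAt.hasFDerivWithinAt
  rw [lintegral_image_eq_lintegral_abs_det_fderiv_mul volume hs hderiv
    ((injOn_coordChange x₀ x₁).mono hsub)]
  refine setLIntegral_congr_fun hs fun y hy => ?_
  rw [det_eq_of_pullback (bilin_coordChange g x₀ x₁ (hsub hy)),
    Real.sqrt_mul (sq_nonneg _), Real.sqrt_sq_eq_abs, ENNReal.ofReal_mul (abs_nonneg _)]

theorem vol_apply_of_subset (g : Metric n M) (x₀ : M) {A : Set M} (hA : MeasurableSet A)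
    (h : A ⊆ (extChartAt (𝓡 n) x₀).source) : vol g A = chartVolume g x₀ A := by
  refine le_antisymm ?_ (chartVolume_le_vol g x₀ A)
  have hle : vol g ≤ chartVolume g x₀ + (vol g).restrict (extChartAt (𝓡 n) x₀).sourceᶜ := by
    refine iSup_le fun x₁ => Measure.le_iff.2 fun B hB => ?_
    rw [← measure_inter_add_sdiff B (isOpen_extChartAt_source (I := 𝓡 n) x₀).measurableSet,
      Measure.add_apply, Measure.restrict_apply hB, chartVolume_inter_source g x₀ x₁ hB]
    exact add_le_add (measure_mono Set.inter_subset_left) (chartVolume_le_vol g x₁ _)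
  calc vol g A
      ≤ chartVolume g x₀ A + vol g (A ∩ (extChartAt (𝓡 n) x₀).sourceᶜ) := by
        simpa only [Measure.add_apply, Measure.restrict_apply hA] using hle A
    _ = chartVolume g x₀ A := by
        rw [← Set.sdiff_eq, Set.sdiff_eq_empty.2 h, measure_empty, add_zero]

theorem vol_restrict_source (g : Metric n M) (x₀ : M) :
    (vol g).restrict (extChartAt (𝓡 n) x₀).source = chartVolume g x₀ := by
  have hsource := (isOpen_extChartAt_source (I := 𝓡 n) x₀).measurableSet
  ext A hA
  rw [Measure.restrict_apply hA, vol_apply_of_subset g x₀ (hA.inter hsource) Set.inter_subset_right,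
    chartVolume_apply g x₀ (hA.inter hsource), chartVolume_apply g x₀ hA]
  congr 2
  ext y
  exact ⟨fun hy => ⟨hy.1, hy.2.1⟩, fun hy => ⟨hy.1, hy.2, (extChartAt (𝓡 n) x₀).map_target hy.1⟩⟩

theorem integral_vol_eq_coord (g : Metric n M) (x₀ : M) {F : M → ℝ} (hF : Measurable F)
    (hsupp : ∀ x ∉ (extChartAt (𝓡 n) x₀).source, F x = 0) :
    ∫ x, F x ∂vol g = ∫ y in (extChartAt (𝓡 n) x₀).target,
      √((coordMetric g x₀ y).det) * F ((extChartAt (𝓡 n) x₀).symm y) := by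
  rw [← setIntegral_eq_integral_of_forall_compl_eq_zero hsupp, vol_restrict_source, chartVolume,
    integral_map ((aemeasurable_chart_symm x₀).mono_ac (withDensity_absolutelyContinuous _ _))
    hF.aestronglyMeasurable,
    integral_withDensity_eq_integral_toReal_smul₀ (aemeasurable_density g x₀) (by simp)]
  simp only [ENNReal.toReal_ofReal (Real.sqrt_nonneg _), smul_eq_mul]

theorem exists_mem_nhds_vol_lt_top [T2Space M] (g : Metric n M) (x₀ : M) :
    ∃ s ∈ 𝓝 x₀, vol g s < ⊤ := by
  obtain ⟨K, hK, hx₀K, hKt⟩ :=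
    exists_compact_subset (isOpen_extChartAt_target (I := 𝓡 n) x₀) (mem_extChartAt_target x₀)
  have hmeas : MeasurableSet ((extChartAt (𝓡 n) x₀).symm '' K) :=
    (hK.image_of_continuousOn ((continuousOn_extChartAt_symm x₀).mono hKt)).measurableSet
  have hsub : (extChartAt (𝓡 n) x₀).symm '' K ⊆ (extChartAt (𝓡 n) x₀).source :=
    Set.image_subset_iff.2 fun y hy => (extChartAt (𝓡 n) x₀).map_target (hKt hy)
  refine ⟨(extChartAt (𝓡 n) x₀).symm '' K, ?_, ?_⟩
  · filter_upwards [(continuousAt_extChartAt (I := 𝓡 n) x₀).preimage_mem_nhds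
      (mem_interior_iff_mem_nhds.1 hx₀K), extChartAt_source_mem_nhds (I := 𝓡 n) x₀] with x hxK hx
    exact ⟨_, hxK, (extChartAt (𝓡 n) x₀).left_inv hx⟩
  · rw [vol_apply_of_subset g x₀ hmeas hsub, chartVolume_apply g x₀ hmeas]
    have hpre : (extChartAt (𝓡 n) x₀).target ∩
        (extChartAt (𝓡 n) x₀).symm ⁻¹' ((extChartAt (𝓡 n) x₀).symm '' K) ⊆ K := by
      rintro y ⟨hy, z, hz, hzy⟩
      rwa [← (extChartAt (𝓡 n) x₀).symm.injOn (hKt hz) hy hzy]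
    have hint : IntegrableOn (fun y => √((coordMetric g x₀ y).det)) K :=
      ((isSmoothMetric_coordMetric g x₀).contDiffOn_sqrt_det.continuousOn.mono
        hKt).integrableOn_compact hK
    exact (lintegral_mono_set hpre).trans_lt hint.lintegral_lt_top

instance instIsFiniteMeasureVol [T2Space M] [CompactSpace M] (g : Metric n M) :
    IsFiniteMeasure (vol g) :=
  have : IsLocallyFiniteMeasure (vol g) := ⟨exists_mem_nhds_vol_lt_top g⟩
  inferInstance

namespace IsConformalChange

variable {f : M → ℝ} {g h : Metric n M}

theorem chartVolume_eq (hh : IsConformalChange f g h) (hf : Continuous f) (x₀ : M) :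
    chartVolume h x₀ =
      (chartVolume g x₀).withDensity fun x => ENNReal.ofReal (Real.exp (n * f x)) := by
  have hmeas : Measurable fun x => ENNReal.ofReal (Real.exp (n * f x)) :=
    (hf.measurable.const_mul _).exp.ennreal_ofReal
  refine Measure.ext_of_lintegral _ fun F hF => ?_
  rw [lintegral_withDensity_eq_lintegral_mul _ hmeas hF, lintegral_chartVolume h x₀ hF,
    lintegral_chartVolume g x₀ (hmeas.mul hF)]
  refine lintegral_congr fun y => ?_
  rw [hh.sqrt_det_coordMetric, ENNReal.ofReal_mul (Real.sqrt_nonneg _), mul_assoc]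
  rfl

theorem vol_eq [LindelofSpace M] (hh : IsConformalChange f g h) (hf : Continuous f) :
    vol h = (vol g).withDensity fun x => ENNReal.ofReal (Real.exp (n * f x)) := by
  obtain ⟨t, htc, ht⟩ := LindelofSpace.elim_nhds_subcover
    (fun x : M => (extChartAt (𝓡 n) x).source) fun x => extChartAt_source_mem_nhds x
  refine (Measure.ext_iff_of_biUnion_eq_univ htc ht).2 fun x₀ _ => ?_
  rw [restrict_withDensity (isOpen_extChartAt_source x₀).measurableSet, vol_restrict_source,
    vol_restrict_source, hh.chartVolume_eq hf]

end IsConformalChange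

end Volume
section Divergence

variable {n : ℕ}

local notation "𝔼" => EuclideanSpace ℝ (Fin n)
local notation "𝐞[" i "]" => EuclideanSpace.single i (1 : ℝ)

theorem integrable_mul_of_tsupport_subset {U : Set 𝔼} (hU : IsOpen U) {F B : 𝔼 → ℝ}
    (hF : Continuous F) (hFc : HasCompactSupport F) (hFU : tsupport F ⊆ U)
    (hB : ContinuousOn B U) : Integrable fun y => F y * B y :=
  ((hF.continuousOn.mul hB).continuous_of_tsupport_subset hU
    (tsupport_mul_subset_left.trans hFU)).integrable_of_hasCompactSupport hFc.mul_right

section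

variable {U : Set (EuclideanSpace ℝ (Fin n))} {F : EuclideanSpace ℝ (Fin n) → ℝ}

theorem integrable_pd_mul (hU : IsOpen U) (hF : ContDiff ℝ 1 F) (hFc : HasCompactSupport F)
    (hFU : tsupport F ⊆ U) {B : 𝔼 → ℝ} (hB : ContinuousOn B U) (i : Fin n) :
    Integrable fun y => pd i F y * B y :=
  integrable_mul_of_tsupport_subset hU
    ((hF.continuous_fderiv one_ne_zero).clm_apply continuous_const)
    (hFc.fderiv_apply ℝ 𝐞[i]) ((tsupport_fderiv_apply_subset ℝ 𝐞[i]).trans hFU) hB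

theorem integral_pd_mul (hU : IsOpen U) (hF : ContDiff ℝ 1 F) (hFc : HasCompactSupport F)
    (hFU : tsupport F ⊆ U) {B : 𝔼 → ℝ} (hB : ContDiffOn ℝ ∞ B U) (i : Fin n) :
    ∫ y, pd i F y * B y = - ∫ y, F y * pd i B y := by
  have hpdB : Integrable fun y => pd i B y * F y := by
    simpa only [mul_comm] using integrable_mul_of_tsupport_subset hU hF.continuous hFc hFU
      (contDiffOn_pd hU hB i).continuousOn
  have hpdF : Integrable fun y => B y * pd i F y := by
    simpa only [mul_comm] using integrable_pd_mul hU hF hFc hFU hB.continuousOn i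
  have hBF : Integrable fun y => B y * F y := by
    simpa only [mul_comm] using integrable_mul_of_tsupport_subset hU hF.continuous hFc hFU
      hB.continuousOn
  simp only [mul_comm (pd i F _), mul_comm (F _)]
  exact integral_mul_fderiv_eq_neg_fderiv_mul_of_integrable hpdB hpdF hBF
    (fun y hy => (hB.contDiffAt (hU.mem_nhds (hFU hy))).differentiableAt (by simp))
    (fun y _ => hF.differentiable one_ne_zero y)

theorem integral_fderiv_apply (hU : IsOpen U) (hF : ContDiff ℝ 1 F) (hFc : HasCompactSupport F)
    (hFU : tsupport F ⊆ U) {V : 𝔼 → 𝔼} (hV : ContDiffOn ℝ ∞ V U) :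
    ∫ y, fderiv ℝ F y (V y) = - ∫ y, F y * ∑ i, pd i (fun z => V z i) y := by
  have hVi := contDiffOn_euclidean.1 hV
  have hsum (y : 𝔼) : fderiv ℝ F y (V y) = ∑ i, pd i F y * V y i := by
    conv_lhs => rw [← sum_smul_single (V y)]
    simp only [map_sum, map_smul, smul_eq_mul, pd, mul_comm]
  simp only [hsum, Finset.mul_sum]
  rw [integral_finsetSum _ fun i _ => integrable_pd_mul hU hF hFc hFU (hVi i).continuousOn i,
    integral_finsetSum _ fun i _ => integrable_mul_of_tsupport_subset hU hF.continuous hFc hFU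
      (contDiffOn_pd hU (hVi i) i).continuousOn, ← Finset.sum_neg_distrib]
  exact Finset.sum_congr rfl fun i _ => integral_pd_mul hU hF hFc hFU (hVi i) i

theorem setIntegral_fderiv_apply (hU : IsOpen U) (hF : ContDiff ℝ 1 F) (hFc : HasCompactSupport F)
    (hFU : tsupport F ⊆ U) {V : 𝔼 → 𝔼} (hV : ContDiffOn ℝ ∞ V U) :
    ∫ y in U, fderiv ℝ F y (V y) = - ∫ y in U, F y * ∑ i, pd i (fun z => V z i) y := by
  have hzero (y : 𝔼) (hy : y ∉ U) : F =ᶠ[𝓝 y] fun _ => (0 : ℝ) :=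
    notMem_tsupport_iff_eventuallyEq.1 fun h => hy (hFU h)
  rw [setIntegral_eq_integral_of_forall_compl_eq_zero fun y hy => by
      rw [(hzero y hy).fderiv_eq, fderiv_fun_const, Pi.zero_apply, zero_apply],
    setIntegral_eq_integral_of_forall_compl_eq_zero fun y hy => by
      rw [(hzero y hy).self_of_nhds, zero_mul]]
  exact integral_fderiv_apply hU hF hFc hFU hV

end

end Divergence

section Green

variable {n : ℕ} {M : Type*} [TopologicalSpace M] [ChartedSpace (EuclideanSpace ℝ (Fin n)) M]

local notation "𝔼" => EuclideanSpace ℝ (Fin n)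

/-- The coordinate expression of `F` in the chart around `x₀`, extended by zero outside the target
of the chart. -/
def zeroExtension (n : ℕ) {M : Type*} [TopologicalSpace M]
    [ChartedSpace (EuclideanSpace ℝ (Fin n)) M] (x₀ : M) (F : M → ℝ) :
    EuclideanSpace ℝ (Fin n) → ℝ :=
  (extChartAt (𝓡 n) x₀).target.indicator (coordExpr n x₀ F)

theorem zeroExtension_eventuallyEq {x₀ : M} (F : M → ℝ) {y : 𝔼}
    (hy : y ∈ (extChartAt (𝓡 n) x₀).target) : zeroExtension n x₀ F =ᶠ[𝓝 y] coordExpr n x₀ F :=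
  eventually_of_mem ((isOpen_extChartAt_target x₀).mem_nhds hy) fun _ hz =>
    Set.indicator_of_mem hz _

section

variable {x₀ : M} {F : M → ℝ}

theorem tsupport_zeroExtension_subset (hFc : HasCompactSupport F)
    (hFs : tsupport F ⊆ (extChartAt (𝓡 n) x₀).source) :
    tsupport (zeroExtension n x₀ F) ⊆ extChartAt (𝓡 n) x₀ '' tsupport F := by
  refine closure_minimal (fun y hy => ?_)
    (hFc.isCompact.image_of_continuousOn ((continuousOn_extChartAt x₀).mono hFs)).isClosed
  have hyt : y ∈ (extChartAt (𝓡 n) x₀).target := Set.mem_of_indicator_ne_zero hy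
  refine ⟨(extChartAt (𝓡 n) x₀).symm y, subset_tsupport F ?_, (extChartAt (𝓡 n) x₀).right_inv hyt⟩
  rwa [Function.mem_support, zeroExtension, Set.indicator_of_mem hyt] at hy

theorem tsupport_zeroExtension_subset_target (hFc : HasCompactSupport F)
    (hFs : tsupport F ⊆ (extChartAt (𝓡 n) x₀).source) :
    tsupport (zeroExtension n x₀ F) ⊆ (extChartAt (𝓡 n) x₀).target :=
  (tsupport_zeroExtension_subset hFc hFs).trans
    (Set.image_subset_iff.2 fun _ hx => (extChartAt (𝓡 n) x₀).map_source (hFs hx))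

theorem hasCompactSupport_zeroExtension (hFc : HasCompactSupport F)
    (hFs : tsupport F ⊆ (extChartAt (𝓡 n) x₀).source) :
    HasCompactSupport (zeroExtension n x₀ F) :=
  (hFc.isCompact.image_of_continuousOn
    ((continuousOn_extChartAt x₀).mono hFs)).of_isClosed_subset (isClosed_tsupport _)
    (tsupport_zeroExtension_subset hFc hFs)

variable [IsManifold (𝓡 n) ∞ M]

theorem contDiff_zeroExtension (hF : ContMDiff (𝓡 n) 𝓘(ℝ, ℝ) ∞ F) (hFc : HasCompactSupport F)
    (hFs : tsupport F ⊆ (extChartAt (𝓡 n) x₀).source) :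
    ContDiff ℝ ∞ (zeroExtension n x₀ F) := by
  refine contMDiff_iff_contDiff.1 (contMDiff_of_tsupport fun y hy => ?_)
  have hyt := tsupport_zeroExtension_subset_target hFc hFs hy
  exact (((contDiffOn_coordExpr x₀ hF).contDiffAt ((isOpen_extChartAt_target x₀).mem_nhds
    hyt)).congr_of_eventuallyEq (zeroExtension_eventuallyEq F hyt)).contMDiffAt

end

variable [IsManifold (𝓡 n) ∞ M]

section

variable (g : Metric n M) {F F₁ F₂ f : M → ℝ} {x : M}

theorem gradInner_comm (F f : M → ℝ) (x : M) : gradInner g F f x = gradInner g f F x :=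
  g.symm x _ _

theorem gradInner_eq_of_hasMFDerivAt {F' : TangentSpace (𝓡 n) x →L[ℝ] ℝ}
    (hF : HasMFDerivAt (𝓡 n) 𝓘(ℝ, ℝ) F x F') (f : M → ℝ) :
    gradInner g F f x = F' (gradient g f x) := by
  rw [gradInner, inner_gradient]
  exact congrArg (fun L => L (gradient g f x)) hF.mfderiv

theorem gradInner_eq_mfderiv (F f : M → ℝ) (x : M) :
    gradInner g F f x = mfderiv (𝓡 n) 𝓘(ℝ, ℝ) F x (gradient g f x) :=
  inner_gradient g F x _

theorem gradInner_eq_zero_of_notMem_tsupport (hx : x ∉ tsupport F) (f : M → ℝ) :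
    gradInner g F f x = 0 := by
  have hF : F =ᶠ[𝓝 x] fun _ => (0 : ℝ) := notMem_tsupport_iff_eventuallyEq.1 hx
  exact gradInner_eq_of_hasMFDerivAt g ((hasMFDerivAt_const 0 x).congr_of_eventuallyEq hF) f

theorem gradInner_mul_left (hF₁ : MDifferentiableAt (𝓡 n) 𝓘(ℝ, ℝ) F₁ x)
    (hF₂ : MDifferentiableAt (𝓡 n) 𝓘(ℝ, ℝ) F₂ x) (f : M → ℝ) :
    gradInner g (fun x => F₁ x * F₂ x) f x =
      F₁ x * gradInner g F₂ f x + F₂ x * gradInner g F₁ f x := by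
  rw [gradInner_eq_mfderiv g F₁, gradInner_eq_mfderiv g F₂]
  exact gradInner_eq_of_hasMFDerivAt g (hF₁.hasMFDerivAt.mul hF₂.hasMFDerivAt) f

theorem gradInner_comp_left {φ : ℝ → ℝ} {φ' : ℝ} (hφ : HasDerivAt φ φ' (F x))
    (hF : MDifferentiableAt (𝓡 n) 𝓘(ℝ, ℝ) F x) (f : M → ℝ) :
    gradInner g (fun x => φ (F x)) f x = φ' * gradInner g F f x := by
  rw [gradInner_eq_mfderiv g F]
  exact (gradInner_eq_of_hasMFDerivAt g
    (hφ.hasFDerivAt.hasMFDerivAt.comp x hF.hasMFDerivAt) f).trans (mul_comm _ _)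

theorem gradInner_exp_mul_left (hF : MDifferentiableAt (𝓡 n) 𝓘(ℝ, ℝ) F x) (k : ℝ) (f : M → ℝ) :
    gradInner g (fun x => Real.exp (k * F x)) f x =
      k * Real.exp (k * F x) * gradInner g F f x := by
  refine gradInner_comp_left g (φ := fun t => Real.exp (k * t)) ?_ hF f
  simpa only [id, mul_one, one_mul, mul_comm k] using ((hasDerivAt_id (F x)).const_mul k).exp

theorem gradInner_add_left (hF₁ : MDifferentiableAt (𝓡 n) 𝓘(ℝ, ℝ) F₁ x)
    (hF₂ : MDifferentiableAt (𝓡 n) 𝓘(ℝ, ℝ) F₂ x) (f : M → ℝ) :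
    gradInner g (fun x => F₁ x + F₂ x) f x = gradInner g F₁ f x + gradInner g F₂ f x := by
  rw [gradInner_eq_mfderiv g F₁, gradInner_eq_mfderiv g F₂]
  exact gradInner_eq_of_hasMFDerivAt g (hF₁.hasMFDerivAt.add hF₂.hasMFDerivAt) f

theorem gradInner_sum_left {ι : Type*} (s : Finset ι) {F : ι → M → ℝ}
    (hF : ∀ i, ContMDiff (𝓡 n) 𝓘(ℝ, ℝ) ∞ (F i)) (f : M → ℝ) (x : M) :
    gradInner g (fun x => ∑ i ∈ s, F i x) f x = ∑ i ∈ s, gradInner g (F i) f x := by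
  induction s using Finset.cons_induction with
  | empty =>
    simp only [Finset.sum_empty]
    exact gradInner_eq_of_hasMFDerivAt g (hasMFDerivAt_const 0 x) f
  | cons i s hi ih =>
    simp only [Finset.sum_cons]
    rw [gradInner_add_left g (mdifferentiableAt_of_contMDiff (hF i) x)
      (mdifferentiableAt_of_contMDiff (contMDiff_finsetSum fun j _ => hF j) x), ih]

end

variable [MeasurableSpace M] [BorelSpace M] (g : Metric n M) {F f : M → ℝ}

theorem integral_gradInner_of_tsupport_subset_source (x₀ : M)
    (hF : ContMDiff (𝓡 n) 𝓘(ℝ, ℝ) ∞ F) (hFc : HasCompactSupport F)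
    (hFs : tsupport F ⊆ (extChartAt (𝓡 n) x₀).source) (hf : ContMDiff (𝓡 n) 𝓘(ℝ, ℝ) ∞ f) :
    ∫ x, gradInner g F f x ∂vol g = - ∫ x, F x * laplacian g f x ∂vol g := by
  have hG := isSmoothMetric_coordMetric g x₀
  have hfc := contDiffOn_coordExpr x₀ hf
  have hopen := isOpen_extChartAt_target (I := 𝓡 n) x₀
  have hmeas : Measurable fun x => F x * laplacian g f x :=
    (hF.continuous.mul (continuous_laplacian g hf)).measurable
  let V (y : 𝔼) : 𝔼 := √((coordMetric g x₀ y).det) •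
    coordGrad (coordMetric g x₀) (coordExpr n x₀ f) y
  have hdiv := setIntegral_fderiv_apply hopen
    ((contDiff_zeroExtension hF hFc hFs).of_le (by simp)) (hasCompactSupport_zeroExtension hFc hFs)
    (tsupport_zeroExtension_subset_target hFc hFs)
    (V := V) (hG.contDiffOn_sqrt_det.smul (hG.contDiffOn_coordGrad hfc))
  rw [integral_vol_eq_coord g x₀ (continuous_gradInner g hF hf).measurable fun x hx =>
      gradInner_eq_zero_of_notMem_tsupport g (fun h => hx (hFs h)) f,
    integral_vol_eq_coord g x₀ hmeas fun x hx => by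
      rw [image_eq_zero_of_notMem_tsupport fun h => hx (hFs h), zero_mul]]
  convert hdiv using 1
  · refine setIntegral_congr_fun hopen.measurableSet fun y hy => ?_
    rw [gradInner_eq_coord g x₀ ((extChartAt (𝓡 n) x₀).map_target hy)
      (mdifferentiableAt_of_contMDiff hF _) (mdifferentiableAt_of_contMDiff hf _),
      (extChartAt (𝓡 n) x₀).right_inv hy, (zeroExtension_eventuallyEq F hy).fderiv_eq, map_smul,
      smul_eq_mul]
  · refine congrArg Neg.neg (setIntegral_congr_fun hopen.measurableSet fun y hy => ?_)
    dsimp only [V, PiLp.smul_apply, smul_eq_mul]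
    rw [hG.sqrt_det_mul_coordLap hfc hy, (zeroExtension_eventuallyEq F hy).self_of_nhds,
      laplacian_eq_coord g x₀ hf ((extChartAt (𝓡 n) x₀).map_target hy),
      (extChartAt (𝓡 n) x₀).right_inv hy, coordExpr]
    ring

variable [T2Space M] [CompactSpace M]

theorem integrable_vol_of_continuous (hF : Continuous F) : Integrable F (vol g) :=
  hF.integrable_of_hasCompactSupport (HasCompactSupport.of_compactSpace F)

theorem integral_gradInner_eq_neg_integral_mul_laplacian (hF : ContMDiff (𝓡 n) 𝓘(ℝ, ℝ) ∞ F)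
    (hf : ContMDiff (𝓡 n) 𝓘(ℝ, ℝ) ∞ f) :
    ∫ x, gradInner g F f x ∂vol g = - ∫ x, F x * laplacian g f x ∂vol g := by
  obtain ⟨t, -, ht⟩ := isCompact_univ.elim_nhds_subcover
    (fun x₀ : M => (extChartAt (𝓡 n) x₀).source) fun x₀ _ => extChartAt_source_mem_nhds x₀
  obtain ⟨ρ, hρ⟩ := SmoothPartitionOfUnity.exists_isSubordinate (𝓡 n) isClosed_univ
    (fun i : t => (extChartAt (𝓡 n) (i : M)).source) (fun i => isOpen_extChartAt_source _)
    (ht.trans_eq (Set.biUnion_eq_iUnion _ _))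
  have hρF (i : t) : ContMDiff (𝓡 n) 𝓘(ℝ, ℝ) ∞ fun x => ρ i x * F x := (ρ i).contMDiff.mul hF
  have hint (i : t) : Integrable (fun x => ρ i x * F x * laplacian g f x) (vol g) :=
    integrable_vol_of_continuous g ((hρF i).continuous.mul (continuous_laplacian g hf))
  have hsum (x : M) : F x = ∑ i, ρ i x * F x := by
    rw [← Finset.sum_mul, ← finsum_eq_sum_of_fintype, ρ.sum_eq_one (Set.mem_univ x), one_mul]
  have hgrad (x : M) : gradInner g F f x = ∑ i, gradInner g (fun x => ρ i x * F x) f x := by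
    rw [← gradInner_sum_left g _ hρF, ← funext hsum]
  have hmul (x : M) : F x * laplacian g f x = ∑ i, ρ i x * F x * laplacian g f x := by
    rw [← Finset.sum_mul, ← hsum]
  simp only [hgrad, hmul]
  rw [integral_finsetSum _ fun i _ =>
      integrable_vol_of_continuous g (continuous_gradInner g (hρF i) hf),
    integral_finsetSum _ fun i _ => hint i, ← Finset.sum_neg_distrib]
  exact Finset.sum_congr rfl fun i _ => integral_gradInner_of_tsupport_subset_source g _ (hρF i)
    (HasCompactSupport.of_compactSpace _) (tsupport_mul_subset_left.trans (hρ i)) hf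

end Green

section ConformalEnergy

variable {n : ℕ} {M : Type*} [TopologicalSpace M] [ChartedSpace (EuclideanSpace ℝ (Fin n)) M]
  {f φ : M → ℝ}

theorem contMDiff_exp_mul (hf : ContMDiff (𝓡 n) 𝓘(ℝ, ℝ) ∞ f) (k : ℝ) :
    ContMDiff (𝓡 n) 𝓘(ℝ, ℝ) ∞ fun x => Real.exp (k * f x) :=
  (Real.contDiff_exp.comp (contDiff_const.mul contDiff_id)).contMDiff.comp hf

variable [IsManifold (𝓡 n) ∞ M]

section

variable (g : Metric n M)

theorem gradInner_exp_mul_self (hf : ContMDiff (𝓡 n) 𝓘(ℝ, ℝ) ∞ f)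
    (hφ : ContMDiff (𝓡 n) 𝓘(ℝ, ℝ) ∞ φ) (k : ℝ) (x : M) :
    gradInner g (fun x => Real.exp (k * f x) * φ x) (fun x => Real.exp (k * f x) * φ x) x =
      Real.exp (2 * k * f x) * (gradInner g φ φ x + 2 * k * φ x * gradInner g f φ x
        + k ^ 2 * φ x ^ 2 * gradInner g f f x) := by
  have hdf := mdifferentiableAt_of_contMDiff hf x
  have hdφ := mdifferentiableAt_of_contMDiff hφ x
  have hdexp := mdifferentiableAt_of_contMDiff (contMDiff_exp_mul hf k) x
  have hexp : Real.exp (2 * k * f x) = Real.exp (k * f x) * Real.exp (k * f x) := by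
    rw [← Real.exp_add]
    ring_nf
  rw [gradInner_mul_left g hdexp hdφ, gradInner_exp_mul_left g hdf, gradInner_comm g φ,
    gradInner_comm g f fun _ => _, gradInner_mul_left g hdexp hdφ, gradInner_mul_left g hdexp hdφ,
    gradInner_exp_mul_left g hdf, gradInner_exp_mul_left g hdf, gradInner_comm g φ f, hexp]
  ring

theorem gradInner_exp_mul_sq_left (hf : ContMDiff (𝓡 n) 𝓘(ℝ, ℝ) ∞ f)
    (hφ : ContMDiff (𝓡 n) 𝓘(ℝ, ℝ) ∞ φ) (k : ℝ) (x : M) :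
    gradInner g (fun x => Real.exp (k * f x) * (φ x * φ x)) f x =
      Real.exp (k * f x) * (2 * φ x * gradInner g f φ x + k * φ x ^ 2 * gradInner g f f x) := by
  have hdφ := mdifferentiableAt_of_contMDiff hφ x
  have hsq : ContMDiff (𝓡 n) 𝓘(ℝ, ℝ) ∞ fun x => φ x * φ x := hφ.mul hφ
  rw [gradInner_mul_left g (mdifferentiableAt_of_contMDiff (contMDiff_exp_mul hf k) x)
    (mdifferentiableAt_of_contMDiff hsq x), gradInner_mul_left g hdφ hdφ,
    gradInner_exp_mul_left g (mdifferentiableAt_of_contMDiff hf x), gradInner_comm g φ f]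
  ring

/-- The integrand `4 (n-1)/(n-2) |∇φ|² + R_g φ²` of `energy`. -/
def energyDensity (g : Metric n M) (φ : M → ℝ) (x : M) : ℝ :=
  4 * ((n : ℝ) - 1) / ((n : ℝ) - 2) * gradInner g φ φ x + scalarCurvature g x * φ x * φ x

theorem continuous_energyDensity (g : Metric n M) (hφ : ContMDiff (𝓡 n) 𝓘(ℝ, ℝ) ∞ φ) :
    Continuous (energyDensity g φ) :=
  ((continuous_gradInner g hφ hφ).const_mul _).add
    (((continuous_scalarCurvature g).mul hφ.continuous).mul hφ.continuous)

end

/-- With `w = e^{(n-2)f/2}`, the two energy densities differ by the divergence of `w² φ² ∇f`. -/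
theorem IsConformalChange.energyDensity_eq {g h : Metric n M} (hh : IsConformalChange f g h)
    (hn : (n : ℝ) ≠ 2) (hf : ContMDiff (𝓡 n) 𝓘(ℝ, ℝ) ∞ f) (hφ : ContMDiff (𝓡 n) 𝓘(ℝ, ℝ) ∞ φ)
    (x : M) :
    Real.exp (n * f x) * energyDensity h φ x =
      energyDensity g (fun x => Real.exp (((n : ℝ) - 2) / 2 * f x) * φ x) x
        - 2 * ((n : ℝ) - 1) *
          (gradInner g (fun x => Real.exp (((n : ℝ) - 2) * f x) * (φ x * φ x)) f x
            + Real.exp (((n : ℝ) - 2) * f x) * (φ x * φ x) * laplacian g f x) := by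
  have hweight : Real.exp (((n : ℝ) - 2) / 2 * f x) * Real.exp (((n : ℝ) - 2) / 2 * f x) =
      Real.exp (((n : ℝ) - 2) * f x) := by
    rw [← Real.exp_add]
    ring_nf
  have hcurv : scalarCurvature g x * (Real.exp (((n : ℝ) - 2) / 2 * f x) * φ x)
      * (Real.exp (((n : ℝ) - 2) / 2 * f x) * φ x) =
      Real.exp (((n : ℝ) - 2) * f x) * (scalarCurvature g x * φ x ^ 2) := by
    rw [← hweight]
    ring
  have hscale (t : ℝ) : Real.exp (n * f x) * (Real.exp (-(2 * f x)) * t) =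
      Real.exp (((n : ℝ) - 2) * f x) * t := by
    rw [← mul_assoc, ← Real.exp_add]
    ring_nf
  have hn' : (n : ℝ) - 2 ≠ 0 := sub_ne_zero.2 hn
  rw [energyDensity, energyDensity, hh.gradInner_eq, hh.scalarCurvature_eq hf,
    gradInner_exp_mul_self g hf hφ, gradInner_exp_mul_sq_left g hf hφ, hcurv,
    mul_div_cancel₀ _ two_ne_zero, mul_add, mul_left_comm _ (4 * ((n : ℝ) - 1) / _), hscale,
    mul_assoc (Real.exp (-(2 * f x)) * _), mul_assoc (Real.exp (-(2 * f x))), hscale]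
  field_simp
  ring

variable [MeasurableSpace M] [BorelSpace M]

theorem IsConformalChange.integral_vol_eq [LindelofSpace M] {g h : Metric n M}
    (hh : IsConformalChange f g h) (hf : Continuous f) (F : M → ℝ) :
    ∫ x, F x ∂vol h = ∫ x, Real.exp (n * f x) * F x ∂vol g := by
  rw [hh.vol_eq hf, integral_withDensity_eq_integral_toReal_smul (by fun_prop)
    (Eventually.of_forall fun x => ENNReal.ofReal_lt_top)]
  simp only [ENNReal.toReal_ofReal (Real.exp_pos _).le, smul_eq_mul]

/-- The quadratic form `⟨φ, φ⟩_g` on smooth functions, with the classical gradient. -/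
def energy (g : Metric n M) (φ : M → ℝ) : ℝ :=
  4 * ((n : ℝ) - 1) / ((n : ℝ) - 2) * ∫ x, gradInner g φ φ x ∂vol g
    + ∫ x, scalarCurvature g x * φ x * φ x ∂vol g

variable [T2Space M] [CompactSpace M]

theorem energy_eq_integral_energyDensity (g : Metric n M) (hφ : ContMDiff (𝓡 n) 𝓘(ℝ, ℝ) ∞ φ) :
    energy g φ = ∫ x, energyDensity g φ x ∂vol g := by
  have hpotential : Continuous fun x => scalarCurvature g x * φ x * φ x :=
    ((continuous_scalarCurvature g).mul hφ.continuous).mul hφ.continuous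
  simp only [energy, energyDensity]
  rw [integral_add ((integrable_vol_of_continuous g (continuous_gradInner g hφ hφ)).const_mul _)
    (integrable_vol_of_continuous g hpotential), integral_const_mul]

theorem IsConformalChange.energy_eq {g h : Metric n M} (hh : IsConformalChange f g h)
    (hn : (n : ℝ) ≠ 2) (hf : ContMDiff (𝓡 n) 𝓘(ℝ, ℝ) ∞ f) (hφ : ContMDiff (𝓡 n) 𝓘(ℝ, ℝ) ∞ φ) :
    energy h φ = energy g fun x => Real.exp (((n : ℝ) - 2) / 2 * f x) * φ x := by
  have hF : ContMDiff (𝓡 n) 𝓘(ℝ, ℝ) ∞ fun x => Real.exp (((n : ℝ) - 2) * f x) * (φ x * φ x) :=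
    (contMDiff_exp_mul hf _).mul (hφ.mul hφ)
  have hwφ : ContMDiff (𝓡 n) 𝓘(ℝ, ℝ) ∞ fun x => Real.exp (((n : ℝ) - 2) / 2 * f x) * φ x :=
    (contMDiff_exp_mul hf _).mul hφ
  have hgrad := integrable_vol_of_continuous g (continuous_gradInner g hF hf)
  have hlap : Integrable (fun x => Real.exp (((n : ℝ) - 2) * f x) * (φ x * φ x) * laplacian g f x)
      (vol g) := integrable_vol_of_continuous g (hF.continuous.mul (continuous_laplacian g hf))
  have hdiv : Integrable (fun x =>
      gradInner g (fun x => Real.exp (((n : ℝ) - 2) * f x) * (φ x * φ x)) f x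
        + Real.exp (((n : ℝ) - 2) * f x) * (φ x * φ x) * laplacian g f x) (vol g) :=
    hgrad.add hlap
  rw [energy_eq_integral_energyDensity h hφ, energy_eq_integral_energyDensity g hwφ,
    hh.integral_vol_eq hf.continuous]
  simp only [hh.energyDensity_eq hn hf hφ]
  rw [integral_sub (integrable_vol_of_continuous g (continuous_energyDensity g hwφ))
    (hdiv.const_mul _), integral_const_mul, integral_add hgrad hlap,
    integral_gradInner_eq_neg_integral_mul_laplacian g hF hf]
  ring

end ConformalEnergy
section BilinearForms

variable {V : Type*} [AddCommGroup V] [Module ℝ V] {B : LinearMap.BilinForm ℝ V}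

/-- The seminorm `v ↦ √B(v, v)` of a positive semidefinite symmetric bilinear form. -/
def sqrtSeminorm (B : LinearMap.BilinForm ℝ V) (hB : B.IsPosSemidef) : Seminorm ℝ V :=
  Seminorm.of (fun v => √(B v v))
    (fun v w => by
      have hcs : B v w ≤ √(B v v) * √(B w w) := by
        rw [← Real.sqrt_mul (hB.nonneg v)]
        exact Real.le_sqrt_of_sq_le (LinearMap.BilinForm.apply_sq_le_of_symm B hB.nonneg
          (LinearMap.BilinForm.isSymm_iff.1 hB.isSymm) v w)
      refine Real.sqrt_le_iff.2 ⟨by positivity, ?_⟩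
      rw [add_sq, Real.sq_sqrt (hB.nonneg v), Real.sq_sqrt (hB.nonneg w)]
      simp only [map_add, LinearMap.add_apply, hB.isSymm.eq w v]
      linarith)
    (fun c v => by
      rw [map_smul, map_smul, LinearMap.smul_apply, smul_smul, smul_eq_mul,
        Real.sqrt_mul (mul_self_nonneg c), Real.sqrt_mul_self_eq_abs, Real.norm_eq_abs])

theorem sqrtSeminorm_apply (hB : B.IsPosSemidef) (v : V) : sqrtSeminorm B hB v = √(B v v) := rfl

theorem sqrtSeminorm_sq (hB : B.IsPosSemidef) (v : V) : sqrtSeminorm B hB v ^ 2 = B v v :=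
  Real.sq_sqrt (hB.nonneg v)

theorem tendsto_sqrtSeminorm_zero_iff (hB : B.IsPosSemidef) {ι : Type*} {l : Filter ι}
    {v : ι → V} :
    Tendsto (fun k => sqrtSeminorm B hB (v k)) l (𝓝 0) ↔
      Tendsto (fun k => B (v k) (v k)) l (𝓝 0) := by
  refine ⟨fun h => ?_, fun h => ?_⟩
  · simpa [sqrtSeminorm_sq] using h.pow 2
  · simpa [sqrtSeminorm_apply] using h.sqrt

theorem parallelogram_apply (hB : B.IsSymm) (v w : V) :
    B (v + w) (v + w) + B (v - w) (v - w) = 2 * B v v + 2 * B w w := by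
  simp only [map_add, map_sub, LinearMap.add_apply, LinearMap.sub_apply, hB.eq w v]
  ring

theorem apply_add_self_le (hB : B.IsPosSemidef) (v w : V) :
    B (v + w) (v + w) ≤ 2 * B v v + 2 * B w w := by
  linarith [parallelogram_apply hB.isSymm v w, hB.nonneg (v - w)]

theorem apply_sub_self_comm (v w : V) : B (v - w) (v - w) = B (w - v) (w - v) := by
  rw [← neg_sub w v, map_neg, map_neg, LinearMap.neg_apply, neg_neg]

theorem tendsto_apply_self_of_tendsto_sub (hB : B.IsPosSemidef) {ι : Type*} {l : Filter ι}
    {v w : ι → V} {a : ℝ} (hw : Tendsto (fun k => B (w k) (w k)) l (𝓝 a))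
    (hvw : Tendsto (fun k => B (v k - w k) (v k - w k)) l (𝓝 0)) :
    Tendsto (fun k => B (v k) (v k)) l (𝓝 a) := by
  set p := sqrtSeminorm B hB
  have hdiff : Tendsto (fun k => p (v k) - p (w k)) l (𝓝 0) :=
    squeeze_zero_norm (fun k => abs_sub_map_le_sub p (v k) (w k))
      ((tendsto_sqrtSeminorm_zero_iff hB).2 hvw)
  have hroot : Tendsto (fun k => p (w k)) l (𝓝 √a) := hw.sqrt
  rcases l.eq_or_neBot with rfl | _
  · exact tendsto_bot
  have ha : 0 ≤ a := ge_of_tendsto' hw fun k => hB.nonneg _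
  simpa [p, sqrtSeminorm_sq, Real.sq_sqrt ha] using (hdiff.add hroot).pow 2

/-- The sequence `v` is Cauchy for the quadratic form of `B`. -/
def IsCauchyFor (B : LinearMap.BilinForm ℝ V) (v : ℕ → V) : Prop :=
  Tendsto (fun p : ℕ × ℕ => B (v p.1 - v p.2) (v p.1 - v p.2)) atTop (𝓝 0)

theorem IsCauchyFor.eventually_lt {v : ℕ → V} (hv : IsCauchyFor B v) {ε : ℝ} (hε : 0 < ε) :
    ∃ K, ∀ k ≥ K, ∀ m ≥ K, B (v k - v m) (v k - v m) < ε := by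
  obtain ⟨K, hK⟩ := eventually_atTop_prod_self.1 (hv.eventually_lt_const hε)
  exact ⟨K, fun k hk m hm => hK k m hk hm⟩

theorem IsCauchyFor.of_tendsto_sub (hB : B.IsPosSemidef) {v w : ℕ → V} (hv : IsCauchyFor B v)
    (hvw : Tendsto (fun k => B (v k - w k) (v k - w k)) atTop (𝓝 0)) : IsCauchyFor B w := by
  set p := sqrtSeminorm B hB
  have hdist := (tendsto_sqrtSeminorm_zero_iff hB).2 hvw
  refine (tendsto_sqrtSeminorm_zero_iff hB).1 (squeeze_zero (fun _ => apply_nonneg p _)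
    (fun k => ?_) (g := fun k => p (v k.1 - w k.1) + p (v k.1 - v k.2) + p (v k.2 - w k.2)) ?_)
  · rw [map_sub_rev p (v k.1) (w k.1), ← sub_add_sub_cancel (w k.1) (v k.2) (w k.2),
      ← sub_add_sub_cancel (w k.1) (v k.1) (v k.2)]
    exact (map_add_le_add p _ _).trans (add_le_add_left (map_add_le_add p _ _) _)
  · have hv' := (tendsto_sqrtSeminorm_zero_iff hB).2 hv
    rw [← prod_atTop_atTop_eq] at hv' ⊢
    simpa using ((hdist.comp tendsto_fst).add hv').add (hdist.comp tendsto_snd)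

/-- The parallelogram law makes every minimizing sequence in a convex set Cauchy. -/
theorem apply_sub_self_le_of_convex (hB : B.IsSymm) {K : Set V} (hK : Convex ℝ K) {m : ℝ}
    (hm : ∀ z ∈ K, m ≤ B z z) {v w : V} (hv : v ∈ K) (hw : w ∈ K) :
    B (v - w) (v - w) ≤ 2 * (B v v - m) + 2 * (B w w - m) := by
  have hmid := hm _ (hK hv hw (by norm_num) (by norm_num) (add_halves (1 : ℝ)))
  rw [← smul_add] at hmid
  simp only [map_smul, LinearMap.smul_apply, smul_eq_mul] at hmid
  linarith [parallelogram_apply hB v w]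

theorem exists_forall_apply_self_le (hB : B.IsPosSemidef) {K : Set V} (hK : Convex ℝ K)
    (hne : K.Nonempty) (hcomplete : ∀ v : ℕ → V, (∀ k, v k ∈ K) → IsCauchyFor B v →
      ∃ w ∈ K, Tendsto (fun k => B (v k - w) (v k - w)) atTop (𝓝 0)) :
    ∃ w ∈ K, ∀ z ∈ K, B w w ≤ B z z := by
  set m := sInf ((fun z => B z z) '' K)
  have hm : ∀ z ∈ K, m ≤ B z z := fun z hz =>
    csInf_le ⟨0, Set.forall_mem_image.2 fun z _ => hB.nonneg z⟩ (Set.mem_image_of_mem _ hz)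
  obtain ⟨a, -, ha, haK⟩ := exists_seq_tendsto_sInf (hne.image fun z => B z z)
    ⟨0, Set.forall_mem_image.2 fun z _ => hB.nonneg z⟩
  choose v hvK hva using haK
  have hlim : Tendsto (fun k => B (v k) (v k)) atTop (𝓝 m) := by simpa only [hva] using ha
  have hgap : Tendsto (fun k => 2 * (B (v k) (v k) - m)) atTop (𝓝 0) := by
    simpa using (hlim.sub_const m).const_mul 2
  have hcauchy : IsCauchyFor B v := by
    refine squeeze_zero (fun _ => hB.nonneg _)
      (fun k => apply_sub_self_le_of_convex hB.isSymm hK hm (hvK k.1) (hvK k.2)) ?_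
    rw [← prod_atTop_atTop_eq]
    simpa using (hgap.comp tendsto_fst).add (hgap.comp tendsto_snd)
  obtain ⟨w, hwK, hw⟩ := hcomplete v hvK hcauchy
  have hwm : B w w = m := tendsto_nhds_unique (tendsto_const_nhds (f := atTop (α := ℕ)))
    (tendsto_apply_self_of_tendsto_sub hB hlim (by simpa only [apply_sub_self_comm] using hw))
  exact ⟨w, hwK, fun z hz => hwm ▸ hm z hz⟩

end BilinearForms

section Gradient

variable {n : ℕ} {M : Type*} [TopologicalSpace M] [ChartedSpace (EuclideanSpace ℝ (Fin n)) M]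

variable (n M) in
/-- The space `C^∞(M)`. -/
abbrev Smooth : Type _ := ContMDiffMap (𝓡 n) 𝓘(ℝ, ℝ) M ℝ ∞

theorem Smooth.mdifferentiableAt (φ : Smooth n M) (x : M) :
    MDifferentiableAt (𝓡 n) 𝓘(ℝ, ℝ) φ x :=
  mdifferentiableAt_of_contMDiff φ.contMDiff x

variable [IsManifold (𝓡 n) ∞ M]

theorem isPosSemidef_metricForm (g : Metric n M) (x : M) : (metricForm g x).IsPosSemidef where
  eq := g.symm x
  nonneg a := by
    rcases eq_or_ne a 0 with rfl | h
    · simp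
    · exact (g.pos x a h).le

/-- The norm of `T_xM`, bundled as a seminorm; its values are those of `tangentNorm`. -/
def tangentSeminorm (g : Metric n M) (x : M) : Seminorm ℝ (TangentSpace (𝓡 n) x) :=
  sqrtSeminorm (metricForm g x) (isPosSemidef_metricForm g x)

theorem inner_self_nonneg (g : Metric n M) (x : M) (a : TangentSpace (𝓡 n) x) :
    0 ≤ g.inner x a a := (isPosSemidef_metricForm g x).nonneg a

theorem tangentNorm_nonneg (g : Metric n M) (x : M) (a : TangentSpace (𝓡 n) x) :
    0 ≤ tangentNorm g x a := Real.sqrt_nonneg _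

theorem tangentNorm_sq (g : Metric n M) (x : M) (a : TangentSpace (𝓡 n) x) :
    tangentNorm g x a ^ 2 = g.inner x a a := Real.sq_sqrt (inner_self_nonneg g x a)

theorem exists_norm_le_tangentNorm (g : Metric n M) (x : M) :
    ∃ C : ℝ, ∀ v : EuclideanSpace ℝ (Fin n), ‖v‖ ≤ C * tangentNorm g x v := by
  let p : Seminorm ℝ (EuclideanSpace ℝ (Fin n)) := tangentSeminorm g x
  change ∃ C : ℝ, ∀ v, ‖v‖ ≤ C * p v
  have hb : Bornology.IsVonNBounded ℝ
      {v : EuclideanSpace ℝ (Fin n) | (g.inner x v : TangentSpace (𝓡 n) x → ℝ) v < 1} :=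
    g.isVonNBounded x
  obtain ⟨C, hC⟩ := ((NormedSpace.isVonNBounded_iff ℝ).1 hb).exists_norm_le
  refine ⟨2 * C, fun v => ?_⟩
  rcases eq_or_ne v 0 with rfl | hv
  · rw [norm_zero, map_zero, mul_zero]
  have hpos : 0 < p v := Real.sqrt_pos.2 (g.pos x v hv)
  have hunit : ‖(1 / (2 * p v)) • v‖ ≤ C := by
    refine hC _ (?_ : g.inner x _ _ < 1)
    have hhalf : p ((1 / (2 * p v)) • v) = 1 / 2 := by
      rw [map_smul_eq_mul, Real.norm_of_nonneg (by positivity)]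
      field_simp
    refine (tangentNorm_sq g x _).symm.trans_lt ?_
    change p _ ^ 2 < 1
    rw [hhalf]
    norm_num
  rw [norm_smul, Real.norm_of_nonneg (by positivity), one_div,
    inv_mul_le_iff₀ (by positivity)] at hunit
  linarith

theorem exists_tangentNorm_tendsto (g : Metric n M) (x : M) (a : ℕ → TangentSpace (𝓡 n) x)
    (ha : Summable fun j => tangentNorm g x (a (j + 1) - a j)) :
    ∃ X : TangentSpace (𝓡 n) x, ∀ b : TangentSpace (𝓡 n) x,
      Tendsto (fun j => tangentNorm g x (b - a j)) atTop (𝓝 (tangentNorm g x (b - X))) := by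
  obtain ⟨C, hC⟩ := exists_norm_le_tangentNorm g x
  let a' : ℕ → EuclideanSpace ℝ (Fin n) := a
  have hdist : Summable fun j => dist (a' j) (a' (j + 1)) := by
    refine Summable.of_nonneg_of_le (fun _ => dist_nonneg) (fun j => ?_) (ha.mul_left C)
    rw [dist_comm, dist_eq_norm]
    exact hC _
  obtain ⟨X, hX⟩ := cauchySeq_tendsto_of_complete (cauchySeq_of_summable_dist hdist)
  let L : EuclideanSpace ℝ (Fin n) →L[ℝ] EuclideanSpace ℝ (Fin n) →L[ℝ] ℝ := g.inner x
  have hnorm : Continuous fun v => √(L v v) :=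
    Real.continuous_sqrt.comp (L.continuous.clm_apply continuous_id)
  refine ⟨X, fun b => ?_⟩
  let b' : EuclideanSpace ℝ (Fin n) := b
  exact (hnorm.tendsto (b' - X)).comp (hX.const_sub b')

theorem gradient_eq_of_inner (g : Metric n M) {f : M → ℝ} {x : M} {v : TangentSpace (𝓡 n) x}
    (h : ∀ a : TangentSpace (𝓡 n) x, g.inner x v a = mfderiv (𝓡 n) 𝓘(ℝ, ℝ) f x a) :
    gradient g f x = v := by
  rw [← sub_eq_zero]
  refine (metricForm_nondegenerate g x).1 _ fun a => ?_
  rw [map_sub, LinearMap.sub_apply, sub_eq_zero]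
  exact (inner_gradient g f x a).trans (h a).symm

theorem gradient_add (g : Metric n M) {f₁ f₂ : M → ℝ} {x : M}
    (h₁ : MDifferentiableAt (𝓡 n) 𝓘(ℝ, ℝ) f₁ x) (h₂ : MDifferentiableAt (𝓡 n) 𝓘(ℝ, ℝ) f₂ x) :
    gradient g (f₁ + f₂) x = gradient g f₁ x + gradient g f₂ x := by
  refine gradient_eq_of_inner g fun a => ?_
  rw [map_add, FunLike.coe_add, Pi.add_apply, inner_gradient, inner_gradient, mfderiv_add h₁ h₂]
  rfl

theorem gradient_smul (g : Metric n M) (c : ℝ) {f : M → ℝ} {x : M}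
    (hf : MDifferentiableAt (𝓡 n) 𝓘(ℝ, ℝ) f x) :
    gradient g (c • f) x = c • gradient g f x := by
  refine gradient_eq_of_inner g fun a => ?_
  rw [map_smul, FunLike.coe_smul, Pi.smul_apply, inner_gradient, const_smul_mfderiv hf c]
  rfl

theorem gradient_sub (g : Metric n M) (φ ψ : Smooth n M) (x : M) :
    gradient g ⇑(φ - ψ) x = gradient g φ x - gradient g ψ x := by
  have hψ : gradient g ⇑((φ - ψ) + ψ) x = gradient g ⇑(φ - ψ) x + gradient g ψ x :=
    gradient_add g ((φ - ψ).mdifferentiableAt x) (ψ.mdifferentiableAt x)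
  rw [sub_add_cancel] at hψ
  exact eq_sub_of_add_eq hψ.symm

variable [MeasurableSpace M]

theorem integral_gradInner_smul_left (g : Metric n M) (c : ℝ) (φ ψ : Smooth n M) :
    ∫ x, gradInner g ⇑(c • φ) ψ x ∂vol g = c • ∫ x, gradInner g φ ψ x ∂vol g := by
  rw [← integral_smul]
  refine integral_congr_ae (Eventually.of_forall fun x => ?_)
  simp only [gradInner]
  rw [ContMDiffMap.coe_smul, gradient_smul g c (φ.mdifferentiableAt x), map_smul]
  rfl

variable [BorelSpace M] [CompactSpace M] [T2Space M]

theorem Smooth.memLp (g : Metric n M) (φ : Smooth n M) (p : ℝ≥0∞) : MemLp φ p (vol g) :=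
  φ.contMDiff.continuous.memLp_of_hasCompactSupport (HasCompactSupport.of_compactSpace _)

/-- Smooth functions as elements of `L²`. -/
def toL2 (g : Metric n M) : Smooth n M →ₗ[ℝ] Lp ℝ 2 (vol g) where
  toFun φ := (φ.memLp g 2).toLp φ
  map_add' _ _ := rfl
  map_smul' _ _ := rfl

theorem coeFn_toL2 (g : Metric n M) (φ : Smooth n M) : toL2 g φ =ᵐ[vol g] φ :=
  MemLp.coeFn_toLp (φ.memLp g 2)

theorem memLp_scalarCurvature (g : Metric n M) : MemLp (scalarCurvature g) ∞ (vol g) :=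
  (continuous_scalarCurvature g).memLp_of_hasCompactSupport (HasCompactSupport.of_compactSpace _)

/-- Multiplication by the scalar curvature, as an operator on `L²`. -/
def curvatureMul (g : Metric n M) : Lp ℝ 2 (vol g) →L[ℝ] Lp ℝ 2 (vol g) :=
  (ContinuousLinearMap.mul ℝ ℝ).holderL (vol g) ∞ 2 2 ((memLp_scalarCurvature g).toLp _)

theorem coeFn_curvatureMul (g : Metric n M) (u : Lp ℝ 2 (vol g)) :
    curvatureMul g u =ᵐ[vol g] fun x => scalarCurvature g x * u x := by
  have hmul := ContinuousLinearMap.coeFn_holder (r := 2) (ContinuousLinearMap.mul ℝ ℝ)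
    ((memLp_scalarCurvature g).toLp _) u
  filter_upwards [hmul, (memLp_scalarCurvature g).coeFn_toLp] with x hx hR
  refine hx.trans ?_
  rw [hR, ContinuousLinearMap.mul_apply']

/-- The bounded bilinear form `(u, v) ↦ ∫ R_g u v dV_g` on `L²`. -/
def potential (g : Metric n M) : Lp ℝ 2 (vol g) →L[ℝ] Lp ℝ 2 (vol g) →L[ℝ] ℝ :=
  (ContinuousLinearMap.mul ℝ ℝ).lpPairing (vol g) 2 2 ∘L curvatureMul g

theorem potential_apply (g : Metric n M) (u v : Lp ℝ 2 (vol g)) :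
    potential g u v = ∫ x, scalarCurvature g x * u x * v x ∂vol g := by
  rw [potential, ContinuousLinearMap.comp_apply, ContinuousLinearMap.lpPairing_eq_integral]
  refine integral_congr_ae ?_
  filter_upwards [coeFn_curvatureMul g u] with x hx
  rw [hx, ContinuousLinearMap.mul_apply']

theorem integrable_gradInner (g : Metric n M) (φ ψ : Smooth n M) :
    Integrable (gradInner g φ ψ) (vol g) :=
  integrable_vol_of_continuous g (continuous_gradInner g φ.contMDiff ψ.contMDiff)

theorem integral_gradInner_add_left (g : Metric n M) (φ₁ φ₂ ψ : Smooth n M) :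
    ∫ x, gradInner g ⇑(φ₁ + φ₂) ψ x ∂vol g =
      ∫ x, gradInner g φ₁ ψ x ∂vol g + ∫ x, gradInner g φ₂ ψ x ∂vol g := by
  rw [← integral_add (integrable_gradInner g φ₁ ψ) (integrable_gradInner g φ₂ ψ)]
  exact integral_congr_ae (Eventually.of_forall fun x =>
    gradInner_add_left g (φ₁.mdifferentiableAt x) (φ₂.mdifferentiableAt x) ψ)

/-- The Dirichlet form `(φ, ψ) ↦ ∫ g(∇φ, ∇ψ) dV_g` on `C^∞(M)`. -/
def dirichlet (g : Metric n M) : LinearMap.BilinForm ℝ (Smooth n M) :=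
  LinearMap.mk₂ ℝ (fun φ ψ => ∫ x, gradInner g φ ψ x ∂vol g)
    (integral_gradInner_add_left g) (integral_gradInner_smul_left g)
    (fun ψ φ₁ φ₂ => by simpa only [gradInner_comm g ψ] using integral_gradInner_add_left g φ₁ φ₂ ψ)
    (fun c ψ φ => by simpa only [gradInner_comm g ψ] using integral_gradInner_smul_left g c φ ψ)

theorem dirichlet_apply (g : Metric n M) (φ ψ : Smooth n M) :
    dirichlet g φ ψ = ∫ x, gradInner g φ ψ x ∂vol g := rfl

theorem isPosSemidef_dirichlet (g : Metric n M) : (dirichlet g).IsPosSemidef where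
  eq φ ψ := by simp only [dirichlet_apply, gradInner_comm g φ ψ]
  nonneg φ := integral_nonneg fun x => inner_self_nonneg g x _

/-- The quadratic form `energy`, polarized. -/
def energyForm (g : Metric n M) : LinearMap.BilinForm ℝ (Smooth n M) :=
  (4 * ((n : ℝ) - 1) / ((n : ℝ) - 2)) • dirichlet g
    + (potential g).toBilinForm.comp (toL2 g) (toL2 g)

theorem energyForm_apply (g : Metric n M) (φ ψ : Smooth n M) :
    energyForm g φ ψ = 4 * ((n : ℝ) - 1) / ((n : ℝ) - 2) * dirichlet g φ ψ
      + potential g (toL2 g φ) (toL2 g ψ) := rfl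

theorem isSymm_energyForm (g : Metric n M) : (energyForm g).IsSymm where
  eq φ ψ := by
    simp only [energyForm_apply, potential_apply,
      (isPosSemidef_dirichlet g).isSymm.eq φ ψ, mul_right_comm]

theorem energyForm_self (g : Metric n M) (φ : Smooth n M) : energyForm g φ φ = energy g φ := by
  rw [energy, energyForm_apply, dirichlet_apply, potential_apply]
  congr 1
  refine integral_congr_ae ?_
  filter_upwards [coeFn_toL2 g φ] with x hx
  rw [hx]

end Gradient
theorem integral_sq_eq_toReal_eLpNorm_sq {α : Type*} [MeasurableSpace α] {μ : Measure α}
    {f : α → ℝ} (hf : MemLp f 2 μ) : ∫ x, f x ^ 2 ∂μ = (eLpNorm f 2 μ).toReal ^ 2 := by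
  rw [← Lp.norm_toLp f hf, ← real_inner_self_eq_norm_sq, L2.inner_def]
  refine integral_congr_ae ?_
  filter_upwards [hf.coeFn_toLp] with x hx
  rw [hx, real_inner_self_eq_norm_sq, Real.norm_eq_abs, sq_abs]

section Approximation

variable {n : ℕ} {M : Type*} [TopologicalSpace M] [ChartedSpace (EuclideanSpace ℝ (Fin n)) M]
  [IsManifold (𝓡 n) ∞ M]

/-- The length of the gradient of a smooth function. -/
def gradLength (g : Metric n M) (φ : Smooth n M) (x : M) : ℝ := tangentNorm g x (gradient g φ x)

/-- The pointwise distance between `∇φ` and a vector field. -/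
def gradDist (g : Metric n M) (φ : Smooth n M) (X : Π x : M, TangentSpace (𝓡 n) x) (x : M) : ℝ :=
  tangentNorm g x (gradient g φ x - X x)

theorem gradLength_nonneg (g : Metric n M) (φ : Smooth n M) (x : M) : 0 ≤ gradLength g φ x :=
  tangentNorm_nonneg g x _

theorem gradLength_sub (g : Metric n M) (φ ψ : Smooth n M) (x : M) :
    gradLength g (φ - ψ) x = gradDist g φ (gradient g ψ) x := by
  rw [gradLength, gradDist, gradient_sub]

theorem gradLength_sub_comm (g : Metric n M) (φ ψ : Smooth n M) :
    gradLength g (φ - ψ) = gradLength g (ψ - φ) := by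
  ext x
  rw [gradLength_sub, gradLength_sub]
  exact map_sub_rev (tangentSeminorm g x) _ _

theorem gradLength_sub_le (g : Metric n M) (φ ψ : Smooth n M)
    (X : Π x : M, TangentSpace (𝓡 n) x) (x : M) :
    gradLength g (φ - ψ) x ≤ gradDist g φ X x + gradDist g ψ X x := by
  rw [gradLength_sub]
  refine (le_map_sub_add_map_sub (tangentSeminorm g x) _ (X x) _).trans_eq ?_
  rw [map_sub_rev (tangentSeminorm g x) (X x)]
  rfl

theorem abs_gradLength_sub_le (g : Metric n M) (φ : Smooth n M)
    (X : Π x : M, TangentSpace (𝓡 n) x) (x : M) :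
    |gradLength g φ x - tangentNorm g x (X x)| ≤ gradDist g φ X x :=
  abs_sub_map_le_sub (tangentSeminorm g x) _ _

theorem continuous_gradLength (g : Metric n M) (φ : Smooth n M) : Continuous (gradLength g φ) :=
  Real.continuous_sqrt.comp (continuous_gradInner g φ.contMDiff φ.contMDiff)

variable [MeasurableSpace M]

theorem exists_limit_field {g : Metric n M} {ψ : ℕ → Smooth n M}
    (hψ : ∀ᵐ x ∂vol g, Summable fun j =>
      tangentNorm g x (gradient g (ψ (j + 1)) x - gradient g (ψ j) x)) :
    ∃ X : Π x : M, TangentSpace (𝓡 n) x, ∀ j, ∀ᵐ x ∂vol g,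
      Tendsto (fun m => gradLength g (ψ j - ψ m) x) atTop (𝓝 (gradDist g (ψ j) X x)) := by
  have hpoint (x : M) : ∃ Y : TangentSpace (𝓡 n) x, (Summable fun j =>
      tangentNorm g x (gradient g (ψ (j + 1)) x - gradient g (ψ j) x)) →
      ∀ b, Tendsto (fun m => tangentNorm g x (b - gradient g (ψ m) x)) atTop
        (𝓝 (tangentNorm g x (b - Y))) := by
    by_cases hx : Summable fun j =>
      tangentNorm g x (gradient g (ψ (j + 1)) x - gradient g (ψ j) x)
    · obtain ⟨Y, hY⟩ := exists_tangentNorm_tendsto g x (fun j => gradient g (ψ j) x) hx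
      exact ⟨Y, fun _ => hY⟩
    · exact ⟨0, fun h => absurd h hx⟩
  choose X hX using hpoint
  refine ⟨X, fun j => ?_⟩
  filter_upwards [hψ] with x hx
  simp only [gradLength_sub]
  exact hX x hx _

variable [BorelSpace M] [CompactSpace M] [T2Space M]

theorem memLp_gradLength (g : Metric n M) (φ : Smooth n M) : MemLp (gradLength g φ) 2 (vol g) :=
  (continuous_gradLength g φ).memLp_of_hasCompactSupport (HasCompactSupport.of_compactSpace _)

theorem dirichlet_self (g : Metric n M) (φ : Smooth n M) :
    dirichlet g φ φ = (eLpNorm (gradLength g φ) 2 (vol g)).toReal ^ 2 := by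
  rw [← integral_sq_eq_toReal_eLpNorm_sq (memLp_gradLength g φ), dirichlet_apply]
  exact integral_congr_ae (Eventually.of_forall fun x => (tangentNorm_sq g x _).symm)

/-- The sequence `φ` of smooth functions converges to `u` in `L²` and is Cauchy in `H¹`. -/
structure IsApprox (g : Metric n M) (u : Lp ℝ 2 (vol g)) (φ : ℕ → Smooth n M) : Prop where
  tendsto : Tendsto (fun k => toL2 g (φ k)) atTop (𝓝 u)
  cauchy : IsCauchyFor (dirichlet g) φ

theorem toL2_tendsto_iff (g : Metric n M) (u : Lp ℝ 2 (vol g)) (φ : ℕ → Smooth n M) :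
    Tendsto (fun k => toL2 g (φ k)) atTop (𝓝 u) ↔
      Tendsto (fun k => eLpNorm (fun x => φ k x - u x) 2 (vol g)) atTop (𝓝 0) := by
  rw [Lp.tendsto_Lp_iff_tendsto_eLpNorm']
  refine tendsto_congr fun k => eLpNorm_congr_ae ?_
  filter_upwards [coeFn_toL2 g (φ k)] with x hx
  rw [Pi.sub_apply, hx]

theorem isApprox_of_tendsto_gradDist {g : Metric n M} {u : Lp ℝ 2 (vol g)}
    {φ : ℕ → Smooth n M} {X : Π x : M, TangentSpace (𝓡 n) x}
    (hu : Tendsto (fun k => toL2 g (φ k)) atTop (𝓝 u))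
    (hmem : ∀ k, MemLp (gradDist g (φ k) X) 2 (vol g))
    (hlim : Tendsto (fun k => eLpNorm (gradDist g (φ k) X) 2 (vol g)) atTop (𝓝 0)) :
    IsApprox g u φ := by
  refine ⟨hu, ?_⟩
  have hle (p : ℕ × ℕ) : eLpNorm (gradLength g (φ p.1 - φ p.2)) 2 (vol g) ≤
      eLpNorm (gradDist g (φ p.1) X) 2 (vol g) + eLpNorm (gradDist g (φ p.2) X) 2 (vol g) := by
    refine (eLpNorm_mono_real fun x => ?_).trans
      (eLpNorm_add_le (hmem _).1 (hmem _).1 one_le_two)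
    rw [Real.norm_of_nonneg (gradLength_nonneg _ _ _)]
    exact gradLength_sub_le g _ _ X x
  have hsum : Tendsto (fun p : ℕ × ℕ => eLpNorm (gradDist g (φ p.1) X) 2 (vol g)
      + eLpNorm (gradDist g (φ p.2) X) 2 (vol g)) atTop (𝓝 0) := by
    rw [← prod_atTop_atTop_eq]
    simpa using (hlim.comp tendsto_fst).add (hlim.comp tendsto_snd)
  have hzero := tendsto_of_tendsto_of_tendsto_of_le_of_le tendsto_const_nhds hsum
    (fun _ => zero_le) hle
  simp only [IsCauchyFor, dirichlet_self]
  simpa using ((ENNReal.tendsto_toReal ENNReal.zero_ne_top).comp hzero).pow 2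

theorem memLp_tangentNorm_of_tendsto_gradDist {g : Metric n M} {φ : ℕ → Smooth n M}
    {X : Π x : M, TangentSpace (𝓡 n) x} (hmem : ∀ k, MemLp (gradDist g (φ k) X) 2 (vol g))
    (hlim : Tendsto (fun k => eLpNorm (gradDist g (φ k) X) 2 (vol g)) atTop (𝓝 0)) :
    MemLp (fun x => tangentNorm g x (X x)) 2 (vol g) := by
  have hmeas : AEStronglyMeasurable (fun x => tangentNorm g x (X x)) (vol g) := by
    have hconv : TendstoInMeasure (vol g) (fun k => gradDist g (φ k) X) atTop 0 :=
      tendstoInMeasure_of_tendsto_eLpNorm two_ne_zero (fun k => (hmem k).1)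
        aestronglyMeasurable_zero (by simpa only [sub_zero] using hlim)
    obtain ⟨ns, -, hns⟩ := hconv.exists_seq_tendsto_ae
    refine aestronglyMeasurable_of_tendsto_ae atTop
      (fun j => (memLp_gradLength g (φ (ns j))).1) ?_
    filter_upwards [hns] with x hx
    rw [tendsto_iff_dist_tendsto_zero]
    exact squeeze_zero (fun _ => dist_nonneg) (fun j => abs_gradLength_sub_le g _ X x) hx
  refine ((memLp_gradLength g (φ 0)).add (hmem 0)).mono' hmeas (Eventually.of_forall fun x => ?_)
  rw [Real.norm_of_nonneg (tangentNorm_nonneg _ _ _), Pi.add_apply]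
  linarith [(abs_sub_le_iff.1 (abs_gradLength_sub_le g (φ 0) X x)).2]

theorem tendsto_dirichlet_of_tendsto_gradDist {g : Metric n M} {φ : ℕ → Smooth n M}
    {X : Π x : M, TangentSpace (𝓡 n) x} (hmem : ∀ k, MemLp (gradDist g (φ k) X) 2 (vol g))
    (hlim : Tendsto (fun k => eLpNorm (gradDist g (φ k) X) 2 (vol g)) atTop (𝓝 0)) :
    Tendsto (fun k => dirichlet g (φ k) (φ k)) atTop
      (𝓝 (∫ x, g.inner x (X x) (X x) ∂vol g)) := by
  have hX := memLp_tangentNorm_of_tendsto_gradDist hmem hlim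
  have hlength : Tendsto (fun k => (memLp_gradLength g (φ k)).toLp _) atTop
      (𝓝 (hX.toLp _)) := by
    rw [Lp.tendsto_Lp_iff_tendsto_eLpNorm'']
    exact tendsto_of_tendsto_of_tendsto_of_le_of_le tendsto_const_nhds hlim (fun _ => zero_le)
      fun k => eLpNorm_mono_real (abs_gradLength_sub_le g (φ k) X)
  simpa only [Lp.norm_toLp, ← dirichlet_self, ← integral_sq_eq_toReal_eLpNorm_sq hX,
    tangentNorm_sq] using hlength.norm.pow 2

theorem HasWeakGradient.exists_isApprox {g : Metric n M} {u : Lp ℝ 2 (vol g)}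
    {X : Π x : M, TangentSpace (𝓡 n) x} (h : HasWeakGradient g u X) :
    ∃ φ, IsApprox g u φ ∧ Tendsto (fun k => dirichlet g (φ k) (φ k)) atTop
      (𝓝 (∫ x, g.inner x (X x) (X x) ∂vol g)) := by
  obtain ⟨φ₀, hφ₀, hu, hmem, hlim⟩ := h
  let φ : ℕ → Smooth n M := fun k => ⟨φ₀ k, hφ₀ k⟩
  exact ⟨φ, isApprox_of_tendsto_gradDist ((toL2_tendsto_iff g u φ).2 hu) hmem hlim,
    tendsto_dirichlet_of_tendsto_gradDist hmem hlim⟩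

/-- Green's formula moves the gradient off `θ k`. -/
theorem tendsto_dirichlet_zero (g : Metric n M) {θ : ℕ → Smooth n M}
    (hθ : Tendsto (fun k => toL2 g (θ k)) atTop (𝓝 0)) (ψ : Smooth n M) :
    Tendsto (fun k => dirichlet g (θ k) ψ) atTop (𝓝 0) := by
  have hlap : MemLp (laplacian g ψ) 2 (vol g) := (continuous_laplacian g
    ψ.contMDiff).memLp_of_hasCompactSupport (HasCompactSupport.of_compactSpace _)
  have hgreen (k : ℕ) : dirichlet g (θ k) ψ = -inner ℝ (toL2 g (θ k)) (hlap.toLp _) := by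
    rw [dirichlet_apply, integral_gradInner_eq_neg_integral_mul_laplacian g (θ k).contMDiff
      ψ.contMDiff, L2.inner_def, neg_inj]
    refine integral_congr_ae ?_
    filter_upwards [coeFn_toL2 g (θ k), hlap.coeFn_toLp] with x hx hlapx
    rw [hx, hlapx, real_inner_eq_re_inner, mul_comm]
    rfl
  simpa [hgreen] using (hθ.inner (𝕜 := ℝ) (tendsto_const_nhds (x := hlap.toLp _))).neg

theorem IsApprox.dirichlet_tendsto_zero {g : Metric n M} {θ : ℕ → Smooth n M}
    (h : IsApprox g 0 θ) : Tendsto (fun k => dirichlet g (θ k) (θ k)) atTop (𝓝 0) := by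
  have hD := isPosSemidef_dirichlet g
  refine Metric.tendsto_atTop.2 fun ε hε => ?_
  obtain ⟨K, hK⟩ := h.cauchy.eventually_lt (half_pos hε)
  refine ⟨K, fun k hk => ?_⟩
  rw [Real.dist_0_eq_abs, abs_of_nonneg (hD.nonneg _)]
  have hexpand (m : ℕ) : dirichlet g (θ k) (θ k) ≤
      dirichlet g (θ k - θ m) (θ k - θ m) + 2 * dirichlet g (θ m) (θ k) := by
    simp only [map_sub, LinearMap.sub_apply, hD.isSymm.eq (θ k) (θ m)]
    linarith [hD.nonneg (θ m)]
  have hle : dirichlet g (θ k) (θ k) ≤ ε / 2 + 2 * 0 := by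
    refine ge_of_tendsto (((tendsto_dirichlet_zero g h.tendsto (θ k)).const_mul 2).const_add _) ?_
    filter_upwards [eventually_ge_atTop K] with m hm
    exact (hexpand m).trans (by linarith [hK k hk m hm])
  linarith

theorem ae_summable_tangentNorm {g : Metric n M} {ψ : ℕ → Smooth n M}
    (hψ : ∀ j m, j ≤ m →
      eLpNorm (gradLength g (ψ j - ψ m)) 2 (vol g) ≤ ENNReal.ofReal ((1 / 2) ^ j)) :
    ∀ᵐ x ∂vol g, Summable fun j =>
      tangentNorm g x (gradient g (ψ (j + 1)) x - gradient g (ψ j) x) := by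
  have hmeas (j : ℕ) : AEMeasurable (fun x => ‖gradLength g (ψ (j + 1) - ψ j) x‖ₑ) (vol g) :=
    (continuous_gradLength g _).measurable.enorm.aemeasurable
  have hterm (j : ℕ) : ∫⁻ x, ‖gradLength g (ψ (j + 1) - ψ j) x‖ₑ ∂vol g ≤
      ENNReal.ofReal ((1 / 2) ^ j) * vol g Set.univ ^ (1 / (1 : ℝ≥0∞).toReal
        - 1 / (2 : ℝ≥0∞).toReal) := by
    rw [← eLpNorm_one_eq_lintegral_enorm]
    refine (eLpNorm_le_eLpNorm_mul_rpow_measure_univ one_le_two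
      (memLp_gradLength g _).1).trans ?_
    gcongr
    rw [gradLength_sub_comm]
    exact hψ j (j + 1) j.le_succ
  have hfin : ∫⁻ x, ∑' j, ‖gradLength g (ψ (j + 1) - ψ j) x‖ₑ ∂vol g ≠ ⊤ := by
    rw [lintegral_tsum hmeas]
    refine ((ENNReal.tsum_le_tsum hterm).trans_lt ?_).ne
    rw [ENNReal.tsum_mul_right,
      ← ENNReal.ofReal_tsum_of_nonneg (fun j => by positivity) summable_geometric_two]
    exact ENNReal.mul_lt_top ENNReal.ofReal_lt_top
      (ENNReal.rpow_lt_top_of_nonneg (by norm_num) (measure_ne_top _ _))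
  filter_upwards [ae_lt_top' (AEMeasurable.tsum hmeas) hfin] with x hx
  refine (ENNReal.summable_toReal hx.ne).congr fun j => ?_
  rw [gradLength_sub, toReal_enorm]
  exact Real.norm_of_nonneg (tangentNorm_nonneg _ _ _)

theorem IsApprox.exists_fast_subseq {g : Metric n M} {u : Lp ℝ 2 (vol g)} {φ : ℕ → Smooth n M}
    (h : IsApprox g u φ) : ∃ s : ℕ → ℕ, StrictMono s ∧ ∀ j m, j ≤ m →
      eLpNorm (gradLength g (φ (s j) - φ (s m))) 2 (vol g) ≤ ENNReal.ofReal ((1 / 2) ^ j) := by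
  have htail (j : ℕ) : ∀ᶠ k in atTop, ∀ l ≥ k,
      eLpNorm (gradLength g (φ k - φ l)) 2 (vol g) ≤ ENNReal.ofReal ((1 / 2) ^ j) := by
    obtain ⟨K, hK⟩ := h.cauchy.eventually_lt (show (0 : ℝ) < ((1 / 2) ^ j) ^ 2 by positivity)
    filter_upwards [eventually_ge_atTop K] with k hk l hl
    have hlt := hK k hk l (hk.trans hl)
    rw [dirichlet_self] at hlt
    rw [ENNReal.le_ofReal_iff_toReal_le (memLp_gradLength g _).2.ne (by positivity)]
    exact (lt_of_pow_lt_pow_left₀ 2 (by positivity) hlt).le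
  obtain ⟨s, hs, hsb⟩ := extraction_forall_of_eventually htail
  exact ⟨s, hs, fun j m hjm => hsb j _ (hs.monotone hjm)⟩

theorem IsApprox.exists_hasWeakGradient {g : Metric n M} {u : Lp ℝ 2 (vol g)}
    {φ : ℕ → Smooth n M} (h : IsApprox g u φ) : ∃ X, HasWeakGradient g u X := by
  obtain ⟨s, hs, hfast⟩ := h.exists_fast_subseq
  obtain ⟨X, hX⟩ := exists_limit_field (ae_summable_tangentNorm hfast)
  have hmeas (j : ℕ) : AEStronglyMeasurable (gradDist g (φ (s j)) X) (vol g) :=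
    aestronglyMeasurable_of_tendsto_ae atTop (fun _ => (memLp_gradLength g _).1) (hX j)
  have hbound (j : ℕ) :
      eLpNorm (gradDist g (φ (s j)) X) 2 (vol g) ≤ ENNReal.ofReal ((1 / 2) ^ j) := by
    refine (Lp.eLpNorm_lim_le_liminf_eLpNorm (fun _ => (memLp_gradLength g _).1) _
      (hX j)).trans (liminf_le_of_frequently_le' (Eventually.frequently ?_))
    filter_upwards [eventually_ge_atTop j] with m hm
    exact hfast j m hm
  have hgeom : Tendsto (fun j : ℕ => ENNReal.ofReal ((1 / 2) ^ j)) atTop (𝓝 0) := by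
    simpa using ENNReal.tendsto_ofReal (tendsto_pow_atTop_nhds_zero_of_lt_one
      (r := (1 / 2 : ℝ)) (by norm_num) (by norm_num))
  exact ⟨X, fun j => φ (s j), fun j => (φ (s j)).contMDiff,
    (toL2_tendsto_iff g u _).1 (h.tendsto.comp hs.tendsto_atTop),
    fun j => ⟨hmeas j, (hbound j).trans_lt ENNReal.ofReal_lt_top⟩,
    tendsto_of_tendsto_of_tendsto_of_le_of_le tendsto_const_nhds hgeom (fun _ => zero_le) hbound⟩

theorem mem_H1_iff {g : Metric n M} {u : Lp ℝ 2 (vol g)} : u ∈ H1 g ↔ ∃ φ, IsApprox g u φ :=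
  ⟨fun ⟨_, hX⟩ => let ⟨φ, hφ, _⟩ := hX.exists_isApprox; ⟨φ, hφ⟩,
    fun ⟨_, hφ⟩ => hφ.exists_hasWeakGradient⟩

theorem IsApprox.add {g : Metric n M} {u v : Lp ℝ 2 (vol g)} {φ ψ : ℕ → Smooth n M}
    (hu : IsApprox g u φ) (hv : IsApprox g v ψ) : IsApprox g (u + v) fun k => φ k + ψ k where
  tendsto := by simpa only [map_add] using hu.tendsto.add hv.tendsto
  cauchy := by
    have hlim := (hu.cauchy.const_mul 2).add (hv.cauchy.const_mul 2)
    rw [mul_zero, add_zero] at hlim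
    refine squeeze_zero (fun _ => (isPosSemidef_dirichlet g).nonneg _) (fun p => ?_) hlim
    rw [add_sub_add_comm]
    exact apply_add_self_le (isPosSemidef_dirichlet g) _ _

theorem IsApprox.smul {g : Metric n M} {u : Lp ℝ 2 (vol g)} {φ : ℕ → Smooth n M} (t : ℝ)
    (hu : IsApprox g u φ) : IsApprox g (t • u) fun k => t • φ k where
  tendsto := by simpa only [map_smul] using hu.tendsto.const_smul t
  cauchy := by
    have hlim := (hu.cauchy.const_mul t).const_mul t
    simp only [mul_zero] at hlim
    simpa only [IsCauchyFor, ← smul_sub, map_smul, LinearMap.smul_apply, smul_eq_mul] using hlim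

theorem IsApprox.sub {g : Metric n M} {u v : Lp ℝ 2 (vol g)} {φ ψ : ℕ → Smooth n M}
    (hu : IsApprox g u φ) (hv : IsApprox g v ψ) : IsApprox g (u - v) fun k => φ k - ψ k := by
  simpa only [neg_one_smul, ← sub_eq_add_neg] using hu.add (hv.smul (-1))

theorem isApprox_const (g : Metric n M) (φ : Smooth n M) : IsApprox g (toL2 g φ) fun _ => φ where
  tendsto := tendsto_const_nhds
  cauchy := by simp [IsCauchyFor]

theorem IsApprox.tendsto_energyForm_self {g : Metric n M} {u : Lp ℝ 2 (vol g)}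
    {φ : ℕ → Smooth n M} (h : IsApprox g u φ) :
    Tendsto (fun k => energyForm g (φ k) (φ k)) atTop (𝓝 (form g u u)) := by
  have hX : HasWeakGradient g u (weakGradient g u) := by
    rw [weakGradient, dif_pos h.exists_hasWeakGradient]
    exact h.exists_hasWeakGradient.choose_spec
  obtain ⟨ψ, hψ, hlim⟩ := hX.exists_isApprox
  have hzero : IsApprox g 0 fun k => φ k - ψ k := sub_self u ▸ h.sub hψ
  have hdirichlet := tendsto_apply_self_of_tendsto_sub (isPosSemidef_dirichlet g) hlim
    hzero.dirichlet_tendsto_zero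
  have hpotential := ((potential g).continuous₂.tendsto (u, u)).comp
    (h.tendsto.prodMk_nhds h.tendsto)
  rw [form, ← potential_apply]
  exact (hdirichlet.const_mul _).add hpotential

end Approximation

section SobolevSpace

variable {n : ℕ} {M : Type*} [TopologicalSpace M] [ChartedSpace (EuclideanSpace ℝ (Fin n)) M]
  [IsManifold (𝓡 n) ∞ M] [MeasurableSpace M] [BorelSpace M] [CompactSpace M] [T2Space M]

/-- `H¹(M, g)` as a linear subspace of `L²(M, g)`. -/
def sobolev (g : Metric n M) : Submodule ℝ (Lp ℝ 2 (vol g)) where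
  carrier := H1 g
  add_mem' hu hv := by
    obtain ⟨⟨φ, hφ⟩, ψ, hψ⟩ := And.intro (mem_H1_iff.1 hu) (mem_H1_iff.1 hv)
    exact mem_H1_iff.2 ⟨_, hφ.add hψ⟩
  zero_mem' := mem_H1_iff.2 ⟨_, map_zero (toL2 g) ▸ isApprox_const g 0⟩
  smul_mem' t u hu := by
    obtain ⟨φ, hφ⟩ := mem_H1_iff.1 hu
    exact mem_H1_iff.2 ⟨_, hφ.smul t⟩

theorem IsApprox.tendsto_energyForm {g : Metric n M} {u v : Lp ℝ 2 (vol g)}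
    {φ ψ : ℕ → Smooth n M} (hu : IsApprox g u φ) (hv : IsApprox g v ψ) :
    Tendsto (fun k => energyForm g (φ k) (ψ k)) atTop
      (𝓝 (QuadraticMap.polar (fun w => form g w w) u v / 2)) := by
  refine ((((hu.add hv).tendsto_energyForm_self.sub hu.tendsto_energyForm_self).sub
    hv.tendsto_energyForm_self).div_const 2).congr fun k => ?_
  simp only [map_add, LinearMap.add_apply, (isSymm_energyForm g).eq (ψ k) (φ k)]
  ring

theorem polar_form_add_left {g : Metric n M} (u₁ u₂ v : sobolev g) :
    QuadraticMap.polar (fun w => form g w w) (u₁ + u₂ : Lp ℝ 2 (vol g)) v / 2 =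
      QuadraticMap.polar (fun w => form g w w) (u₁ : Lp ℝ 2 (vol g)) v / 2
        + QuadraticMap.polar (fun w => form g w w) (u₂ : Lp ℝ 2 (vol g)) v / 2 := by
  obtain ⟨φ₁, h₁⟩ := mem_H1_iff.1 u₁.2
  obtain ⟨φ₂, h₂⟩ := mem_H1_iff.1 u₂.2
  obtain ⟨ψ, hψ⟩ := mem_H1_iff.1 v.2
  refine tendsto_nhds_unique ((h₁.add h₂).tendsto_energyForm hψ) ?_
  simpa only [map_add, LinearMap.add_apply] using
    (h₁.tendsto_energyForm hψ).add (h₂.tendsto_energyForm hψ)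

theorem polar_form_smul_left {g : Metric n M} (t : ℝ) (u v : sobolev g) :
    QuadraticMap.polar (fun w => form g w w) (t • u : Lp ℝ 2 (vol g)) v / 2 =
      t • (QuadraticMap.polar (fun w => form g w w) (u : Lp ℝ 2 (vol g)) v / 2) := by
  obtain ⟨φ, hφ⟩ := mem_H1_iff.1 u.2
  obtain ⟨ψ, hψ⟩ := mem_H1_iff.1 v.2
  refine tendsto_nhds_unique ((hφ.smul t).tendsto_energyForm hψ) ?_
  simpa only [map_smul, LinearMap.smul_apply] using (hφ.tendsto_energyForm hψ).const_smul t

/-- The polarization of the quadratic form `u ↦ form g u u` on `H¹(M, g)`. -/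
def sobolevForm (g : Metric n M) : LinearMap.BilinForm ℝ (sobolev g) :=
  LinearMap.mk₂ ℝ (fun u v => QuadraticMap.polar (fun w => form g w w) (u : Lp ℝ 2 (vol g)) v / 2)
    polar_form_add_left polar_form_smul_left
    (fun u v₁ v₂ => by
      simpa only [QuadraticMap.polar_comm _ (u : Lp ℝ 2 (vol g)), Submodule.coe_add] using
        polar_form_add_left v₁ v₂ u)
    (fun t u v => by
      simpa only [QuadraticMap.polar_comm _ (u : Lp ℝ 2 (vol g)), Submodule.coe_smul] using
        polar_form_smul_left t v u)

theorem isSymm_sobolevForm (g : Metric n M) : (sobolevForm g).IsSymm where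
  eq u v := congrArg (· / 2) (QuadraticMap.polar_comm (fun w => form g w w) (u : Lp ℝ 2 (vol g)) v)

theorem sobolevForm_self {g : Metric n M} (u : sobolev g) : sobolevForm g u u = form g u u := by
  obtain ⟨φ, hφ⟩ := mem_H1_iff.1 u.2
  exact tendsto_nhds_unique (hφ.tendsto_energyForm hφ) hφ.tendsto_energyForm_self

end SobolevSpace
theorem gradCoeff_pos {n : ℕ} (hn : 3 ≤ n) : 0 < 4 * ((n : ℝ) - 1) / ((n : ℝ) - 2) := by
  have : (3 : ℝ) ≤ n := by exact_mod_cast hn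
  exact div_pos (by linarith) (by linarith)

section Coercivity

variable {n : ℕ} {M : Type*} [TopologicalSpace M] [ChartedSpace (EuclideanSpace ℝ (Fin n)) M]
  [IsManifold (𝓡 n) ∞ M] [MeasurableSpace M]

/-- The quadratic form `u ↦ ⟨u, u⟩_g` on `H¹(M, g)` controls the norm of `L²(M, g)`. -/
def IsL2Coercive (g : Metric n M) : Prop := ∃ c > 0, ∀ u ∈ H1 g, c * ‖u‖ ^ 2 ≤ form g u u

variable {g : Metric n M}

theorem IsL2Coercive.form_self_nonneg (hg : IsL2Coercive g) {u : Lp ℝ 2 (vol g)} (hu : u ∈ H1 g) :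
    0 ≤ form g u u := by
  obtain ⟨c, hc, hcoercive⟩ := hg
  exact (by positivity : 0 ≤ c * ‖u‖ ^ 2).trans (hcoercive u hu)

variable [BorelSpace M] [CompactSpace M] [T2Space M]

theorem toL2_mem_H1 (g : Metric n M) (φ : Smooth n M) : toL2 g φ ∈ H1 g :=
  mem_H1_iff.2 ⟨_, isApprox_const g φ⟩

/-- The inclusion `C^∞(M) → H¹(M, g)`. -/
def toSobolev (g : Metric n M) : Smooth n M →ₗ[ℝ] sobolev g :=
  (toL2 g).codRestrict (sobolev g) (toL2_mem_H1 g)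

theorem sobolevForm_toSobolev_self (g : Metric n M) (φ : Smooth n M) :
    sobolevForm g (toSobolev g φ) (toSobolev g φ) = energyForm g φ φ :=
  (sobolevForm_self _).trans
    (tendsto_nhds_unique (isApprox_const g φ).tendsto_energyForm_self tendsto_const_nhds)

theorem tendsto_potential_self_zero {ι : Type*} {l : Filter ι} {u : ι → Lp ℝ 2 (vol g)}
    (hu : Tendsto u l (𝓝 0)) : Tendsto (fun k => potential g (u k) (u k)) l (𝓝 0) := by
  have hlim := ((potential g).continuous₂.tendsto (0, 0)).comp (hu.prodMk_nhds hu)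
  simpa only [Function.comp_def, Function.uncurry_apply_pair, map_zero] using hlim

theorem IsApprox.isCauchyFor_energyForm {u : Lp ℝ 2 (vol g)} {φ : ℕ → Smooth n M}
    (h : IsApprox g u φ) : IsCauchyFor (energyForm g) φ := by
  have hdiff : Tendsto (fun p : ℕ × ℕ => toL2 g (φ p.1 - φ p.2)) atTop (𝓝 0) := by
    rw [← prod_atTop_atTop_eq]
    simpa only [map_sub, sub_self, Function.comp_def] using
      (h.tendsto.comp tendsto_fst).sub (h.tendsto.comp tendsto_snd)
  simpa only [IsCauchyFor, energyForm_apply, mul_zero, add_zero] using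
    (h.cauchy.const_mul (4 * ((n : ℝ) - 1) / ((n : ℝ) - 2))).add (tendsto_potential_self_zero hdiff)

theorem IsApprox.tendsto_form_sub {u : Lp ℝ 2 (vol g)} {φ : ℕ → Smooth n M}
    (h : IsApprox g u φ) :
    Tendsto (fun k => form g (u - toL2 g (φ k)) (u - toL2 g (φ k))) atTop (𝓝 0) := by
  refine Metric.tendsto_atTop.2 fun ε hε => ?_
  have habs := h.isCauchyFor_energyForm.abs
  rw [abs_zero] at habs
  obtain ⟨K, hK⟩ := eventually_atTop_prod_self.1 (habs.eventually_lt_const (half_pos hε))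
  refine ⟨K, fun j hj => ?_⟩
  rw [Real.dist_0_eq_abs]
  refine (le_of_tendsto (h.sub (isApprox_const g (φ j))).tendsto_energyForm_self.abs ?_).trans_lt
    (half_lt_self hε)
  filter_upwards [eventually_ge_atTop K] with k hk
  exact (hK k j hk hj).le

namespace IsL2Coercive

theorem isPosSemidef_sobolevForm (hg : IsL2Coercive g) : (sobolevForm g).IsPosSemidef where
  eq := (isSymm_sobolevForm g).eq
  nonneg u := (hg.form_self_nonneg u.2).trans_eq (sobolevForm_self u).symm

theorem tendsto_zero (hg : IsL2Coercive g) {ι : Type*} {l : Filter ι} {v : ι → sobolev g}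
    (hv : Tendsto (fun k => sobolevForm g (v k) (v k)) l (𝓝 0)) : Tendsto v l (𝓝 0) := by
  obtain ⟨c, hc, hcoercive⟩ := hg
  have hsqrt : Tendsto (fun k => √(sobolevForm g (v k) (v k) / c)) l (𝓝 0) := by
    simpa using (hv.div_const c).sqrt
  refine squeeze_zero_norm (fun k => Real.le_sqrt_of_sq_le ?_) hsqrt
  rw [le_div_iff₀' hc, sobolevForm_self]
  exact hcoercive _ (v k).2

theorem exists_isApprox (hg : IsL2Coercive g) (hn : 3 ≤ n) {ψ : ℕ → Smooth n M}
    (hψ : IsCauchyFor (energyForm g) ψ) : ∃ w, IsApprox g w ψ := by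
  have hdiff : Tendsto (fun p : ℕ × ℕ => toL2 g (ψ p.1 - ψ p.2)) atTop (𝓝 0) :=
    tendsto_subtype_rng.1 (hg.tendsto_zero (v := fun p : ℕ × ℕ => toSobolev g (ψ p.1 - ψ p.2))
      (hψ.congr fun p => (sobolevForm_toSobolev_self g (ψ p.1 - ψ p.2)).symm))
  have hcauchy : CauchySeq fun k => toL2 g (ψ k) := by
    rw [cauchySeq_iff_tendsto_dist_atTop_0]
    simpa only [map_sub, dist_eq_norm, norm_zero] using hdiff.norm
  obtain ⟨w, hw⟩ := cauchySeq_tendsto_of_complete hcauchy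
  refine ⟨w, hw, ?_⟩
  simpa only [IsCauchyFor, energyForm_apply, add_sub_cancel_right,
    mul_div_cancel_left₀ _ (gradCoeff_pos hn).ne', sub_zero, zero_div] using
    (hψ.sub (tendsto_potential_self_zero hdiff)).div_const (4 * ((n : ℝ) - 1) / ((n : ℝ) - 2))

theorem exists_tendsto (hg : IsL2Coercive g) (hn : 3 ≤ n) {v : ℕ → sobolev g}
    (hv : IsCauchyFor (sobolevForm g) v) :
    ∃ w, Tendsto (fun k => sobolevForm g (v k - w) (v k - w)) atTop (𝓝 0) := by
  have hB := hg.isPosSemidef_sobolevForm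
  have hdense (k : ℕ) : ∃ ψ, sobolevForm g (v k - toSobolev g ψ) (v k - toSobolev g ψ)
      < 1 / ((k : ℝ) + 1) := by
    obtain ⟨φ, hφ⟩ := mem_H1_iff.1 (v k).2
    obtain ⟨j, hj⟩ := (hφ.tendsto_form_sub.eventually_lt_const
      (show (0 : ℝ) < 1 / ((k : ℝ) + 1) by positivity)).exists
    exact ⟨φ j, (sobolevForm_self _).trans_lt hj⟩
  choose ψ hψ using hdense
  have hclose : Tendsto (fun k => sobolevForm g (v k - toSobolev g (ψ k))
      (v k - toSobolev g (ψ k))) atTop (𝓝 0) :=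
    squeeze_zero (fun _ => hB.nonneg _) (fun k => (hψ k).le) tendsto_one_div_add_atTop_nhds_zero_nat
  have hcauchy : IsCauchyFor (energyForm g) ψ := by
    simpa only [IsCauchyFor, ← map_sub, sobolevForm_toSobolev_self] using
      hv.of_tendsto_sub hB hclose
  obtain ⟨w, hw⟩ := hg.exists_isApprox hn hcauchy
  let W : sobolev g := ⟨w, mem_H1_iff.2 ⟨ψ, hw⟩⟩
  have hlim : Tendsto (fun k => sobolevForm g (W - toSobolev g (ψ k)) (W - toSobolev g (ψ k)))
      atTop (𝓝 0) :=
    hw.tendsto_form_sub.congr fun k => (sobolevForm_self (W - toSobolev g (ψ k))).symm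
  have hsum := (hclose.const_mul 2).add (hlim.const_mul 2)
  rw [mul_zero, add_zero] at hsum
  refine ⟨W, squeeze_zero (fun _ => hB.nonneg _) (fun k => ?_) hsum⟩
  rw [← sub_add_sub_cancel (v k) (toSobolev g (ψ k)) W]
  refine (apply_add_self_le hB _ _).trans_eq ?_
  rw [apply_sub_self_comm _ W]

end IsL2Coercive

end Coercivity
section Regularization

/-- The smooth positive regularization `√(t² + ε²)` of `|t|`. -/
def regAbs (ε t : ℝ) : ℝ := √(t ^ 2 + ε ^ 2)

variable {ε : ℝ}

theorem regAbs_pos (hε : 0 < ε) (t : ℝ) : 0 < regAbs ε t := Real.sqrt_pos.2 (by positivity)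

theorem abs_le_regAbs (ε t : ℝ) : |t| ≤ regAbs ε t := Real.abs_le_sqrt (by nlinarith)

theorem regAbs_mul_self (ε t : ℝ) : regAbs ε t * regAbs ε t = t ^ 2 + ε ^ 2 :=
  Real.mul_self_sqrt (by positivity)

theorem contDiff_regAbs (hε : 0 < ε) : ContDiff ℝ ∞ (regAbs ε) :=
  ContDiff.sqrt (by fun_prop) fun t => by positivity

theorem hasDerivAt_regAbs (hε : 0 < ε) (t : ℝ) : HasDerivAt (regAbs ε) (t / regAbs ε t) t := by
  have hsq : HasDerivAt (fun t : ℝ => t ^ 2 + ε ^ 2) (2 * t) t := by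
    simpa using (hasDerivAt_pow 2 t).add_const (ε ^ 2)
  have hsqrt : HasDerivAt (regAbs ε) (2 * t / (2 * regAbs ε t)) t := hsq.sqrt (by positivity)
  rwa [mul_div_mul_left _ _ two_ne_zero] at hsqrt

variable {n : ℕ} {M : Type*} [TopologicalSpace M] [ChartedSpace (EuclideanSpace ℝ (Fin n)) M]
  [IsManifold (𝓡 n) ∞ M]

theorem gradInner_regAbs_le (hε : 0 < ε) (g : Metric n M) (φ : Smooth n M) (x : M) :
    gradInner g (fun y => regAbs ε (φ y)) (fun y => regAbs ε (φ y)) x ≤ gradInner g φ φ x := by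
  have hchain (f : M → ℝ) : gradInner g (fun y => regAbs ε (φ y)) f x =
      φ x / regAbs ε (φ x) * gradInner g φ f x :=
    gradInner_comp_left g (hasDerivAt_regAbs hε (φ x)) (φ.mdifferentiableAt x) f
  rw [hchain, gradInner_comm, hchain, ← mul_assoc]
  refine mul_le_of_le_one_left (inner_self_nonneg g x _) ?_
  rw [← abs_mul_abs_self, abs_div, abs_of_pos (regAbs_pos hε _)]
  have hle : |φ x| / regAbs ε (φ x) ≤ 1 := (div_le_one (regAbs_pos hε _)).2 (abs_le_regAbs ε _)
  have hnonneg : 0 ≤ |φ x| / regAbs ε (φ x) := div_nonneg (abs_nonneg _) (regAbs_pos hε _).le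
  exact mul_le_one₀ hle hnonneg hle

/-- The smooth function `√(φ² + ε²)`. -/
def regularize (φ : Smooth n M) (hε : 0 < ε) : Smooth n M :=
  ⟨fun x => regAbs ε (φ x), (contDiff_regAbs hε).contMDiff.comp φ.contMDiff⟩

variable [MeasurableSpace M] [BorelSpace M] [T2Space M] [CompactSpace M]

theorem energy_regularize_le (hn : 3 ≤ n) (hε : 0 < ε) (g : Metric n M) (φ : Smooth n M) :
    energy g (regularize φ hε) ≤ energy g φ + ε ^ 2 * ∫ x, scalarCurvature g x ∂vol g := by
  have hR := continuous_scalarCurvature g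
  have hφ := φ.contMDiff.continuous
  have hpotential : ∫ x, scalarCurvature g x * regularize φ hε x * regularize φ hε x ∂vol g =
      ∫ x, scalarCurvature g x * φ x * φ x ∂vol g + ε ^ 2 * ∫ x, scalarCurvature g x ∂vol g := by
    have hint : Integrable (fun x => scalarCurvature g x * φ x * φ x) (vol g) :=
      integrable_vol_of_continuous g ((hR.mul hφ).mul hφ)
    rw [← integral_const_mul,
      ← integral_add hint ((integrable_vol_of_continuous g hR).const_mul _)]
    refine integral_congr_ae (Eventually.of_forall fun x => ?_)
    have hsq := regAbs_mul_self ε (φ x)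
    change scalarCurvature g x * regAbs ε (φ x) * regAbs ε (φ x) = _
    rw [mul_assoc, hsq]
    ring
  have hgrad : ∫ x, gradInner g (regularize φ hε) (regularize φ hε) x ∂vol g ≤
      ∫ x, gradInner g φ φ x ∂vol g :=
    integral_mono (integrable_gradInner g _ _) (integrable_gradInner g φ φ)
      (gradInner_regAbs_le hε g φ)
  rw [energy, energy, hpotential, ← add_assoc]
  have := (gradCoeff_pos hn).le
  gcongr

end Regularization

section Yamabe

theorem two_le_critExp {n : ℕ} (hn : 3 ≤ n) : 2 ≤ critExp n := by
  have : (3 : ℝ) ≤ n := by exact_mod_cast hn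
  rw [critExp, le_div_iff₀ (by linarith)]
  linarith

variable {n : ℕ} {M : Type*} [TopologicalSpace M] [ChartedSpace (EuclideanSpace ℝ (Fin n)) M]
  [IsManifold (𝓡 n) ∞ M]

theorem exists_isConformalChange_of_mem_conformalClass {g h : Metric n M}
    (hh : h ∈ conformalClass g) :
    ∃ f : M → ℝ, ContMDiff (𝓡 n) 𝓘(ℝ, ℝ) ∞ f ∧ IsConformalChange f g h := by
  obtain ⟨w, hw, hpos, hin⟩ := hh
  refine ⟨fun x => 2 / ((n : ℝ) - 2) * Real.log (w x), fun x => ?_, fun x a b => ?_⟩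
  · have : ContDiffAt ℝ ∞ (fun t : ℝ => 2 / ((n : ℝ) - 2) * Real.log t) (w x) :=
      contDiffAt_const.mul (Real.contDiffAt_log.2 (hpos x).ne')
    exact this.contMDiffAt.comp x (hw x)
  · rw [hin, Real.rpow_def_of_pos (hpos x)]
    congr 2
    ring

variable [MeasurableSpace M] {g h : Metric n M}

theorem normLp_ne_zero_and_yamabeInvariant_mul_sq_le_form (hY : 0 < yamabeInvariant g)
    {u : Lp ℝ 2 (vol g)} (hu : u ∈ H1pos g) : normLp g (critExp n) u ≠ 0 ∧
      yamabeInvariant g * normLp g (critExp n) u ^ 2 ≤ form g u u := by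
  have hbdd : BddBelow (Set.range fun u : H1pos g => yamabeFunctional g u) := by
    by_contra hunbdd
    exact hY.ne' (Real.sInf_of_not_bddBelow hunbdd)
  have hle : yamabeInvariant g ≤ yamabeFunctional g u := ciInf_le hbdd ⟨u, hu⟩
  have hne : normLp g (critExp n) u ≠ 0 := fun hzero => by
    have hpos := hY.trans_le hle
    rw [yamabeFunctional, hzero, zero_pow two_ne_zero, div_zero] at hpos
    exact hpos.false
  exact ⟨hne, (le_div_iff₀ (by positivity)).1 hle⟩

theorem IsConformalChange.eLpNorm_critExp_eq [BorelSpace M] [LindelofSpace M] {f : M → ℝ}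
    (hh : IsConformalChange f g h) (hn : 3 ≤ n) (hf : Continuous f) (φ : M → ℝ) :
    eLpNorm φ (ENNReal.ofReal (critExp n)) (vol h) =
      eLpNorm (fun x => Real.exp (((n : ℝ) - 2) / 2 * f x) * φ x)
        (ENNReal.ofReal (critExp n)) (vol g) := by
  have hq : 0 < critExp n := two_pos.trans_le (two_le_critExp hn)
  have hweight : (n : ℝ) = ((n : ℝ) - 2) / 2 * critExp n := by
    have : (n : ℝ) - 2 ≠ 0 := by
      have : (3 : ℝ) ≤ n := by exact_mod_cast hn
      linarith
    rw [critExp]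
    field_simp
  rw [eLpNorm_eq_lintegral_rpow_enorm_toReal (by simpa using hq) ENNReal.ofReal_ne_top,
    eLpNorm_eq_lintegral_rpow_enorm_toReal (by simpa using hq) ENNReal.ofReal_ne_top, hh.vol_eq hf,
    ENNReal.toReal_ofReal hq.le, lintegral_withDensity_eq_lintegral_mul_non_measurable _
      (by fun_prop) (Eventually.of_forall fun x => ENNReal.ofReal_lt_top)]
  congr 1
  refine lintegral_congr fun x => ?_
  rw [Pi.mul_apply, enorm_mul, ENNReal.mul_rpow_of_nonneg _ _ hq.le,
    Real.enorm_of_nonneg (Real.exp_pos _).le, ENNReal.ofReal_rpow_of_pos (Real.exp_pos _),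
    ← Real.exp_mul, mul_right_comm, ← hweight]

variable [BorelSpace M] [T2Space M] [CompactSpace M]

theorem yamabeInvariant_mul_sq_lpNorm_le_energy_of_abs_le (hY : 0 < yamabeInvariant g)
    {φ ψ : Smooth n M} (hψ : ∀ x, 0 < ψ x) (hφψ : ∀ x, |φ x| ≤ ψ x) :
    yamabeInvariant g * lpNorm φ (ENNReal.ofReal (critExp n)) (vol g) ^ 2 ≤ energy g ψ := by
  have hmem : toL2 g ψ ∈ H1pos g := by
    refine ⟨toL2_mem_H1 g ψ, ?_⟩
    filter_upwards [coeFn_toL2 g ψ] with x hx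
    exact hx ▸ hψ x
  have hnorm : lpNorm φ (ENNReal.ofReal (critExp n)) (vol g) ≤
      normLp g (critExp n) (toL2 g ψ) := by
    rw [normLp, ← toReal_eLpNorm (φ.memLp g 2).1, ← toReal_eLpNorm (Lp.aestronglyMeasurable _),
      eLpNorm_congr_ae (coeFn_toL2 g ψ)]
    exact ENNReal.toReal_mono (ψ.memLp g _).2.ne (eLpNorm_mono_real hφψ)
  have hform : form g (toL2 g ψ) (toL2 g ψ) = energy g ψ :=
    (tendsto_nhds_unique (isApprox_const g ψ).tendsto_energyForm_self tendsto_const_nhds).trans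
      (energyForm_self g ψ)
  calc yamabeInvariant g * lpNorm φ (ENNReal.ofReal (critExp n)) (vol g) ^ 2
      ≤ yamabeInvariant g * normLp g (critExp n) (toL2 g ψ) ^ 2 := by
        gcongr
        exact lpNorm_nonneg
    _ ≤ form g (toL2 g ψ) (toL2 g ψ) :=
        (normLp_ne_zero_and_yamabeInvariant_mul_sq_le_form hY hmem).2
    _ = energy g ψ := hform

theorem yamabeInvariant_mul_sq_lpNorm_le_energy (hn : 3 ≤ n) (hY : 0 < yamabeInvariant g)
    (φ : Smooth n M) :
    yamabeInvariant g * lpNorm φ (ENNReal.ofReal (critExp n)) (vol g) ^ 2 ≤ energy g φ := by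
  have hlim : Tendsto (fun ε : ℝ => energy g φ + ε ^ 2 * ∫ x, scalarCurvature g x ∂vol g)
      (𝓝[>] 0) (𝓝 (energy g φ)) :=
    (Continuous.tendsto' (by fun_prop) 0 _ (by simp)).mono_left nhdsWithin_le_nhds
  refine ge_of_tendsto hlim ?_
  filter_upwards [self_mem_nhdsWithin] with ε hε
  exact (yamabeInvariant_mul_sq_lpNorm_le_energy_of_abs_le hY (ψ := regularize φ hε)
    (fun x => regAbs_pos hε _) fun x => abs_le_regAbs ε _).trans (energy_regularize_le hn hε g φ)

theorem yamabeInvariant_mul_sq_lpNorm_le_energy_of_mem_conformalClass (hn : 3 ≤ n)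
    (hY : 0 < yamabeInvariant g) (hh : h ∈ conformalClass g) (φ : Smooth n M) :
    yamabeInvariant g * lpNorm φ (ENNReal.ofReal (critExp n)) (vol h) ^ 2 ≤ energy h φ := by
  obtain ⟨f, hf, hgh⟩ := exists_isConformalChange_of_mem_conformalClass hh
  have hn2 : (n : ℝ) ≠ 2 := by exact_mod_cast (by omega : n ≠ 2)
  let ψ : Smooth n M := ⟨fun x => Real.exp (((n : ℝ) - 2) / 2 * f x) * φ x,
    (contMDiff_exp_mul hf _).mul φ.contMDiff⟩
  rw [hgh.energy_eq hn2 hf φ.contMDiff, ← toReal_eLpNorm (φ.memLp h 2).1,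
    hgh.eLpNorm_critExp_eq hn hf.continuous]
  exact (toReal_eLpNorm (ψ.memLp g 2).1).symm ▸ yamabeInvariant_mul_sq_lpNorm_le_energy hn hY ψ

theorem form_self_nonneg (hn : 3 ≤ n) (hY : 0 < yamabeInvariant g) (hh : h ∈ conformalClass g)
    {u : Lp ℝ 2 (vol h)} (hu : u ∈ H1 h) : 0 ≤ form h u u := by
  obtain ⟨φ, hφ⟩ := mem_H1_iff.1 hu
  refine ge_of_tendsto' hφ.tendsto_energyForm_self fun k => ?_
  rw [energyForm_self]
  exact (by positivity : (0 : ℝ) ≤ _).trans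
    (yamabeInvariant_mul_sq_lpNorm_le_energy_of_mem_conformalClass hn hY hh (φ k))

theorem eLpNorm_critExp_le_of_mem_H1 (hn : 3 ≤ n) (hY : 0 < yamabeInvariant g)
    (hh : h ∈ conformalClass g) {u : Lp ℝ 2 (vol h)} (hu : u ∈ H1 h) :
    eLpNorm u (ENNReal.ofReal (critExp n)) (vol h) ≤
      ENNReal.ofReal √(form h u u / yamabeInvariant g) := by
  obtain ⟨φ, hφ⟩ := mem_H1_iff.1 hu
  obtain ⟨s, hs, hae⟩ := (tendstoInMeasure_of_tendsto_Lp hφ.tendsto).exists_seq_tendsto_ae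
  refine (Lp.eLpNorm_lim_le_liminf_eLpNorm
    (fun m => Lp.aestronglyMeasurable (toL2 h (φ (s m)))) _ hae).trans ?_
  have hlim : Tendsto (fun m => ENNReal.ofReal √(energy h (φ (s m)) / yamabeInvariant g)) atTop
      (𝓝 (ENNReal.ofReal √(form h u u / yamabeInvariant g))) := by
    simp only [← energyForm_self]
    exact ENNReal.tendsto_ofReal
      ((hφ.tendsto_energyForm_self.comp hs.tendsto_atTop).div_const _).sqrt
  rw [← hlim.liminf_eq]
  refine liminf_le_liminf (Eventually.of_forall fun m => ?_)
  simp only [eLpNorm_congr_ae (coeFn_toL2 h (φ (s m)))]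
  rw [← ofReal_lpNorm ((φ (s m)).memLp h _)]
  refine ENNReal.ofReal_le_ofReal (Real.le_sqrt_of_sq_le ((le_div_iff₀' hY).2 ?_))
  exact yamabeInvariant_mul_sq_lpNorm_le_energy_of_mem_conformalClass hn hY hh _

theorem memLp_critExp_of_mem_H1 (hn : 3 ≤ n) (hY : 0 < yamabeInvariant g)
    (hh : h ∈ conformalClass g) {u : Lp ℝ 2 (vol h)} (hu : u ∈ H1 h) :
    MemLp u (ENNReal.ofReal (critExp n)) (vol h) :=
  ⟨Lp.aestronglyMeasurable u,
    (eLpNorm_critExp_le_of_mem_H1 hn hY hh hu).trans_lt ENNReal.ofReal_lt_top⟩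

theorem isL2Coercive_of_mem_conformalClass (hn : 3 ≤ n) (hY : 0 < yamabeInvariant g)
    (hh : h ∈ conformalClass g) : IsL2Coercive h := by
  set q := ENNReal.ofReal (critExp n)
  have hq : (2 : ℝ≥0∞) ≤ q := by
    rw [← ENNReal.ofReal_ofNat]
    exact ENNReal.ofReal_le_ofReal (two_le_critExp hn)
  set V : ℝ := (vol h Set.univ ^ (1 / (2 : ℝ≥0∞).toReal - 1 / q.toReal)).toReal
  have hV : vol h Set.univ ^ (1 / (2 : ℝ≥0∞).toReal - 1 / q.toReal) ≠ ⊤ := by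
    refine ENNReal.rpow_ne_top_of_nonneg (sub_nonneg.2 ?_) (measure_ne_top _ _)
    exact one_div_le_one_div_of_le (by simp) (ENNReal.toReal_mono ENNReal.ofReal_ne_top hq)
  refine ⟨yamabeInvariant g / (V ^ 2 + 1), by positivity, fun u hu => ?_⟩
  have hform := form_self_nonneg hn hY hh hu
  have hnorm : ‖u‖ ≤ √(form h u u / yamabeInvariant g) * V := by
    have hholder := eLpNorm_le_eLpNorm_mul_rpow_measure_univ hq (Lp.aestronglyMeasurable u)
    rw [Lp.norm_def, ← ENNReal.toReal_ofReal (Real.sqrt_nonneg _), ← ENNReal.toReal_mul]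
    refine ENNReal.toReal_mono (ENNReal.mul_ne_top ENNReal.ofReal_ne_top hV) (hholder.trans ?_)
    gcongr
    exact eLpNorm_critExp_le_of_mem_H1 hn hY hh hu
  rw [div_mul_eq_mul_div, div_le_iff₀ (by positivity)]
  calc yamabeInvariant g * ‖u‖ ^ 2
      ≤ yamabeInvariant g * (√(form h u u / yamabeInvariant g) * V) ^ 2 := by gcongr
    _ = form h u u * V ^ 2 := by
        rw [mul_pow, Real.sq_sqrt (by positivity)]
        field_simp
    _ ≤ form h u u * (V ^ 2 + 1) := by gcongr; linarith

theorem vol_ne_zero_of_mem_conformalClass (hY : 0 < yamabeInvariant g)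
    (hh : h ∈ conformalClass g) : vol h ≠ 0 := by
  have hg : vol g ≠ 0 := fun hzero => by
    have hmem : toL2 g (1 : Smooth n M) ∈ H1pos g := by
      refine ⟨toL2_mem_H1 g 1, ?_⟩
      filter_upwards [coeFn_toL2 g 1] with x hx
      exact hx ▸ one_pos
    refine (normLp_ne_zero_and_yamabeInvariant_mul_sq_le_form hY hmem).1 ?_
    have hnorm : eLpNorm (toL2 g 1) (ENNReal.ofReal (critExp n)) (vol g) = 0 :=
      le_zero_iff.1 ((eLpNorm_mono_measure _ hzero.le).trans eLpNorm_measure_zero.le)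
    rw [normLp, ← toReal_eLpNorm (Lp.aestronglyMeasurable _), hnorm, ENNReal.toReal_zero]
  obtain ⟨f, hf, hgh⟩ := exists_isConformalChange_of_mem_conformalClass hh
  have hac : vol g ≪ vol h := by
    have hcont := hf.continuous
    rw [hgh.vol_eq hcont]
    exact withDensity_absolutelyContinuous' (by fun_prop)
      (Eventually.of_forall fun x => (ENNReal.ofReal_pos.2 (Real.exp_pos _)).ne')
  exact fun hzero => hg (Measure.absolutelyContinuous_zero_iff.1 (hzero ▸ hac))

end Yamabe
section Obstacle

theorem convex_Ici_Lp {α : Type*} [MeasurableSpace α] {μ : Measure α} {p : ℝ≥0∞}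
    (u : Lp ℝ p μ) : Convex ℝ (Set.Ici u) := by
  intro v hv w hw a b ha hb hab
  have huv := (Lp.coeFn_le u v).2 hv
  have huw := (Lp.coeFn_le u w).2 hw
  refine (Lp.coeFn_le _ _).1 ?_
  filter_upwards [huv, huw, Lp.coeFn_add (a • v) (b • w), Lp.coeFn_smul a v, Lp.coeFn_smul b w]
    with x hxv hxw hadd hav hbw
  rw [hadd, Pi.add_apply, hav, hbw]
  exact convex_Ici (u x) hxv hxw ha hb hab

variable {n : ℕ} {M : Type*} [TopologicalSpace M] [ChartedSpace (EuclideanSpace ℝ (Fin n)) M]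
  [IsManifold (𝓡 n) ∞ M] [MeasurableSpace M] {h : Metric n M} {u v w : Lp ℝ 2 (vol h)}

theorem mem_H1pos_of_le (hu : u ∈ H1pos h) (hv : v ∈ H1 h) (huv : u ≤ v) : v ∈ H1pos h := by
  refine ⟨hv, ?_⟩
  filter_upwards [hu.2, (Lp.coeFn_le u v).2 huv] with x hpos hle
  exact hpos.trans_le hle

theorem normLp_pos {q : ℝ} (hq : 0 < q) (hpos : ∀ᵐ x ∂vol h, 0 < u x)
    (hu : MemLp u (ENNReal.ofReal q) (vol h)) (hvol : vol h ≠ 0) : 0 < normLp h q u := by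
  refine lpNorm_nonneg.lt_of_ne' fun hzero => hvol (ae_eq_bot.1 (eventually_false_iff_eq_bot.1 ?_))
  filter_upwards [(lpNorm_eq_zero hu (ENNReal.ofReal_pos.2 hq).ne').1 hzero, hpos] with x hx hxpos
  exact hxpos.ne' hx

theorem IsObstacleSolution.self (hv : IsObstacleSolution h u v) : IsObstacleSolution h v v :=
  ⟨⟨hv.1.1, le_rfl⟩, fun z hz hvz => hv.2 z hz (hv.1.2.trans hvz)⟩

theorem IsL2Coercive.formNorm_sq (hh : IsL2Coercive h) (hu : u ∈ H1 h) :
    formNorm h u ^ 2 = form h u u :=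
  Real.sq_sqrt (hh.form_self_nonneg hu)

variable [BorelSpace M] [T2Space M] [CompactSpace M]

theorem convex_setOf_le_sobolev (u : Lp ℝ 2 (vol h)) : Convex ℝ {v : sobolev h | u ≤ v} :=
  (convex_Ici_Lp u).linear_preimage (sobolev h).subtype

namespace IsL2Coercive

theorem exists_isObstacleSolution (hh : IsL2Coercive h) (hn : 3 ≤ n) (hu : u ∈ H1pos h) :
    ∃ v, IsObstacleSolution h u v := by
  have hclosed (v : ℕ → sobolev h) (hle : ∀ k, u ≤ v k) (hv : IsCauchyFor (sobolevForm h) v) :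
      ∃ w : sobolev h, u ≤ w ∧
        Tendsto (fun k => sobolevForm h (v k - w) (v k - w)) atTop (𝓝 0) := by
    obtain ⟨w, hw⟩ := hh.exists_tendsto hn hv
    have hlim : Tendsto v atTop (𝓝 w) := tendsto_sub_nhds_zero_iff.1 (hh.tendsto_zero hw)
    exact ⟨w, ge_of_tendsto' (tendsto_subtype_rng.1 hlim) hle, hw⟩
  obtain ⟨v, huv, hmin⟩ := exists_forall_apply_self_le hh.isPosSemidef_sobolevForm
    (convex_setOf_le_sobolev u) ⟨⟨u, hu.1⟩, le_refl u⟩ hclosed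
  refine ⟨v, ⟨mem_H1pos_of_le hu v.2 huv, huv⟩, fun z hz huz => ?_⟩
  simpa only [sobolevForm_self] using hmin ⟨z, hz.1⟩ huz

theorem eq_of_isObstacleSolution (hh : IsL2Coercive h) (hu : u ∈ H1pos h)
    (hv : IsObstacleSolution h u v) (hw : IsObstacleSolution h u w) : v = w := by
  let V : sobolev h := ⟨v, hv.1.1.1⟩
  let W : sobolev h := ⟨w, hw.1.1.1⟩
  have hmin {y : Lp ℝ 2 (vol h)} (hy : IsObstacleSolution h u y) (z : sobolev h)
      (huz : z ∈ {v : sobolev h | u ≤ v}) : form h y y ≤ sobolevForm h z z :=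
    (hy.2 z (mem_H1pos_of_le hu z.2 huz) huz).trans_eq (sobolevForm_self z).symm
  have hle : form h (v - w) (v - w) ≤ 0 := by
    have hdist := apply_sub_self_le_of_convex (isSymm_sobolevForm h) (convex_setOf_le_sobolev u)
      (hmin hv) (v := V) (w := W) hv.1.2 hw.1.2
    simp only [sobolevForm_self] at hdist
    have hwv : form h w w ≤ form h v v := hw.2 v hv.1.1 hv.1.2
    exact hdist.trans (by linarith)
  obtain ⟨c, hc, hcoercive⟩ := hh
  have hnorm : c * ‖v - w‖ ^ 2 ≤ 0 := (hcoercive _ (V - W).2).trans hle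
  have hsq : ‖v - w‖ ^ 2 ≤ 0 := nonpos_of_mul_nonpos_right hnorm hc
  exact sub_eq_zero.1 (norm_eq_zero.1 (sq_eq_zero_iff.1 (hsq.antisymm (by positivity))))

theorem isObstacleSolution_obstacleMap (hh : IsL2Coercive h) (hn : 3 ≤ n) (hu : u ∈ H1pos h) :
    IsObstacleSolution h u (obstacleMap h u) :=
  Classical.epsilon_spec (hh.exists_isObstacleSolution hn hu)

theorem obstacleMap_eq (hh : IsL2Coercive h) (hn : 3 ≤ n) (hu : u ∈ H1pos h)
    (hv : IsObstacleSolution h u v) : obstacleMap h u = v :=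
  hh.eq_of_isObstacleSolution hu (hh.isObstacleSolution_obstacleMap hn hu) hv

theorem obstacleMap_obstacleMap (hh : IsL2Coercive h) (hn : 3 ≤ n) (hu : u ∈ H1pos h) :
    obstacleMap h (obstacleMap h u) = obstacleMap h u :=
  have hT := hh.isObstacleSolution_obstacleMap hn hu
  hh.obstacleMap_eq hn hT.1.1 hT.self

theorem form_obstacleMap_le (hh : IsL2Coercive h) (hn : 3 ≤ n) (hu : u ∈ H1pos h) :
    form h (obstacleMap h u) (obstacleMap h u) ≤ form h u u :=
  (hh.isObstacleSolution_obstacleMap hn hu).2 u hu le_rfl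

theorem obstacleMap_eq_self_of_form_le (hh : IsL2Coercive h) (hn : 3 ≤ n) (hu : u ∈ H1pos h)
    (hle : form h u u ≤ form h (obstacleMap h u) (obstacleMap h u)) : obstacleMap h u = u :=
  hh.obstacleMap_eq hn hu ⟨⟨hu, le_rfl⟩, fun z hz huz =>
    hle.trans ((hh.isObstacleSolution_obstacleMap hn hu).2 z hz huz)⟩

theorem controlFunctional_sub_eq (hh : IsL2Coercive h) (hn : 3 ≤ n) (hu : u ∈ H1pos h) (p : ℝ) :
    controlFunctional h p u - controlFunctional h p (obstacleMap h u) =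
      1 / normLp h (p + 1) (obstacleMap h u) ^ 2 *
        (formNorm h u ^ 2 - formNorm h (obstacleMap h u) ^ 2) := by
  rw [controlFunctional, controlFunctional, hh.obstacleMap_obstacleMap hn hu, hh.formNorm_sq hu.1,
    hh.formNorm_sq (hh.isObstacleSolution_obstacleMap hn hu).1.1.1]
  ring

end IsL2Coercive

end Obstacle
end ConformalObstacle

end

theorem lemma6p1_general {n : ℕ} (hn : 3 ≤ n) {M : Type*} [TopologicalSpace M] [T2Space M]
    [CompactSpace M] [ChartedSpace (EuclideanSpace ℝ (Fin n)) M] [IsManifold (𝓡 n) ∞ M]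
    [MeasurableSpace M] [BorelSpace M]
    (g h : ConformalObstacle.Metric n M) (hY : 0 < yamabeInvariant g) (hh : h ∈ conformalClass g)
    (p : ℝ) (hp : -1 < p) (hp' : p ≤ critExp n - 1)
    (u : Lp ℝ 2 (vol h)) (hu : u ∈ H1pos h) :
    (IsObstacleSolution h u (obstacleMap h u) ∧
      ∀ v, IsObstacleSolution h u v → v = obstacleMap h u) ∧
    MemLp (obstacleMap h u) (ENNReal.ofReal (p + 1)) (vol h) ∧
    0 < normLp h (p + 1) (obstacleMap h u) ∧
    controlFunctional h p u - controlFunctional h p (obstacleMap h u)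
      = 1 / normLp h (p + 1) (obstacleMap h u) ^ 2
        * (formNorm h u ^ 2 - formNorm h (obstacleMap h u) ^ 2) ∧
    0 ≤ 1 / normLp h (p + 1) (obstacleMap h u) ^ 2
        * (formNorm h u ^ 2 - formNorm h (obstacleMap h u) ^ 2) ∧
    (controlFunctional h p u = controlFunctional h p (obstacleMap h u) → obstacleMap h u = u) := by
  have hco := isL2Coercive_of_mem_conformalClass hn hY hh
  have hT := hco.isObstacleSolution_obstacleMap hn hu
  have hle := hco.form_obstacleMap_le hn hu
  have hmem : MemLp (obstacleMap h u) (ENNReal.ofReal (p + 1)) (vol h) :=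
    (memLp_critExp_of_mem_H1 hn hY hh hT.1.1.1).mono_exponent
      (ENNReal.ofReal_le_ofReal (by linarith))
  have hpos : 0 < normLp h (p + 1) (obstacleMap h u) :=
    normLp_pos (by linarith) hT.1.1.2 hmem (vol_ne_zero_of_mem_conformalClass hY hh)
  have hdiff := hco.controlFunctional_sub_eq hn hu p
  refine ⟨⟨hT, fun v hv => (hco.obstacleMap_eq hn hu hv).symm⟩, hmem, hpos, hdiff, ?_,
    fun heq => ?_⟩
  · rw [hco.formNorm_sq hu.1, hco.formNorm_sq hT.1.1.1]
    exact mul_nonneg (by positivity) (sub_nonneg.2 hle)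
  · have hform : form h u u = form h (obstacleMap h u) (obstacleMap h u) := by
      rw [controlFunctional, controlFunctional, hco.obstacleMap_obstacleMap hn hu] at heq
      exact (div_left_inj' (by positivity)).1 heq
    exact hco.obstacleMap_eq_self_of_form_le hn hu hform.le

theorem lemma6p1 {n : ℕ} (hn : 3 ≤ n) {M : Type*} [TopologicalSpace M] [T2Space M] [CompactSpace M]
    [ChartedSpace (EuclideanSpace ℝ (Fin n)) M] [IsManifold (𝓡 n) ∞ M]
    [MeasurableSpace M] [BorelSpace M]
    (g h : ConformalObstacle.Metric n M) (hY : 0 < yamabeInvariant g) (hh : h ∈ conformalClass g)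
    (p : ℝ) (hp : 1 ≤ p) (hp' : p ≤ critExp n - 1)
    (u : Lp ℝ 2 (vol h)) (hu : u ∈ H1pos h) :
    -- `T_h(u)` is the unique solution of the obstacle problem, and its norm is finite and nonzero
    (IsObstacleSolution h u (obstacleMap h u) ∧
      ∀ v, IsObstacleSolution h u v → v = obstacleMap h u) ∧
    MemLp (obstacleMap h u) (ENNReal.ofReal (p + 1)) (vol h) ∧
    0 < normLp h (p + 1) (obstacleMap h u) ∧
    -- the monotonicity formula
    controlFunctional h p u - controlFunctional h p (obstacleMap h u)
      = 1 / normLp h (p + 1) (obstacleMap h u) ^ 2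
        * (formNorm h u ^ 2 - formNorm h (obstacleMap h u) ^ 2) ∧
    0 ≤ 1 / normLp h (p + 1) (obstacleMap h u) ^ 2
        * (formNorm h u ^ 2 - formNorm h (obstacleMap h u) ^ 2) ∧
    -- rigidity
    (controlFunctional h p u = controlFunctional h p (obstacleMap h u) → obstacleMap h u = u) :=
  lemma6p1_general hn g h hY hh p (by linarith) hp' u hu
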